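/- Everything is of class $C^\infty$. Let $(M,\xi,\tilde\xi)_\pm$ be a pair of transverse contact distributions on a 3-manifold $M$, commonly oriented (sign $+$) or oppositely oriented (sign $-$), with axis $A=\xi\cap\tilde\xi$. Contact forms $\alpha,\tilde\alpha$ for $\xi,\tilde\xi$ are *balanced* if $\alpha\wedge d\alpha=\pm\tilde\alpha\wedge d\tilde\alpha$. Suppose that $A$ is oriented, and let $X$ be the normalized field spanning $A$: locally $i_X(\alpha\wedge d\alpha)=\alpha\wedge\tilde\alpha$ for balanced contact forms, which are then determined up to a common non-zero factor; below, all balanced contact forms are normalized in this way. Write $f'=Xf$, and let $I:M\to\mathbb R$ be the generating invariant, $I\,\alpha\wedge d\alpha=\alpha\wedge d\tilde\alpha+\tilde\alpha\wedge d\alpha$. Let $\mathcal S$ be the Schwarzian invariant: the quadratic form on $A$ whose value at $m\in M$ is the pullback by $\delta_m$ of the Schwarzian derivative of $\tilde\delta_m\circ\delta_m^{-1}$ at $\delta_m(m)$, where $\delta_m,\tilde\delta_m$ map a point $\varphi_t(m)$ of the integral curve of $A$ through $m$ to $\varphi_{-t,*}\xi_{\varphi_t(m)}$, resp. $\varphi_{-t,*}\tilde\xi_{\varphi_t(m)}$,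 in $\mathbb P(T_mM/A_m)$, and $\varphi_t$ is the flow of a vector field spanning $A$. Suppose that $\mathcal S\equiv0$, that $dI\neq0$ everywhere, and that $dI$ does not vanish identically on $\tilde\xi_m$ for any $m\in M$ (which holds near any given point after exchanging $\xi$ and $\tilde\xi$ if necessary). Then locally $dI=j_1\alpha+j_2\tilde\alpha$ with $j_1\ne0$ for balanced contact forms, and $J=j_2/j_1$ is a well-defined smooth function on $M$. Moreover: 1. Suppose $J'\neq0$ everywhere. Around each $m\in M$ there are local coordinates $(x,I,J)$ in which, for some smooth function $B(I,x)>0$, $$\xi=\{dI=BJ\,dx\},\qquad \tilde\xi=\Big\{dI+\frac{B\,dx}{I\pm J}=0\Big\},$$ where the last formula stands for $\{(I\pm J)\,dI+B\,dx=0\}$ (so it means $\{dx=0\}$ where $I\pm J=0$). For any such coordinates around $m$, the pair admits exactly one infinitesimal symmetry around $m$ (that is, the germs at $m$ of vector fields preserving $\xi$ and $\tilde\xi$ form a one-dimensional vector space) if and only if $B$ is separable near $m$, i.e. $\partial_I\partial_x\log B\equiv0$ near the point of the $(I,x)$-plane corresponding to $m$. Equivalently, the invariant $G$ vanishes identically near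 $m$; here, for the balanced contact forms with $dI=\alpha+J\tilde\alpha$, and with $C=I/2$ and $\eta=(J\pm C)\alpha\mp(CJ+1)\tilde\alpha$, there are functions $H,F,G$ on $M$ with $d\eta=H\,dI\wedge\eta$ and $dH=F\,dI+G\,\eta$. 2. Suppose $J'\equiv0$. Around each $m\in M$ there are local coordinates $(x,I,p)$ in which $$\xi=\{dI=p\,dx\},\qquad \tilde\xi=\{\pm J^2\,dI=p\,dx\},$$ where $J=J(I)$ is a smooth function of $I$ satisfying $1+IJ\pm J^2=0$. -/

import Mathlib

open scoped Manifold ContDiff Topology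

namespace ContactPair

noncomputable section

/-- Three-dimensional coordinate space. -/
abbrev E3 : Type := EuclideanSpace ℝ (Fin 3)

/-! ### Differential forms on coordinate space -/

/-- The exterior derivative of a one-form: `(dα)_y (u, v)`. -/
def extD (α : E3 → E3 →L[ℝ] ℝ) (y u v : E3) : ℝ :=
  fderiv ℝ α y u v - fderiv ℝ α y v u

/-- The wedge product of two covectors. -/
def wedge (a b : E3 →L[ℝ] ℝ) (u v : E3) : ℝ := a u * b v - a v * b u

/-- The three-form `α ∧ dβ` at `y`. -/
def wedgeD (α β : E3 → E3 →L[ℝ] ℝ) (y u v w : E3) : ℝ :=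
  α y u * extD β y v w - α y v * extD β y u w + α y w * extD β y u v

/-- `α` is a smooth contact form on `U`: `α ∧ dα` vanishes nowhere on `U`. -/
def IsContactForm (U : Set E3) (α : E3 → E3 →L[ℝ] ℝ) : Prop :=
  ContDiffOn ℝ ∞ α U ∧ ∀ y ∈ U, ∃ u v w : E3, wedgeD α α y u v w ≠ 0

/-- The Schwarzian derivative `(f''/f')' - (1/2) (f''/f')^2` of a real function at `p`. -/
def schwarzianDeriv (f : ℝ → ℝ) (p : ℝ) : ℝ :=
  deriv (fun t => deriv (deriv f) t / deriv f t) p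
    - 1 / 2 * (deriv (deriv f) p / deriv f p) ^ 2

section Manifold

variable {M : Type*} [TopologicalSpace M] [ChartedSpace E3 M]

/-- A chart `e` of the smooth structure of `M` that is defined around `m`. -/
def IsChartAt (e : OpenPartialHomeomorph M E3) (m : M) : Prop :=
  e ∈ IsManifold.maximalAtlas 𝓘(ℝ, E3) ∞ M ∧ m ∈ e.source

/-- The differential at `m` of a chart (the coordinates of a tangent vector). -/
def chartD (e : OpenPartialHomeomorph M E3) (m : M) : TangentSpace 𝓘(ℝ, E3) m →L[ℝ] E3 :=
  mfderiv 𝓘(ℝ, E3) 𝓘(ℝ, E3) e m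

/-- A field of tangent subspaces, written in a chart. -/
def distInChart (e : OpenPartialHomeomorph M E3)
    (ξ : ∀ m : M, Submodule ℝ (TangentSpace 𝓘(ℝ, E3) m)) (y : E3) : Submodule ℝ E3 :=
  (ξ (e.symm y)).map (chartD e (e.symm y)).toLinearMap

/-- A vector field, written in a chart. -/
def vecInChart (e : OpenPartialHomeomorph M E3)
    (X : ∀ m : M, TangentSpace 𝓘(ℝ, E3) m) (y : E3) : E3 :=
  chartD e (e.symm y) (X (e.symm y))

/-- The one-form `α` on the target of the chart `e` is a smooth contact form with kernel `ξ`. -/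
def IsContactFormFor (e : OpenPartialHomeomorph M E3)
    (ξ : ∀ m : M, Submodule ℝ (TangentSpace 𝓘(ℝ, E3) m)) (α : E3 → E3 →L[ℝ] ℝ) : Prop :=
  IsContactForm e.target α ∧
    ∀ y ∈ e.target, distInChart e ξ y = LinearMap.ker (α y).toLinearMap

/-- `(M, ξ, ξ')_ε`: a pair of transverse contact distributions, which are commonly oriented if
`ε = 1` and oppositely oriented if `ε = -1`. -/
def IsContactPair (ξ ξ' : ∀ m : M, Submodule ℝ (TangentSpace 𝓘(ℝ, E3) m)) (ε : ℝ) : Prop :=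
  (∀ m : M, ξ m ⊔ ξ' m = ⊤) ∧
  ∀ m : M, ∃ (e : OpenPartialHomeomorph M E3) (α α' : E3 → E3 →L[ℝ] ℝ),
    IsChartAt e m ∧ IsContactFormFor e ξ α ∧ IsContactFormFor e ξ' α' ∧
    ∀ y ∈ e.target, ∀ u v w : E3, 0 ≤ ε * wedgeD α α y u v w * wedgeD α' α' y u v w

/-- `α, α'` (written in the chart `e`) are balanced contact forms for the pair, that is
`α ∧ dα = ε α' ∧ dα'`, and `X` is the normalized vector field along the axis that belongs to them,
that is `i_X (α ∧ dα) = α ∧ α'`. -/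
def IsBalanced (ξ ξ' : ∀ m : M, Submodule ℝ (TangentSpace 𝓘(ℝ, E3) m)) (ε : ℝ)
    (X : ∀ m : M, TangentSpace 𝓘(ℝ, E3) m) (e : OpenPartialHomeomorph M E3)
    (α α' : E3 → E3 →L[ℝ] ℝ) : Prop :=
  IsContactFormFor e ξ α ∧ IsContactFormFor e ξ' α' ∧
  (∀ y ∈ e.target, ∀ u v w : E3, wedgeD α α y u v w = ε * wedgeD α' α' y u v w) ∧
  ∀ y ∈ e.target, ∀ v w : E3,
    wedgeD α α y (vecInChart e X y) v w = wedge (α y) (α' y) v w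

/-- `X` is the normalized vector field of the (oriented) axis and `I` is the generating invariant
of the pair: for balanced contact forms normalized with respect to `X`,
`I • (α ∧ dα) = α ∧ dα' + α' ∧ dα`. -/
def IsGeneratingInvariant (ξ ξ' : ∀ m : M, Submodule ℝ (TangentSpace 𝓘(ℝ, E3) m)) (ε : ℝ)
    (X : ∀ m : M, TangentSpace 𝓘(ℝ, E3) m) (I : M → ℝ) : Prop :=
  ∀ m : M, ∃ (e : OpenPartialHomeomorph M E3) (α α' : E3 → E3 →L[ℝ] ℝ),
    IsChartAt e m ∧ IsBalanced ξ ξ' ε X e α α' ∧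
    ∀ y ∈ e.target, ∀ u v w : E3,
      I (e.symm y) * wedgeD α α y u v w = wedgeD α α' y u v w + wedgeD α' α y u v w

/-- The derivative `f' = X f` of a function along the axis. -/
def axisDeriv (X : ∀ m : M, TangentSpace 𝓘(ℝ, E3) m) (f : M → ℝ) (m : M) : ℝ :=
  mfderiv 𝓘(ℝ, E3) 𝓘(ℝ, ℝ) f m (X m)

/-! ### The Schwarzian invariant -/

/-- The Schwarzian invariant of the pair, a quadratic form on the axis `A = ξ ∩ ξ'`, takes the
value `s` at the non-zero vector `v ∈ A_m`.

Everything is written in a chart `e` around `m`, with `y = e m`. The field `V` spans the axis and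
extends `v`, and `φ` is its local flow. The linear forms `a, b` on the tangent space vanish on `A_m`
and are homogeneous coordinates on the projective line `P(T_m M / A_m)`. In the affine
coordinate `b / a`, the functions `q, r` are the curves `t ↦ φ_{-t,*} ξ` and `t ↦ φ_{-t,*} ξ'`
(the planes are taken at the point `φ_t (m)`), and `f` is the transition map `r ∘ q⁻¹` between the
two projective structures. The value is that of the pullback by `q` of the quadratic form
`S(f) (dp)^2`. -/
def HasSchwarzianValue (ξ ξ' : ∀ m : M, Submodule ℝ (TangentSpace 𝓘(ℝ, E3) m))
    (m : M) (v : TangentSpace 𝓘(ℝ, E3) m) (s : ℝ) : Prop :=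
  ∃ (e : OpenPartialHomeomorph M E3) (V : E3 → E3) (φ : ℝ × E3 → E3) (a b : E3 →L[ℝ] ℝ)
    (q r f : ℝ → ℝ),
    IsChartAt e m ∧
    V (e m) = chartD e m v ∧
    (∃ N ∈ 𝓝 (e m), ContDiffOn ℝ ∞ V N) ∧
    (∀ᶠ z in 𝓝 (e m), distInChart e ξ z ⊓ distInChart e ξ' z = Submodule.span ℝ {V z}) ∧
    (∃ N ∈ 𝓝 ((0 : ℝ), e m), ContDiffOn ℝ ∞ φ N) ∧
    (∀ᶠ z in 𝓝 (e m), φ (0, z) = z) ∧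
    (∀ᶠ x in 𝓝 ((0 : ℝ), e m), HasDerivAt (fun t => φ (t, x.2)) (V (φ x)) x.1) ∧
    LinearIndependent ℝ ![a, b] ∧ a (V (e m)) = 0 ∧ b (V (e m)) = 0 ∧
    (∀ᶠ t in 𝓝 (0 : ℝ),
      (distInChart e ξ (φ (t, e m))).comap
          (fderiv ℝ (fun z => φ (t, z)) (e m)).toLinearMap
        = LinearMap.ker (b - q t • a).toLinearMap) ∧
    (∀ᶠ t in 𝓝 (0 : ℝ),
      (distInChart e ξ' (φ (t, e m))).comap
          (fderiv ℝ (fun z => φ (t, z)) (e m)).toLinearMap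
        = LinearMap.ker (b - r t • a).toLinearMap) ∧
    ContDiffAt ℝ ∞ f (q 0) ∧
    (∀ᶠ t in 𝓝 (0 : ℝ), r t = f (q t)) ∧
    s = schwarzianDeriv f (q 0) * deriv q 0 ^ 2

/-- The Schwarzian invariant of the pair vanishes identically. -/
def SchwarzianVanishes (ξ ξ' : ∀ m : M, Submodule ℝ (TangentSpace 𝓘(ℝ, E3) m)) : Prop :=
  ∀ (m : M) (v : TangentSpace 𝓘(ℝ, E3) m), v ∈ ξ m ⊓ ξ' m → v ≠ 0 →
    HasSchwarzianValue ξ ξ' m v 0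

/-! ### The finer invariants -/

/-- `J = j₂ / j₁`, where `dI = j₁ α + j₂ α'` with `j₁ ≠ 0`, for balanced contact forms. -/
def IsJInvariant (ξ ξ' : ∀ m : M, Submodule ℝ (TangentSpace 𝓘(ℝ, E3) m)) (ε : ℝ)
    (X : ∀ m : M, TangentSpace 𝓘(ℝ, E3) m) (I J : M → ℝ) : Prop :=
  ∀ m : M, ∃ (e : OpenPartialHomeomorph M E3) (α α' : E3 → E3 →L[ℝ] ℝ) (j₁ j₂ : E3 → ℝ),
    IsChartAt e m ∧ IsBalanced ξ ξ' ε X e α α' ∧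
    ∀ y ∈ e.target,
      fderiv ℝ (fun z => I (e.symm z)) y = j₁ y • α y + j₂ y • α' y ∧
      j₁ y ≠ 0 ∧ J (e.symm y) = j₂ y / j₁ y

/-- The one-form `η = (J ± C) α ∓ (C J + 1) α'`, `C = I / 2`, written in the chart `e`. -/
def etaForm (ε : ℝ) (I J : M → ℝ) (e : OpenPartialHomeomorph M E3) (α α' : E3 → E3 →L[ℝ] ℝ) :
    E3 → E3 →L[ℝ] ℝ := fun y =>
  (J (e.symm y) + ε * (I (e.symm y) / 2)) • α y
    - (ε * (I (e.symm y) / 2 * J (e.symm y) + 1)) • α' y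

/-- The invariants `H, F, G`: if the balanced contact forms are scaled such that
`dI = α + J α'`, then `dη = H dI ∧ η` and `dH = F dI + G η`. -/
def IsHFGInvariant (ξ ξ' : ∀ m : M, Submodule ℝ (TangentSpace 𝓘(ℝ, E3) m)) (ε : ℝ)
    (X : ∀ m : M, TangentSpace 𝓘(ℝ, E3) m) (I J H F G : M → ℝ) : Prop :=
  ContMDiff 𝓘(ℝ, E3) 𝓘(ℝ, ℝ) ∞ H ∧
  ∀ m : M, ∃ (e : OpenPartialHomeomorph M E3) (α α' : E3 → E3 →L[ℝ] ℝ),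
    IsChartAt e m ∧ IsBalanced ξ ξ' ε X e α α' ∧
    ∀ y ∈ e.target,
      fderiv ℝ (fun z => I (e.symm z)) y = α y + J (e.symm y) • α' y ∧
      (∀ u v : E3, extD (etaForm ε I J e α α') y u v
        = H (e.symm y)
          * wedge (fderiv ℝ (fun z => I (e.symm z)) y) (etaForm ε I J e α α' y) u v) ∧
      fderiv ℝ (fun z => H (e.symm z)) y
        = F (e.symm y) • fderiv ℝ (fun z => I (e.symm z)) y
          + G (e.symm y) • etaForm ε I J e α α' y

/-! ### Infinitesimal symmetries -/

section Symmetry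

variable [IsManifold 𝓘(ℝ, E3) ∞ M]

/-- `Y` is an infinitesimal symmetry, around `m`, of the distribution `ξ`: near `m`, the Lie
bracket of `Y` with any local smooth section of `ξ` is a section of `ξ`. -/
def PreservesNear (ξ : ∀ m : M, Submodule ℝ (TangentSpace 𝓘(ℝ, E3) m))
    (Y : ∀ m : M, TangentSpace 𝓘(ℝ, E3) m) (m : M) : Prop :=
  ∀ᶠ p in 𝓝 m, ∀ Z : ∀ x : M, TangentSpace 𝓘(ℝ, E3) x,
    ContMDiffAt 𝓘(ℝ, E3) 𝓘(ℝ, E3).tangent ∞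
      (fun x => (⟨x, Z x⟩ : TangentBundle 𝓘(ℝ, E3) M)) p →
    (∀ᶠ x in 𝓝 p, Z x ∈ ξ x) →
    VectorField.mlieBracket 𝓘(ℝ, E3) Y Z p ∈ ξ p

/-- `Y` is a smooth vector field near `m` and an infinitesimal symmetry of the pair there. -/
def IsSymmetryNear (ξ ξ' : ∀ m : M, Submodule ℝ (TangentSpace 𝓘(ℝ, E3) m))
    (Y : ∀ m : M, TangentSpace 𝓘(ℝ, E3) m) (m : M) : Prop :=
  (∀ᶠ p in 𝓝 m, ContMDiffAt 𝓘(ℝ, E3) 𝓘(ℝ, E3).tangent ∞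
    (fun x => (⟨x, Y x⟩ : TangentBundle 𝓘(ℝ, E3) M)) p) ∧
  PreservesNear ξ Y m ∧ PreservesNear ξ' Y m

/-- The pair admits exactly one infinitesimal symmetry around `m`, up to constant multiples:
the vector space of germs at `m` of infinitesimal symmetries is one-dimensional. -/
def HasExactlyOneSymmetry (ξ ξ' : ∀ m : M, Submodule ℝ (TangentSpace 𝓘(ℝ, E3) m))
    (m : M) : Prop :=
  ∃ Y : ∀ x : M, TangentSpace 𝓘(ℝ, E3) x, IsSymmetryNear ξ ξ' Y m ∧
    (¬ ∀ᶠ p in 𝓝 m, Y p = 0) ∧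
    ∀ Z : ∀ x : M, TangentSpace 𝓘(ℝ, E3) x, IsSymmetryNear ξ ξ' Z m →
      ∃ c : ℝ, ∀ᶠ p in 𝓝 m, Z p = c • Y p

end Symmetry

/-! ### Normal forms -/

/-- The chart `e` around `m` has coordinates `(x, I, J)`, and in it, for a smooth positive
function `B (I, x)`, one has `ξ = {dI = B J dx}` and `ξ' = {(I ± J) dI + B dx = 0}`. -/
def IsGenericNormalForm (ξ ξ' : ∀ m : M, Submodule ℝ (TangentSpace 𝓘(ℝ, E3) m)) (ε : ℝ)
    (I J : M → ℝ) (m : M) (e : OpenPartialHomeomorph M E3) (B : ℝ × ℝ → ℝ) : Prop :=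
  IsChartAt e m ∧
  (∀ p ∈ e.source, e p 1 = I p ∧ e p 2 = J p) ∧
  ContDiffOn ℝ ∞ B ((fun y : E3 => (y 1, y 0)) '' e.target) ∧
  (∀ p ∈ e.source, 0 < B (I p, e p 0)) ∧
  (∀ p ∈ e.source, ∀ v : TangentSpace 𝓘(ℝ, E3) p,
    v ∈ ξ p ↔ chartD e p v 1 = B (I p, e p 0) * J p * chartD e p v 0) ∧
  (∀ p ∈ e.source, ∀ v : TangentSpace 𝓘(ℝ, E3) p,
    v ∈ ξ' p ↔ (I p + ε * J p) * chartD e p v 1 + B (I p, e p 0) * chartD e p v 0 = 0)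

/-- `∂_I ∂_x log B` vanishes near the point `z` of the `(I, x)`-plane. -/
def IsSeparableNear (B : ℝ × ℝ → ℝ) (z : ℝ × ℝ) : Prop :=
  ∀ᶠ w in 𝓝 z, deriv (fun s => deriv (fun t => Real.log (B (s, t))) w.2) w.1 = 0

/-- The chart `e` around `m` has coordinates `(x, I, p)`, on its domain `J = j (I)` is a smooth
function of `I` with `1 + I J ± J² = 0`, and in it `ξ = {dI = p dx}` and
`ξ' = {± J² dI = p dx}`. -/
def IsDegenerateNormalForm (ξ ξ' : ∀ m : M, Submodule ℝ (TangentSpace 𝓘(ℝ, E3) m)) (ε : ℝ)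
    (I J : M → ℝ) (m : M) (e : OpenPartialHomeomorph M E3) (j : ℝ → ℝ) : Prop :=
  IsChartAt e m ∧
  (∀ p ∈ e.source, e p 1 = I p) ∧
  ContDiffOn ℝ ∞ j (I '' e.source) ∧
  (∀ p ∈ e.source, J p = j (I p) ∧ 1 + I p * j (I p) + ε * j (I p) ^ 2 = 0) ∧
  (∀ p ∈ e.source, ∀ v : TangentSpace 𝓘(ℝ, E3) p,
    v ∈ ξ p ↔ chartD e p v 1 = e p 2 * chartD e p v 0) ∧
  (∀ p ∈ e.source, ∀ v : TangentSpace 𝓘(ℝ, E3) p,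
    v ∈ ξ' p ↔ ε * j (I p) ^ 2 * chartD e p v 1 = e p 2 * chartD e p v 0)

end Manifold

end

end ContactPair

/-! Let α, β be balanced forms for ξ, ξ'. Contracting the defining identities with X gives i_X dα =
kα − β and i_X dβ = εα + k'β with k − k' = I (`IsBalancedOn.lieDeriv`). Along a curve of the axis
these are linear equations for the two moving lines in T_mM/A_m, and computing the Schwarzian
derivative of their transition map (`schwarzianDeriv_transition`) shows that the Schwarzian
invariant takes the value 2I' on X. Hence it vanishes only if I' = 0. Then dI is a combination of α
and β, and the common factor of the balanced forms can be fixed by dI = α + Jβ. Contracting d(dI) =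
0 with X now determines everything: k = −εJ, k' = −(I + εJ) and J' = D, where D = 1 + IJ + εJ²
(`IsNormalizedOn.structure_equations`).

Suppose D ≠ 0. The form θ = β − (I + εJ)α satisfies θ(X) = 0 and i_X dθ = 0, so it is integrable, θ
= B dx. The functions x, I, J are coordinates in which the axis is the J-direction, and i_X dθ = 0
says that B depends on I and x only. The identities Dα = dI − Jθ and Dβ = (I + εJ)dI + θ are the
normal form (`IsAdapted.exists_generic_chart`).

Suppose D ≡ 0. Now θ = J(εJα + β) is integrable, θ = p dx, because i_X dθ = ((1 − εJ²)/J) θ. The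
factor here does not vanish, so p varies along the axis and x, I, p are coordinates. J is a simple
root of the quadratic 1 + IJ + εJ², hence a smooth function of I
(`IsAdapted.exists_degenerate_chart`).

An infinitesimal symmetry in a generic chart preserves the axis, so its components along x and I do
not depend on J. The remaining conditions are then polynomials of degree two in J with coefficients
free of J, and each coefficient has to vanish. This leaves c(x)∂_x with ∂_x(cB) = 0
(`isReducedField_of_symmetry`). A non-zero field of this kind exists if and only if ∂_x log B does
not depend on I, and it is then unique up to a constant factor
(`IsGenericNormalForm.hasExactlyOneSymmetry_iff_logSlope`). Finally η = −ε(B dx + (I/2) dI), so H =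
∂_I log B and G = −ε ∂_x H / B, which vanishes exactly when B is separable (`exists_HFG`).

The analytic inputs are smooth local flows, obtained from the inverse function theorem on a space of
curves (`exists_smooth_flow`), and Frobenius' theorem for a one-form with a characteristic direction
(`exists_integrating_factor`). -/

namespace ContactPair
noncomputable section

set_option linter.unusedSectionVars false

/-! ### Smooth superposition operators -/

section Superposition

universe u

variable {K : Type*} [TopologicalSpace K] [CompactSpace K]

/-- Pointwise application of a continuous family of continuous linear maps. -/
def pointwiseApply (E F : Type*) [NormedAddCommGroup E] [NormedSpace ℝ E]
    [NormedAddCommGroup F] [NormedSpace ℝ F] :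
    C(K, E →L[ℝ] F) →L[ℝ] C(K, E) →L[ℝ] C(K, F) :=
  LinearMap.mkContinuous₂
    (LinearMap.mk₂ ℝ (fun (A : C(K, E →L[ℝ] F)) (v : C(K, E)) =>
        (⟨fun x => A x (v x), A.continuous.clm_apply v.continuous⟩ : C(K, F)))
      (fun A A' v => by ext x; simp) (fun c A v => by ext x; simp)
      (fun A v v' => by ext x; simp) (fun c A v => by ext x; simp)) 1
    (fun A v => by
      rw [one_mul, ContinuousMap.norm_le _ (by positivity)]
      intro x
      exact ((A x).le_opNorm _).trans
        (mul_le_mul (A.norm_coe_le_norm x) (v.norm_coe_le_norm x) (norm_nonneg _) (norm_nonneg A)))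

@[simp] lemma pointwiseApply_apply {E F : Type*} [NormedAddCommGroup E] [NormedSpace ℝ E]
    [NormedAddCommGroup F] [NormedSpace ℝ F] (A : C(K, E →L[ℝ] F)) (v : C(K, E)) (x : K) :
    pointwiseApply E F A v x = A x (v x) := rfl

/-- The remainder is estimated pointwise by the mean value inequality on the segment from u x to u x
+ v x. Continuity of w ↦ f' ∘ w in the sup norm, applied along u + t v, makes the estimate uniform
in x. -/
lemma hasFDerivAt_comp_continuousMap {E F : Type*} [NormedAddCommGroup E] [NormedSpace ℝ E]
    [NormedAddCommGroup F] [NormedSpace ℝ F] {f : E → F} (hf : Differentiable ℝ f)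
    (hf' : Continuous (fderiv ℝ f)) (u : C(K, E)) :
    HasFDerivAt (fun u : C(K, E) => (⟨f, hf.continuous⟩ : C(E, F)).comp u)
      (pointwiseApply E F ((⟨fderiv ℝ f, hf'⟩ : C(E, E →L[ℝ] F)).comp u)) u := by
  rw [hasFDerivAt_iff_isLittleO_nhds_zero, Asymptotics.isLittleO_iff]
  intro c hc
  have hcont : Continuous fun w : C(K, E) => (⟨fderiv ℝ f, hf'⟩ : C(E, E →L[ℝ] F)).comp w :=
    ContinuousMap.continuous_postcomp _
  obtain ⟨δ, hδ, h⟩ := (Metric.continuous_iff (α := C(K, E)) (β := C(K, E →L[ℝ] F))).1 hcont u c hc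
  filter_upwards [Metric.ball_mem_nhds (0 : C(K, E)) hδ] with v hv
  rw [ContinuousMap.norm_le _ (by positivity)]
  intro x
  have hseg : ∀ y ∈ segment ℝ (u x) (u x + v x), ‖fderiv ℝ f y - fderiv ℝ f (u x)‖ ≤ c := by
    intro y hy
    rw [segment_eq_image'] at hy
    obtain ⟨t, ht, rfl⟩ := hy
    have h1 := h (u + t • v) (by
      rw [dist_eq_norm, add_sub_cancel_left, norm_smul, Real.norm_eq_abs, abs_of_nonneg ht.1]
      have : ‖v‖ < δ := by simpa using hv
      nlinarith [norm_nonneg v, ht.2, ht.1])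
    have h2 := (ContinuousMap.dist_apply_le_dist x).trans h1.le
    simpa [dist_eq_norm] using h2
  have key := Convex.norm_image_sub_le_of_norm_hasFDerivWithin_le'
    (f := f) (f' := fderiv ℝ f) (φ := fderiv ℝ f (u x)) (C := c)
    (fun y hy => (hf y).hasFDerivAt.hasFDerivWithinAt) hseg (convex_segment _ _)
    (left_mem_segment ℝ _ _) (right_mem_segment ℝ _ _)
  have h3 : ‖f (u x + v x) - f (u x) - (fderiv ℝ f (u x)) (v x)‖ ≤ c * ‖v x‖ := by
    simpa using key
  refine le_trans (le_of_eq ?_) (h3.trans (mul_le_mul_of_nonneg_left (v.norm_coe_le_norm x) hc.le))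
  simp

/-- The derivative at u is multiplication by f' ∘ u, a bounded linear operator applied to the
superposition operator of f', so the induction on n runs over all f at once. E and F share a
universe so that F may be replaced by the space of operators from E to F. -/
lemma contDiff_comp_continuousMap (n : ℕ) : ∀ {E F : Type u} [NormedAddCommGroup E]
    [NormedSpace ℝ E] [NormedAddCommGroup F] [NormedSpace ℝ F] {f : E → F}
    (hf : ContDiff ℝ ∞ f),
    ContDiff ℝ n (fun u : C(K, E) => (⟨f, hf.continuous⟩ : C(E, F)).comp u) := by
  induction n with
  | zero =>
    intro E F _ _ _ _ f hf
    rw [Nat.cast_zero, contDiff_zero]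
    exact ContinuousMap.continuous_postcomp _
  | succ n ih =>
    intro E F _ _ _ _ f hf
    have hf' : ContDiff ℝ ∞ (fderiv ℝ f) := hf.fderiv_right (by simp)
    rw [Nat.cast_succ, contDiff_succ_iff_hasFDerivAt]
    refine ⟨_, ?_, fun u => hasFDerivAt_comp_continuousMap (hf.differentiable (by simp))
      hf'.continuous u⟩
    exact (pointwiseApply E F).contDiff.comp (ih hf')

lemma contDiff_infty_comp_continuousMap {E F : Type u} [NormedAddCommGroup E]
    [NormedSpace ℝ E] [NormedAddCommGroup F] [NormedSpace ℝ F] {f : E → F}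
    (hf : ContDiff ℝ ∞ f) :
    ContDiff ℝ ∞ (fun u : C(K, E) => (⟨f, hf.continuous⟩ : C(E, F)).comp u) :=
  contDiff_infty.2 fun n => contDiff_comp_continuousMap n hf

end Superposition

/-! ### Local inverses of smooth maps -/

/-- The source is cut down to points where the derivative is still invertible, an open condition.
There the inverse is smooth at every point of the target, not only at the image of a. -/
lemma exists_smooth_localInverse {E F : Type*} [NormedAddCommGroup E] [NormedSpace ℝ E]
    [CompleteSpace E] [NormedAddCommGroup F] [NormedSpace ℝ F] [CompleteSpace F] {f : E → F}
    {U : Set E} (hU : IsOpen U) (hf : ContDiffOn ℝ ∞ f U) {a : E} (ha : a ∈ U)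
    (f' : E ≃L[ℝ] F) (hf' : HasFDerivAt f (f' : E →L[ℝ] F) a) :
    ∃ P : OpenPartialHomeomorph E F, a ∈ P.source ∧ P.source ⊆ U ∧ (∀ x, P x = f x) ∧
      ContDiffOn ℝ ∞ P.symm P.target := by
  have hfa : ContDiffAt ℝ ∞ f a := hf.contDiffAt (hU.mem_nhds ha)
  let Q := hfa.toOpenPartialHomeomorph f hf' (by simp)
  have haQ : a ∈ Q.source := hfa.mem_toOpenPartialHomeomorph_source hf' (by simp)
  let W : Set E := U ∩ fderiv ℝ f ⁻¹' Set.range ((↑) : (E ≃L[ℝ] F) → (E →L[ℝ] F))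
  have hW : IsOpen W :=
    (hf.continuousOn_fderiv_of_isOpen hU (by simp)).isOpen_inter_preimage hU
      ContinuousLinearEquiv.isOpen
  have haW : a ∈ W := ⟨ha, f', hf'.fderiv.symm⟩
  refine ⟨Q.restr W, ?_, ?_, fun x => rfl, ?_⟩
  · rw [Q.restr_source' _ hW]; exact ⟨haQ, haW⟩
  · rw [Q.restr_source' _ hW]; exact fun x hx => hx.2.1
  · intro y hy
    have hy' : (Q.restr W).symm y ∈ (Q.restr W).source := (Q.restr W).map_target hy
    have hyW : (Q.restr W).symm y ∈ W := by rw [Q.restr_source' _ hW] at hy'; exact hy'.2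
    obtain ⟨g, hg⟩ := hyW.2
    refine ContDiffAt.contDiffWithinAt ?_
    refine (Q.restr W).contDiffAt_symm (f₀' := g) hy ?_ (hf.contDiffAt (hU.mem_nhds hyW.1))
    have : DifferentiableAt ℝ f ((Q.restr W).symm y) :=
      (hf.contDiffAt (hU.mem_nhds hyW.1)).differentiableAt (by simp)
    rw [hg]
    exact this.hasFDerivAt

/-! ### Smooth local flows -/

section Flow

universe u

variable {E : Type u} [NormedAddCommGroup E] [NormedSpace ℝ E]

/-- The interval `[-1, 1]`. -/
abbrev SymmIcc : Type := Set.Icc (-1 : ℝ) 1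

lemma neg_one_le_one : (-1 : ℝ) ≤ 1 := by norm_num

/-- Extension of a curve on `[-1, 1]` by constants. -/
def extendCurve {E : Type*} [TopologicalSpace E] (g : C(SymmIcc, E)) (r : ℝ) : E := g (Set.projIcc (-1) 1 neg_one_le_one r)

lemma continuous_extendCurve {E : Type*} [TopologicalSpace E] (g : C(SymmIcc, E)) : Continuous (extendCurve g) :=
  g.continuous.comp continuous_projIcc

/-- The primitive `s ↦ ∫ r in 0..s, g r` of a curve on `[-1, 1]`. -/
def primitiveCurve (E : Type u) [NormedAddCommGroup E] [NormedSpace ℝ E] :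
    C(SymmIcc, E) →L[ℝ] C(SymmIcc, E) :=
  LinearMap.mkContinuous
    { toFun := fun g => ⟨fun s => ∫ r in (0 : ℝ)..s, extendCurve g r,
        (intervalIntegral.continuous_primitive
          (fun a b => (continuous_extendCurve g).intervalIntegrable a b) 0).comp
            continuous_subtype_val⟩
      map_add' := fun g h => by
        ext s
        exact intervalIntegral.integral_add ((continuous_extendCurve g).intervalIntegrable _ _)
          ((continuous_extendCurve h).intervalIntegrable _ _)
      map_smul' := fun c g => by
        ext s
        exact intervalIntegral.integral_smul _ _ } 1
    (fun g => by
      rw [one_mul, ContinuousMap.norm_le _ (by positivity)]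
      intro s
      have h := intervalIntegral.norm_integral_le_of_norm_le_const (a := 0) (b := (s : ℝ))
        (f := extendCurve g) (C := ‖g‖) (fun r _ => g.norm_coe_le_norm _)
      refine h.trans ?_
      have : |(s : ℝ) - 0| ≤ 1 := by rw [sub_zero, abs_le]; exact s.2
      exact mul_le_of_le_one_right (norm_nonneg g) this)

lemma primitiveCurve_apply (g : C(SymmIcc, E)) (s : SymmIcc) :
    primitiveCurve E g s = ∫ r in (0 : ℝ)..s, extendCurve g r := rfl

lemma mul_mem_symmIcc (a s : SymmIcc) : (a : ℝ) * s ∈ Set.Icc (-1 : ℝ) 1 := by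
  rw [Set.mem_Icc, ← abs_le, abs_mul]
  exact mul_le_one₀ (abs_le.2 a.2) (abs_nonneg _) (abs_le.2 s.2)

/-- Multiplication by `a` on `[-1, 1]`. -/
def scaleIcc (a : SymmIcc) : C(SymmIcc, SymmIcc) :=
  ⟨fun s => ⟨a * s, mul_mem_symmIcc a s⟩, by fun_prop⟩

/-- The substitution r ↦ a r. Consequently a solution of u' = τ V(u), run at speed a, solves the
equation with a τ in place of τ. -/
lemma primitiveCurve_comp_scale (g : C(SymmIcc, E)) (a s : SymmIcc) :
    (a : ℝ) • primitiveCurve E (g.comp (scaleIcc a)) s = primitiveCurve E g (scaleIcc a s) := by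
  rw [primitiveCurve_apply, primitiveCurve_apply]
  have h : ∫ r in (0 : ℝ)..s, extendCurve (g.comp (scaleIcc a)) r
      = ∫ r in (0 : ℝ)..s, extendCurve g (a * r) := by
    refine intervalIntegral.integral_congr fun r hr => ?_
    have hr1 : r ∈ Set.Icc (-1 : ℝ) 1 := by
      have h0 : (0 : ℝ) ∈ Set.Icc (-1 : ℝ) 1 := by constructor <;> norm_num
      exact Set.uIcc_subset_Icc h0 s.2 hr
    simp only [extendCurve]
    rw [Set.projIcc_of_mem _ hr1, Set.projIcc_of_mem _ (mul_mem_symmIcc a ⟨r, hr1⟩)]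
    rfl
  rw [h]
  have := intervalIntegral.smul_integral_comp_mul_left (a := 0) (b := (s : ℝ)) (extendCurve g)
    (a : ℝ)
  rw [this, mul_zero]
  rfl

/-- The map whose zeros are the solutions `u` on `[-1, 1]` of `u' = τ V(u)`, `u(0) = z`. -/
def flowMap {V : E → E} (hV : Continuous V) (x : (ℝ × E) × C(SymmIcc, E)) :
    (ℝ × E) × C(SymmIcc, E) :=
  (x.1, x.2 - ContinuousMap.const _ x.1.2
    - x.1.1 • primitiveCurve E ((⟨V, hV⟩ : C(E, E)).comp x.2))

lemma contDiff_flowMap {V : E → E} (hV : ContDiff ℝ ∞ V) :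
    ContDiff ℝ ∞ (flowMap hV.continuous) := by
  refine contDiff_fst.prodMk ((contDiff_snd.sub ?_).sub ?_)
  · exact (ContinuousLinearMap.const ℝ SymmIcc (M := E)).contDiff.comp
      (contDiff_snd.comp contDiff_fst)
  · exact (contDiff_fst.comp contDiff_fst).smul ((primitiveCurve E).contDiff.comp
      ((contDiff_infty_comp_continuousMap hV).comp contDiff_snd))

/-- At τ = 0 the nonlinear term contributes only through its derivative in τ, so the differential is
triangular with identities on the diagonal and is invertible. -/
lemma hasFDerivAt_flowMap {V : E → E} (hV : ContDiff ℝ ∞ V) (z : E) :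
    ∃ L : ((ℝ × E) × C(SymmIcc, E)) ≃L[ℝ] ((ℝ × E) × C(SymmIcc, E)),
      HasFDerivAt (flowMap hV.continuous) (L : _ →L[ℝ] _)
        ((0, z), ContinuousMap.const _ z) := by
  let c : C(SymmIcc, E) := ContinuousMap.const _ z
  let k : C(SymmIcc, E) := primitiveCurve E ((⟨V, hV.continuous⟩ : C(E, E)).comp c)
  let A : (ℝ × E) →L[ℝ] C(SymmIcc, E) :=
    -((ContinuousLinearMap.const ℝ SymmIcc (M := E)).comp (ContinuousLinearMap.snd ℝ ℝ E))
      - (ContinuousLinearMap.fst ℝ ℝ E).smulRight k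
  refine ⟨(ContinuousLinearEquiv.refl ℝ _).skewProd (ContinuousLinearEquiv.refl ℝ _) A, ?_⟩
  have h1 : HasFDerivAt (fun x : (ℝ × E) × C(SymmIcc, E) => x.1)
      (ContinuousLinearMap.fst ℝ _ _) ((0, z), c) := hasFDerivAt_fst
  have h2 : HasFDerivAt (fun x : (ℝ × E) × C(SymmIcc, E) => x.2)
      (ContinuousLinearMap.snd ℝ _ _) ((0, z), c) := hasFDerivAt_snd
  have h3 : HasFDerivAt (fun x : (ℝ × E) × C(SymmIcc, E) =>
      (ContinuousLinearMap.const ℝ SymmIcc (M := E)) x.1.2) _ ((0, z), c) :=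
    (ContinuousLinearMap.const ℝ SymmIcc (M := E)).hasFDerivAt.comp _
      (hasFDerivAt_snd.comp _ h1)
  have h4 := ((primitiveCurve E).hasFDerivAt.comp _
      ((((contDiff_infty_comp_continuousMap (K := SymmIcc) hV).differentiable (by simp)) c
        ).hasFDerivAt.comp ((0, z), c) h2))
  have h5 : HasFDerivAt (fun x : (ℝ × E) × C(SymmIcc, E) => x.1.1) _ ((0, z), c) :=
    hasFDerivAt_fst.comp _ h1
  have h6 := h1.prodMk ((h2.sub h3).sub (h5.smul h4))
  refine h6.congr_fderiv ?_
  refine ContinuousLinearMap.ext fun x => Prod.ext rfl ?_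
  simp [A, k, c, sub_eq_add_neg, add_assoc]

variable [CompleteSpace E]

/-- A smooth vector field has a smooth local flow. -/
theorem exists_smooth_flow {V : E → E} (hV : ContDiff ℝ ∞ V) (z₀ : E) :
    ∃ φ : ℝ × E → E, (∃ N ∈ 𝓝 ((0 : ℝ), z₀), ContDiffOn ℝ ∞ φ N) ∧
      (∀ᶠ z in 𝓝 z₀, φ (0, z) = z) ∧
      ∀ᶠ x in 𝓝 ((0 : ℝ), z₀), HasDerivAt (fun t => φ (t, x.2)) (V (φ x)) x.1 := by
  obtain ⟨L, hL⟩ := hasFDerivAt_flowMap hV z₀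
  set a : (ℝ × E) × C(SymmIcc, E) := ((0, z₀), ContinuousMap.const _ z₀) with ha
  obtain ⟨P, haP, -, hPf, hPs⟩ := exists_smooth_localInverse isOpen_univ
    (contDiff_flowMap hV).contDiffOn (Set.mem_univ a) L hL
  have hPa : P a = ((0, z₀), 0) := by
    rw [hPf]; simp [flowMap, ha]
  obtain ⟨r, hr, hball⟩ := Metric.isOpen_iff.1 P.open_source a haP
  -- the solution curves
  let S : ℝ × E → (ℝ × E) × C(SymmIcc, E) := fun p => P.symm (p, 0)
  let one : SymmIcc := ⟨1, by norm_num, le_rfl⟩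
  have hzero : ((0 : ℝ), z₀) ∈ {p : ℝ × E | (p, (0 : C(SymmIcc, E))) ∈ P.target} := by
    have := P.map_source haP
    rwa [hPa] at this
  have hSa : S (0, z₀) = a := by
    change P.symm ((0, z₀), 0) = a
    rw [← hPa, P.left_inv haP]
  have hopen : IsOpen {p : ℝ × E | (p, (0 : C(SymmIcc, E))) ∈ P.target} :=
    P.open_target.preimage (by fun_prop)
  have hSsmooth : ContDiffOn ℝ ∞ S {p : ℝ × E | (p, (0 : C(SymmIcc, E))) ∈ P.target} :=
    hPs.comp (contDiff_id.prodMk contDiff_const).contDiffOn fun p hp => hp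
  have hScont : ContinuousAt S (0, z₀) :=
    hSsmooth.continuousOn.continuousAt (hopen.mem_nhds hzero)
  have hnear : ∀ᶠ p in 𝓝 ((0 : ℝ), z₀),
      (p, (0 : C(SymmIcc, E))) ∈ P.target ∧ S p ∈ Metric.ball a r :=
    (hopen.eventually_mem hzero).and (hScont.eventually
      (by rw [hSa]; exact Metric.ball_mem_nhds a hr))
  obtain ⟨δ, hδ, hδ'⟩ := Metric.eventually_nhds_iff_ball.1 hnear
  have hS : ∀ p ∈ Metric.ball ((0 : ℝ), z₀) δ, (S p).1 = p ∧ ∀ s : SymmIcc,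
      (S p).2 s = p.2 + p.1 • primitiveCurve E ((⟨V, hV.continuous⟩ : C(E, E)).comp (S p).2) s := by
    intro p hp
    have h1 : P (S p) = (p, 0) := P.right_inv (hδ' p hp).1
    rw [hPf] at h1
    have h2 : (S p).1 = p := congrArg Prod.fst h1
    refine ⟨h2, fun s => ?_⟩
    have h3 := congrArg (fun x => x.2 s) h1
    simp only [flowMap, h2, ContinuousMap.sub_apply, ContinuousMap.const_apply,
      ContinuousMap.smul_apply, ContinuousMap.zero_apply] at h3
    rw [sub_sub, sub_eq_zero] at h3
    exact h3
  have hmem : ∀ (t : ℝ) (z : E), |t| < δ → dist z z₀ < δ → (t, z) ∈ Metric.ball ((0 : ℝ), z₀) δ := by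
    intro t z ht hz
    rw [Metric.mem_ball, Prod.dist_eq, max_lt_iff]
    exact ⟨by simpa using ht, hz⟩
  -- scaling of the solution curves
  have hscale : ∀ (t : ℝ) (z : E) (b : SymmIcc), |t| < δ → dist z z₀ < δ →
      (S (b * t, z)).2 one = (S (t, z)).2 b := by
    intro t z b ht hz
    have hb : |(b : ℝ) * t| ≤ |t| := by
      rw [abs_mul]; exact mul_le_of_le_one_left (abs_nonneg _) (abs_le.2 b.2)
    have hp := hmem t z ht hz
    have hp' := hmem (b * t) z (hb.trans_lt ht) hz
    -- The solution with parameter t, run at speed b, is a zero of the map with parameter b t. It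
    -- stays in the source of `P`, where `P` is injective, so it is the solution S (b t, z).
    let v : C(SymmIcc, E) := (S (t, z)).2.comp (scaleIcc b)
    have hv : ((b * t, z), v) ∈ P.source := by
      apply hball
      have h1 := (hδ' _ hp).2
      rw [Metric.mem_ball, Prod.dist_eq, max_lt_iff, (hS _ hp).1, Prod.dist_eq, max_lt_iff] at h1
      rw [Metric.mem_ball, Prod.dist_eq, max_lt_iff, Prod.dist_eq, max_lt_iff]
      refine ⟨⟨?_, h1.1.2⟩, ?_⟩
      · have h2 := h1.1.1
        simp only [ha, Real.dist_eq, sub_zero] at h2 ⊢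
        exact hb.trans_lt h2
      · refine lt_of_le_of_lt ?_ h1.2
        rw [ContinuousMap.dist_le dist_nonneg]
        intro s
        exact ContinuousMap.dist_apply_le_dist (f := (S (t, z)).2)
          (g := ContinuousMap.const _ z₀) (scaleIcc b s)
    have hPv : P ((b * t, z), v) = ((b * t, z), 0) := by
      rw [hPf]
      refine Prod.ext rfl ?_
      ext s
      have h1 := (hS _ hp).2 (scaleIcc b s)
      have h2 := primitiveCurve_comp_scale
        ((⟨V, hV.continuous⟩ : C(E, E)).comp (S (t, z)).2) b s
      simp only [flowMap, ContinuousMap.sub_apply, ContinuousMap.const_apply,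
        ContinuousMap.smul_apply, ContinuousMap.zero_apply]
      rw [sub_sub, sub_eq_zero]
      refine h1.trans ?_
      rw [← h2, smul_smul, mul_comm t]
      rfl
    have h3 : S (b * t, z) = ((b * t, z), v) := by
      change P.symm ((b * t, z), 0) = _
      rw [← hPv, P.left_inv hv]
    rw [h3]
    exact congrArg (S (t, z)).2 (Subtype.ext (mul_one (b : ℝ)))
  -- The flow for time t is the value at 1 of the solution of u' = t V(u).
  refine ⟨fun p => (S p).2 one, ⟨Metric.ball ((0 : ℝ), z₀) δ, Metric.ball_mem_nhds _ hδ, ?_⟩,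
    ?_, ?_⟩
  · have h1 : ContDiffOn ℝ ∞ S (Metric.ball ((0 : ℝ), z₀) δ) :=
      hSsmooth.mono fun p hp => (hδ' p hp).1
    exact (ContinuousMap.evalCLM ℝ one).contDiff.comp_contDiffOn h1.snd
  · filter_upwards [Metric.ball_mem_nhds z₀ hδ] with z hz
    have := (hS _ (hmem 0 z (by simpa using hδ) hz)).2 one
    simpa using this
  · filter_upwards [Metric.ball_mem_nhds ((0 : ℝ), z₀) (half_pos hδ)] with x hx
    obtain ⟨t₀, z⟩ := x
    rw [Metric.mem_ball, Prod.dist_eq, max_lt_iff] at hx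
    have ht₀ : |t₀| < δ / 2 := by simpa using hx.1
    have hz : dist z z₀ < δ := hx.2.trans (half_lt_self hδ)
    have hδ2 : |δ / 2| < δ := by rw [abs_of_pos (half_pos hδ)]; exact half_lt_self hδ
    set g : C(SymmIcc, E) := (⟨V, hV.continuous⟩ : C(E, E)).comp (S (δ / 2, z)).2 with hg
    have hsub : ∀ t : ℝ, |t| < δ / 2 → t / (δ / 2) ∈ Set.Icc (-1 : ℝ) 1 := by
      intro t ht
      rw [Set.mem_Icc, ← abs_le, abs_div, abs_of_pos (half_pos hδ), div_le_one (half_pos hδ)]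
      exact ht.le
    have hval : ∀ t : ℝ, ∀ ht : |t| < δ / 2,
        (S (t, z)).2 one = (S (δ / 2, z)).2 ⟨t / (δ / 2), hsub t ht⟩ := by
      intro t ht
      have := hscale (δ / 2) z ⟨t / (δ / 2), hsub t ht⟩ hδ2 hz
      rwa [show ((⟨t / (δ / 2), hsub t ht⟩ : SymmIcc) : ℝ) * (δ / 2) = t from
        div_mul_cancel₀ _ (half_pos hδ).ne'] at this
    -- By scaling, all these values lie on the single curve with parameter δ / 2, which is a
    -- primitive of a continuous function; its derivative can be read off.
    have hform : ∀ t : ℝ, |t| < δ / 2 →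
        (S (t, z)).2 one = z + (δ / 2) • ∫ r in (0 : ℝ)..(t / (δ / 2)), extendCurve g r := by
      intro t ht
      rw [hval t ht]
      exact (hS _ (hmem _ z hδ2 hz)).2 _
    have hev : (fun t => (S (t, z)).2 one) =ᶠ[𝓝 t₀]
        fun t => z + (δ / 2) • ∫ r in (0 : ℝ)..(t / (δ / 2)), extendCurve g r := by
      filter_upwards [(isOpen_lt continuous_abs continuous_const).mem_nhds ht₀] with t ht
      exact hform t ht
    have hF : HasDerivAt (fun y : ℝ => ∫ r in (0 : ℝ)..y, extendCurve g r)
        (extendCurve g (t₀ / (δ / 2))) (t₀ / (δ / 2)) :=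
      intervalIntegral.integral_hasDerivAt_right
        ((continuous_extendCurve g).intervalIntegrable _ _)
        ((continuous_extendCurve g).stronglyMeasurableAtFilter _ _)
        (continuous_extendCurve g).continuousAt
    have hd := ((HasDerivAt.scomp t₀ hF ((hasDerivAt_id t₀).div_const (δ / 2))).const_smul
      (δ / 2)).const_add z
    have hd' := hd.congr_of_eventuallyEq hev
    refine hd'.congr_deriv ?_
    rw [smul_smul, mul_one_div_cancel (half_pos hδ).ne', one_smul]
    simp only [extendCurve]
    rw [Set.projIcc_of_mem _ (hsub t₀ ht₀), hg]
    change V ((S (δ / 2, z)).2 _) = V ((S (t₀, z)).2 one)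
    rw [hval t₀ ht₀]

end Flow

/-! ### Flow boxes -/

lemma two_le_infty : (2 : WithTop ℕ∞) ≤ ∞ :=
  WithTop.coe_le_coe.2 (le_top : (2 : ℕ∞) ≤ ⊤)

/-- Multiplication by a bump function supported in U. It reduces local flows to those of fields
smooth on the whole space. -/
lemma exists_contDiff_eventuallyEq {E F : Type*} [NormedAddCommGroup E] [NormedSpace ℝ E]
    [FiniteDimensional ℝ E] [NormedAddCommGroup F] [NormedSpace ℝ F] {V : E → F} {U : Set E}
    (hU : IsOpen U) (hV : ContDiffOn ℝ ∞ V U) {z : E} (hz : z ∈ U) :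
    ∃ W : E → F, ContDiff ℝ ∞ W ∧ W =ᶠ[𝓝 z] V := by
  obtain ⟨r, hr, hrU⟩ := Metric.isOpen_iff.1 hU z hz
  let b : ContDiffBump z := ⟨r / 4, r / 2, by linarith, by linarith⟩
  refine ⟨fun x => b x • V x, ?_, ?_⟩
  · rw [contDiff_iff_contDiffAt]
    intro x
    by_cases hx : x ∈ U
    · exact b.contDiffAt.smul (hV.contDiffAt (hU.mem_nhds hx))
    · have hxb : x ∉ tsupport b := by
        rw [b.tsupport_eq]
        intro h
        exact hx (hrU (Metric.closedBall_subset_ball (by change r / 2 < r; linarith) h))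
      have h0 : (fun x => b x • V x) =ᶠ[𝓝 x] fun _ => 0 := by
        filter_upwards [(isClosed_tsupport b).isOpen_compl.mem_nhds hxb] with y hy
        rw [image_eq_zero_of_notMem_tsupport hy, zero_smul]
      exact contDiffAt_const.congr_of_eventuallyEq h0
  · filter_upwards [b.eventuallyEq_one] with x hx
    rw [hx, Pi.one_apply, one_smul]

/-- A smooth local flow `φ` of the field `V`, defined on a box of size `R` around `(0, z)`,
with values in `U`. -/
structure IsFlowBox {E : Type*} [NormedAddCommGroup E] [NormedSpace ℝ E] (V : E → E) (U : Set E)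
    (φ : ℝ × E → E) (R : ℝ) (z : E) : Prop where
  pos : 0 < R
  smooth : ContDiffOn ℝ ∞ φ (Set.Ioo (-R) R ×ˢ Metric.ball z R)
  zero : ∀ p ∈ Metric.ball z R, φ (0, p) = p
  mem : ∀ t ∈ Set.Ioo (-R) R, ∀ p ∈ Metric.ball z R, φ (t, p) ∈ U
  deriv : ∀ t ∈ Set.Ioo (-R) R, ∀ p ∈ Metric.ball z R,
    HasDerivAt (fun s => φ (s, p)) (V (φ (t, p))) t

lemma exists_box {E : Type*} [PseudoMetricSpace E] {P : ℝ × E → Prop} {z : E}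
    (h : ∀ᶠ x in 𝓝 ((0 : ℝ), z), P x) :
    ∃ R > 0, ∀ t ∈ Set.Ioo (-R) R, ∀ p ∈ Metric.ball z R, P (t, p) := by
  obtain ⟨R, hR, h⟩ := Metric.eventually_nhds_iff_ball.1 h
  refine ⟨R, hR, fun t ht p hp => h _ ?_⟩
  rw [Metric.mem_ball, Prod.dist_eq, max_lt_iff]
  exact ⟨by simpa [abs_lt] using ht, hp⟩

lemma exists_isFlowBox {E : Type*} [NormedAddCommGroup E] [NormedSpace ℝ E]
    [FiniteDimensional ℝ E] {V : E → E} {U : Set E} (hU : IsOpen U) (hV : ContDiffOn ℝ ∞ V U)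
    {z : E} (hz : z ∈ U) : ∃ (φ : ℝ × E → E) (R : ℝ), IsFlowBox V U φ R z := by
  have : CompleteSpace E := FiniteDimensional.complete ℝ E
  obtain ⟨W, hW, hWV⟩ := exists_contDiff_eventuallyEq hU hV hz
  obtain ⟨φ, ⟨N, hN, hφ⟩, h0, hd⟩ := exists_smooth_flow hW z
  have hc : ContinuousAt φ (0, z) := hφ.continuousOn.continuousAt hN
  have hφz : φ (0, z) = z := h0.self_of_nhds
  have h1 : ∀ᶠ x in 𝓝 ((0 : ℝ), z), φ x ∈ U :=
    hc.eventually (by rw [hφz]; exact hU.mem_nhds hz)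
  have h2 : ∀ᶠ x in 𝓝 ((0 : ℝ), z), W (φ x) = V (φ x) :=
    hc.eventually (by rw [hφz]; exact hWV)
  have h3 : ∀ᶠ x in 𝓝 ((0 : ℝ), z), φ (0, x.2) = x.2 :=
    (continuous_snd.tendsto ((0 : ℝ), z)).eventually h0
  have h4 : ∀ᶠ x in 𝓝 ((0 : ℝ), z), x ∈ N := hN
  obtain ⟨R, hR, h⟩ := exists_box (h1.and (h2.and (h3.and (h4.and hd))))
  have hR0 : (0 : ℝ) ∈ Set.Ioo (-R) R := ⟨by linarith, hR⟩
  refine ⟨φ, R, hR, hφ.mono fun x hx => (h x.1 hx.1 x.2 hx.2).2.2.2.1,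
    fun p hp => (h 0 hR0 p hp).2.2.1, fun t ht p hp => (h t ht p hp).1, fun t ht p hp => ?_⟩
  have := h t ht p hp
  rw [← this.2.1]
  exact this.2.2.2.2

/-! ### Pullback of one-forms by a flow -/

section Pullback

variable {E : Type*} [NormedAddCommGroup E] [NormedSpace ℝ E]

lemma fderiv_partial_right {F : Type*} [NormedAddCommGroup F] [NormedSpace ℝ F] {φ : ℝ × E → F}
    {t : ℝ} {p : E} (h : DifferentiableAt ℝ φ (t, p)) (w : E) :
    fderiv ℝ (fun z => φ (t, z)) p w = fderiv ℝ φ (t, p) (0, w) := by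
  have h1 : HasFDerivAt (fun z : E => (t, z)) (ContinuousLinearMap.inr ℝ ℝ E) p :=
    hasFDerivAt_prodMk_right t p
  have h2 : HasFDerivAt (fun z => φ (t, z)) _ p := h.hasFDerivAt.comp p h1
  rw [h2.fderiv]
  simp

lemma fderiv_partial_left {F : Type*} [NormedAddCommGroup F] [NormedSpace ℝ F] {φ : ℝ × E → F}
    {t : ℝ} {p : E} {v : F} (h : DifferentiableAt ℝ φ (t, p))
    (hv : HasDerivAt (fun s => φ (s, p)) v t) : fderiv ℝ φ (t, p) (1, 0) = v := by
  have h1 : HasFDerivAt (fun s : ℝ => (s, p)) (ContinuousLinearMap.inl ℝ ℝ E) t :=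
    hasFDerivAt_prodMk_left t p
  have h2 : HasFDerivAt (fun s => φ (s, p)) _ t := h.hasFDerivAt.comp t h1
  have h3 := h2.hasDerivAt.unique hv
  rw [← h3]
  simp

/-- The variational equation of a flow. -/
lemma hasDerivAt_fderiv_flow {V : E → E} {φ : ℝ × E → E} {t : ℝ} {p : E}
    (hφ : ContDiffAt ℝ ∞ φ (t, p))
    (hd : ∀ᶠ x in 𝓝 (t, p), HasDerivAt (fun s => φ (s, x.2)) (V (φ x)) x.1)
    (hV : DifferentiableAt ℝ V (φ (t, p))) (w : E) :
    HasDerivAt (fun s => fderiv ℝ (fun z => φ (s, z)) p w)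
      (fderiv ℝ V (φ (t, p)) (fderiv ℝ (fun z => φ (t, z)) p w)) t := by
  have hdiff : ∀ᶠ x in 𝓝 (t, p), DifferentiableAt ℝ φ x := by
    have h1 : ContDiffAt ℝ 1 φ (t, p) := hφ.of_le (by simp)
    filter_upwards [h1.eventually (by simp)] with x hx using hx.differentiableAt (by simp)
  have hφ' : DifferentiableAt ℝ (fderiv ℝ φ) (t, p) :=
    (hφ.fderiv_right (m := 1) (by rw [one_add_one_eq_two]; exact two_le_infty)).differentiableAt (by simp)
  have hsymm : IsSymmSndFDerivAt ℝ φ (t, p) := hφ.isSymmSndFDerivAt (by simpa using two_le_infty)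
  -- the two mixed partial derivatives
  have e1 : (fun x => fderiv ℝ φ x (1, 0)) =ᶠ[𝓝 (t, p)] fun x => V (φ x) := by
    filter_upwards [hdiff, hd] with x hx hx'
    exact fderiv_partial_left hx hx'
  have e2 : fderiv ℝ (fderiv ℝ φ) (t, p) (0, w) (1, 0)
      = fderiv ℝ V (φ (t, p)) (fderiv ℝ φ (t, p) (0, w)) := by
    have h1 : HasFDerivAt (fun x => fderiv ℝ φ x (1, 0)) _ (t, p) :=
      hφ'.hasFDerivAt.clm_apply (hasFDerivAt_const _ _)
    have h2 : HasFDerivAt (fun x => V (φ x)) _ (t, p) :=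
      hV.hasFDerivAt.comp (t, p) hdiff.self_of_nhds.hasFDerivAt
    have h3 := (h1.congr_of_eventuallyEq e1.symm).unique h2
    have h4 := congrArg (fun L => L (0, w)) h3
    simpa using h4
  have e3 : (fun s => fderiv ℝ (fun z => φ (s, z)) p w)
      =ᶠ[𝓝 t] fun s => fderiv ℝ φ (s, p) (0, w) := by
    have hc : ContinuousAt (fun s : ℝ => (s, p)) t := by fun_prop
    filter_upwards [hc.eventually hdiff] with s hs
    exact fderiv_partial_right hs w
  have h5 : HasDerivAt (fun s : ℝ => fderiv ℝ φ (s, p) (0, w))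
      (fderiv ℝ (fderiv ℝ φ) (t, p) (1, 0) (0, w)) t := by
    have h1 : HasFDerivAt (fun x => fderiv ℝ φ x (0, w)) _ (t, p) :=
      hφ'.hasFDerivAt.clm_apply (hasFDerivAt_const _ _)
    have h2 : HasFDerivAt (fun s : ℝ => (s, p)) (ContinuousLinearMap.inl ℝ ℝ E) t :=
      hasFDerivAt_prodMk_left t p
    have h3 : HasFDerivAt (fun s : ℝ => fderiv ℝ φ (s, p) (0, w)) _ t :=
      HasFDerivAt.comp (f := fun s : ℝ => (s, p)) (g := fun x => fderiv ℝ φ x (0, w)) t h1 h2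
    refine h3.hasDerivAt.congr_deriv ?_
    simp
  -- Symmetry of the second derivative exchanges time and space: the flow equation differentiated in
  -- the direction w becomes the variational equation.
  rw [hsymm, e2, ← fderiv_partial_right hdiff.self_of_nhds] at h5
  exact h5.congr_of_eventuallyEq e3

end Pullback

/-- The derivative of the pullback of a one-form `α` by the flow of a field `V` in its kernel. -/
lemma hasDerivAt_pullback {V : E3 → E3} {φ : ℝ × E3 → E3} {α : E3 → E3 →L[ℝ] ℝ} {t : ℝ} {p : E3}
    (hφ : ContDiffAt ℝ ∞ φ (t, p))
    (hd : ∀ᶠ x in 𝓝 (t, p), HasDerivAt (fun s => φ (s, x.2)) (V (φ x)) x.1)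
    (hV : DifferentiableAt ℝ V (φ (t, p))) (hα : DifferentiableAt ℝ α (φ (t, p)))
    (hαV : ∀ᶠ y in 𝓝 (φ (t, p)), α y (V y) = 0) (w : E3) :
    HasDerivAt (fun s => α (φ (s, p)) (fderiv ℝ (fun z => φ (s, z)) p w))
      (extD α (φ (t, p)) (V (φ (t, p))) (fderiv ℝ (fun z => φ (t, z)) p w)) t := by
  have h1 := hasDerivAt_fderiv_flow hφ hd hV w
  have h2 : HasDerivAt (fun s => α (φ (s, p))) (fderiv ℝ α (φ (t, p)) (V (φ (t, p)))) t :=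
    hα.hasFDerivAt.comp_hasDerivAt t hd.self_of_nhds
  refine (h2.clm_apply h1).congr_deriv ?_
  -- Differentiating α(V) = 0 in the direction w replaces α(D_w V) by −(D_w α)(V), which completes
  -- the exterior derivative.
  have h3 : HasFDerivAt (fun y => α y (V y)) _ (φ (t, p)) :=
    hα.hasFDerivAt.clm_apply hV.hasFDerivAt
  have h4 := h3.unique ((hasFDerivAt_const (0 : ℝ) _).congr_of_eventuallyEq hαV)
  have h5 := congrArg (fun L => L (fderiv ℝ (fun z => φ (t, z)) p w)) h4
  simp only [add_apply, ContinuousLinearMap.comp_apply,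
    ContinuousLinearMap.flip_apply, zero_apply] at h5
  simp only [extD]
  linarith

lemma eq_zero_of_hasDerivAt_mul {h l : ℝ → ℝ} {R C : ℝ} (hR : 0 < R)
    (hd : ∀ t ∈ Set.Ioo (-R) R, HasDerivAt h (l t * h t) t) (hl : ∀ t ∈ Set.Ioo (-R) R, |l t| ≤ C)
    (h0 : h 0 = 0) : ∀ t ∈ Set.Ioo (-R) R, h t = 0 := by
  have h0R : (0 : ℝ) ∈ Set.Ioo (-R) R := ⟨by linarith, hR⟩
  have key := ODE_solution_unique_of_mem_Ioo (v := fun t x => l t * x) (s := fun _ => Set.univ)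
    (K := C.toNNReal) (f := h) (g := fun _ => 0) (a := -R) (b := R) (t₀ := 0)
    (fun t ht => by
      rw [lipschitzOnWith_univ]
      refine LipschitzWith.of_dist_le_mul fun x y => ?_
      rw [Real.dist_eq, Real.dist_eq, ← mul_sub, abs_mul]
      exact mul_le_mul_of_nonneg_right ((hl t ht).trans (Real.le_coe_toNNReal C)) (abs_nonneg _))
    h0R (fun t ht => ⟨hd t ht, trivial⟩)
    (fun t _ => ⟨by simpa using hasDerivAt_const t (0 : ℝ), trivial⟩) h0
  exact fun t ht => key ht

/-- Since i_V dα = λα, the function t ↦ (φ_t^* α)(w) solves the scalar linear equation h' = λh, and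
vanishing at t = 0 propagates. The flow therefore preserves ker α. The bound on λ serves the
uniqueness theorem for the equation. -/
lemma IsFlowBox.pullback_eq_zero {V : E3 → E3} {U : Set E3} (hU : IsOpen U) {φ : ℝ × E3 → E3}
    {R : ℝ} {z : E3} (hφ : IsFlowBox V U φ R z) (hV : ContDiffOn ℝ ∞ V U) {α : E3 → E3 →L[ℝ] ℝ}
    (hα : ContDiffOn ℝ ∞ α U) (hαV : ∀ y ∈ U, α y (V y) = 0) {lam : E3 → ℝ} {C : ℝ}
    (hlam : ∀ y ∈ U, |lam y| ≤ C) (hd : ∀ y ∈ U, ∀ v, extD α y (V y) v = lam y * α y v)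
    {t : ℝ} (ht : t ∈ Set.Ioo (-R) R) {p : E3} (hp : p ∈ Metric.ball z R) {w : E3}
    (hw : α p w = 0) : α (φ (t, p)) (fderiv ℝ (fun z => φ (t, z)) p w) = 0 := by
  have hopen : IsOpen (Set.Ioo (-R) R ×ˢ Metric.ball z R) := isOpen_Ioo.prod Metric.isOpen_ball
  refine eq_zero_of_hasDerivAt_mul (h := fun t => α (φ (t, p)) (fderiv ℝ (fun z => φ (t, z)) p w))
    (l := fun t => lam (φ (t, p))) hφ.pos (fun s hs => ?_)
    (fun s hs => hlam _ (hφ.mem s hs p hp)) ?_ t ht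
  · have hm := hφ.mem s hs p hp
    have := hasDerivAt_pullback (hφ.smooth.contDiffAt (hopen.mem_nhds ⟨hs, hp⟩))
      (by filter_upwards [hopen.mem_nhds ⟨hs, hp⟩] with x hx using hφ.deriv x.1 hx.1 x.2 hx.2)
      ((hV.contDiffAt (hU.mem_nhds hm)).differentiableAt (by simp))
      ((hα.contDiffAt (hU.mem_nhds hm)).differentiableAt (by simp))
      (by filter_upwards [hU.mem_nhds hm] with y hy using hαV y hy) w
    rwa [hd _ hm] at this
  · have h1 : (fun z => φ (0, z)) =ᶠ[𝓝 p] id := by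
      filter_upwards [Metric.isOpen_ball.mem_nhds hp] with y hy using hφ.zero y hy
    simp only [h1.fderiv_eq, fderiv_id, hφ.zero p hp]
    simpa using hw

/-! ### Linear algebra in three dimensions -/

/-- The standard basis of coordinate space. -/
def stdVec (i : Fin 3) : E3 := EuclideanSpace.single i 1

@[simp] lemma stdVec_apply (i j : Fin 3) : stdVec i j = if j = i then 1 else 0 := by
  simp [stdVec]

lemma eq_sum_stdVec (z : E3) : z = z 0 • stdVec 0 + z 1 • stdVec 1 + z 2 • stdVec 2 := by
  ext i
  fin_cases i <;> simp [stdVec_apply]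

lemma contDiff_coord (i : Fin 3) : ContDiff ℝ ∞ (fun z : E3 => z i) :=
  (EuclideanSpace.proj (𝕜 := ℝ) i : E3 →L[ℝ] ℝ).contDiff

lemma continuous_coord (i : Fin 3) : Continuous (fun z : E3 => z i) := (contDiff_coord i).continuous

lemma exists_equiv_of_injective (L : E3 →L[ℝ] E3) (hL : ∀ z, L z = 0 → z = 0) :
    ∃ e : E3 ≃L[ℝ] E3, (e : E3 →L[ℝ] E3) = L := by
  have hinj : Function.Injective L.toLinearMap :=
    (injective_iff_map_eq_zero L.toLinearMap).2 hL
  refine ⟨(LinearEquiv.ofInjectiveEndo L.toLinearMap hinj).toContinuousLinearEquiv, ?_⟩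
  ext1 x
  rfl

/-- Supplies the initial directions for the parametrization in Frobenius' theorem: n leaves the
plane ker θ, and v completes x to a basis of that plane. -/
lemma exists_transverse_frame {θ : E3 →L[ℝ] ℝ} {x : E3} (hθ : θ ≠ 0) (hx : x ≠ 0) (hθx : θ x = 0) :
    ∃ n v : E3, θ n ≠ 0 ∧ θ v = 0 ∧
      ∀ a b c : ℝ, a • n + b • v + c • x = 0 → a = 0 ∧ b = 0 ∧ c = 0 := by
  obtain ⟨n, hn⟩ : ∃ n, θ n ≠ 0 := by
    by_contra! h
    exact hθ (ContinuousLinearMap.ext h)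
  have hker : ∃ v, θ v = 0 ∧ v ∉ Submodule.span ℝ {x} := by
    by_contra! h
    have h1 : LinearMap.ker θ.toLinearMap ≤ Submodule.span ℝ {x} := fun v hv => h v hv
    have h2 := LinearMap.finrank_range_add_finrank_ker θ.toLinearMap
    have h3 := Submodule.finrank_mono h1
    have h4 : Module.finrank ℝ (Submodule.span ℝ {x}) ≤ 1 := finrank_span_singleton hx |>.le
    have h5 := Submodule.finrank_le (LinearMap.range θ.toLinearMap)
    rw [Module.finrank_self] at h5
    rw [finrank_euclideanSpace_fin] at h2
    omega
  obtain ⟨v, hv, hvx⟩ := hker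
  refine ⟨n, v, hn, hv, fun a b c h => ?_⟩
  have ha : a = 0 := by
    have := congrArg θ h
    simpa [hv, hθx, hn] using this
  rw [ha, zero_smul, zero_add] at h
  have hb : b = 0 := by
    by_contra hb
    apply hvx
    rw [Submodule.mem_span_singleton]
    refine ⟨-(b⁻¹ * c), ?_⟩
    have : b • v = -(c • x) := eq_neg_of_add_eq_zero_left h
    rw [neg_smul, mul_smul, ← smul_neg, ← this, smul_smul, inv_mul_cancel₀ hb, one_smul]
  rw [hb, zero_smul, zero_add] at h
  exact ⟨ha, hb, (smul_eq_zero.1 h).resolve_right hx⟩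

/-! ### Integrating factors -/

set_option maxHeartbeats 1000000 in
/-- Frobenius' theorem for a one-form `θ` with a characteristic direction `X`: if `θ(X) = 0` and
`i_X dθ` is proportional to `θ`, then locally `θ = g dx`. -/
theorem exists_integrating_factor {U : Set E3} (hU : IsOpen U) {y₀ : E3} (hy₀ : y₀ ∈ U)
    {X : E3 → E3} {θ : E3 → E3 →L[ℝ] ℝ} {lam : E3 → ℝ} (hX : ContDiffOn ℝ ∞ X U)
    (hθ : ContDiffOn ℝ ∞ θ U) (hlam : ContinuousOn lam U) (hX0 : X y₀ ≠ 0) (hθ0 : θ y₀ ≠ 0)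
    (hθX : ∀ y ∈ U, θ y (X y) = 0) (hd : ∀ y ∈ U, ∀ v, extD θ y (X y) v = lam y * θ y v) :
    ∃ (W : Set E3) (x g : E3 → ℝ), IsOpen W ∧ y₀ ∈ W ∧ W ⊆ U ∧ ContDiffOn ℝ ∞ x W ∧
      ContDiffOn ℝ ∞ g W ∧ ∀ y ∈ W, θ y = g y • fderiv ℝ x y ∧ g y ≠ 0 := by
  obtain ⟨n, v, hn, hv, hind⟩ := exists_transverse_frame hθ0 hX0 (hθX y₀ hy₀)
  -- a smaller domain
  have hθn : ContDiffOn ℝ ∞ (fun y => θ y n) U := hθ.clm_apply contDiffOn_const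
  have hθv : ContDiffOn ℝ ∞ (fun y => θ y v) U := hθ.clm_apply contDiffOn_const
  let U₁ : Set E3 := (U ∩ (fun y => θ y n) ⁻¹' {0}ᶜ) ∩ (U ∩ lam ⁻¹' Metric.ball (lam y₀) 1)
  have hU₁ : IsOpen U₁ := (hθn.continuousOn.isOpen_inter_preimage hU isOpen_compl_singleton).inter
    (hlam.isOpen_inter_preimage hU Metric.isOpen_ball)
  have hy₁ : y₀ ∈ U₁ := ⟨⟨hy₀, hn⟩, hy₀, Metric.mem_ball_self one_pos⟩
  have hsub : U₁ ⊆ U := fun y hy => hy.1.1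
  have hlamb : ∀ y ∈ U₁, |lam y| ≤ |lam y₀| + 1 := by
    intro y hy
    have h1 : |lam y - lam y₀| < 1 := hy.2.2
    have h2 := abs_sub_abs_le_abs_sub (lam y) (lam y₀)
    linarith
  let V : E3 → E3 := fun y => v - (θ y v / θ y n) • n
  have hV : ContDiffOn ℝ ∞ V U₁ := contDiffOn_const.sub
    (((hθv.mono hsub).div (hθn.mono hsub) fun y hy => hy.1.2).smul contDiffOn_const)
  have hθV : ∀ y ∈ U₁, θ y (V y) = 0 := by
    intro y hy
    have : θ y n ≠ 0 := hy.1.2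
    simp [V, this]
  have hV0 : V y₀ = v := by simp [V, hv]
  obtain ⟨φ, R, hφ⟩ := exists_isFlowBox hU₁ (hX.mono hsub) hy₁
  obtain ⟨ψ, R', hψ⟩ := exists_isFlowBox (hU₁.inter Metric.isOpen_ball)
    (hV.mono Set.inter_subset_left) ⟨hy₁, Metric.mem_ball_self (x := y₀) hφ.pos⟩
  have hφo : IsOpen (Set.Ioo (-R) R ×ˢ Metric.ball y₀ R) := isOpen_Ioo.prod Metric.isOpen_ball
  have hψo : IsOpen (Set.Ioo (-R') R' ×ˢ Metric.ball y₀ R') := isOpen_Ioo.prod Metric.isOpen_ball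
  have h0R : (0 : ℝ) ∈ Set.Ioo (-R) R := ⟨by linarith [hφ.pos], hφ.pos⟩
  have h0R' : (0 : ℝ) ∈ Set.Ioo (-R') R' := ⟨by linarith [hψ.pos], hψ.pos⟩
  -- the parametrization
  let q : E3 → E3 := fun z => y₀ + z 0 • n
  let p : E3 → E3 := fun z => ψ (z 1, q z)
  -- Start on the transversal y₀ + z₀ n, follow V for time z₁, then X for time z₂. The surfaces z₀ =
  -- const are going to be the leaves of ker θ.
  let Φ : E3 → E3 := fun z => φ (z 2, p z)
  let Z : Set E3 := {z | (z 1, q z) ∈ Set.Ioo (-R') R' ×ˢ Metric.ball y₀ R'} ∩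
    {z | z 2 ∈ Set.Ioo (-R) R}
  have hq : ContDiff ℝ ∞ q := contDiff_const.add ((contDiff_coord 0).smul contDiff_const)
  have hq1 : ContDiff ℝ ∞ (fun z : E3 => (z 1, q z)) := (contDiff_coord 1).prodMk hq
  have hZ : IsOpen Z := (hψo.preimage hq1.continuous).inter
    (isOpen_Ioo.preimage (continuous_coord 2))
  have hq0 : q 0 = y₀ := by simp [q]
  have h0Z : (0 : E3) ∈ Z := by
    refine ⟨⟨h0R', ?_⟩, h0R⟩
    change q 0 ∈ _
    rw [hq0]
    exact Metric.mem_ball_self hψ.pos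
  have hpmem : ∀ z ∈ Z, p z ∈ U₁ ∩ Metric.ball y₀ R := fun z hz => hψ.mem _ hz.1.1 _ hz.1.2
  have hpsm : ContDiffOn ℝ ∞ p Z := hψ.smooth.comp hq1.contDiffOn fun z hz => hz.1
  have hΦsm : ContDiffOn ℝ ∞ Φ Z :=
    hφ.smooth.comp ((contDiff_coord 2).contDiffOn.prodMk hpsm) fun z hz => ⟨hz.2, (hpmem z hz).2⟩
  have hΦmem : ∀ z ∈ Z, Φ z ∈ U₁ := fun z hz => hφ.mem _ hz.2 _ (hpmem z hz).2
  have hp0 : p 0 = y₀ := by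
    change ψ ((0 : E3) 1, q 0) = y₀
    rw [hq0]
    exact hψ.zero _ (Metric.mem_ball_self hψ.pos)
  have hΦ0 : Φ 0 = y₀ := by
    change φ ((0 : E3) 2, p 0) = y₀
    rw [hp0]
    exact hφ.zero _ (Metric.mem_ball_self hφ.pos)
  have hΦd : ∀ z ∈ Z, DifferentiableAt ℝ Φ z := fun z hz =>
    (hΦsm.contDiffAt (hZ.mem_nhds hz)).differentiableAt (by simp)
  -- its partial derivatives
  have hD2 : ∀ z ∈ Z, fderiv ℝ Φ z (stdVec 2) = X (Φ z) := by
    intro z hz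
    have h1 : HasDerivAt (fun s : ℝ => Φ (z + s • stdVec 2)) (fderiv ℝ Φ z (stdVec 2)) 0 :=
      (hΦd z hz).hasFDerivAt.hasLineDerivAt _
    have h2 : (fun s : ℝ => Φ (z + s • stdVec 2)) = fun s => φ (z 2 + s, p z) := by
      funext s
      simp [Φ, p, q]
    rw [h2] at h1
    refine h1.unique (HasDerivAt.comp_const_add (f := fun s => φ (s, p z)) (z 2) 0 ?_)
    rw [add_zero]
    exact hφ.deriv _ hz.2 _ (hpmem z hz).2
  have hD1 : ∀ z ∈ Z, fderiv ℝ Φ z (stdVec 1)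
      = fderiv ℝ (fun w => φ (z 2, w)) (p z) (V (p z)) := by
    intro z hz
    have h1 : HasDerivAt (fun s : ℝ => Φ (z + s • stdVec 1)) (fderiv ℝ Φ z (stdVec 1)) 0 :=
      (hΦd z hz).hasFDerivAt.hasLineDerivAt _
    have h2 : (fun s : ℝ => Φ (z + s • stdVec 1)) = fun s => φ (z 2, ψ (z 1 + s, q z)) := by
      funext s
      simp [Φ, p, q]
    rw [h2] at h1
    have h3 : HasDerivAt (fun s => ψ (z 1 + s, q z)) (V (p z)) 0 := by
      refine HasDerivAt.comp_const_add (f := fun s => ψ (s, q z)) (z 1) 0 ?_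
      rw [add_zero]
      exact hψ.deriv _ hz.1.1 _ hz.1.2
    have h4 : DifferentiableAt ℝ (fun w => φ (z 2, w)) (ψ (z 1 + 0, q z)) := by
      rw [add_zero]
      have hmm : (z 2, p z) ∈ Set.Ioo (-R) R ×ˢ Metric.ball y₀ R := ⟨hz.2, (hpmem z hz).2⟩
      have h5 : DifferentiableAt ℝ φ (z 2, p z) :=
        (hφ.smooth.contDiffAt (hφo.mem_nhds hmm)).differentiableAt (by simp)
      exact DifferentiableAt.comp (f := fun w : E3 => (z 2, w)) (p z) h5 (by fun_prop)
    have h6 := h4.hasFDerivAt.comp_hasDerivAt (0 : ℝ) h3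
    rw [add_zero] at h6
    exact h1.unique h6
  have hD0 : fderiv ℝ Φ 0 (stdVec 0) = n := by
    have h1 : HasDerivAt (fun s : ℝ => Φ (0 + s • stdVec 0)) (fderiv ℝ Φ 0 (stdVec 0)) 0 :=
      (hΦd 0 h0Z).hasFDerivAt.hasLineDerivAt _
    have h2 : (fun s : ℝ => Φ (0 + s • stdVec 0)) =ᶠ[𝓝 0] fun s => y₀ + s • n := by
      have hc : ContinuousAt (fun s : ℝ => y₀ + s • n) 0 := by fun_prop
      rw [ContinuousAt, zero_smul, add_zero] at hc
      have e1 := hc.eventually (Metric.ball_mem_nhds y₀ hφ.pos)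
      have e2 := hc.eventually (Metric.ball_mem_nhds y₀ hψ.pos)
      filter_upwards [e1, e2] with s hs1 hs2
      have e3 : Φ (0 + s • stdVec 0) = φ (0, ψ (0, y₀ + s • n)) := by simp [Φ, p, q]
      rw [e3, hψ.zero _ hs2, hφ.zero _ hs1]
    have h3 : HasDerivAt (fun s : ℝ => y₀ + s • n) n 0 := by
      simpa using ((hasDerivAt_id (0 : ℝ)).smul_const n).const_add y₀
    exact (h1.congr_of_eventuallyEq h2.symm).unique h3
  have hD1' : fderiv ℝ Φ 0 (stdVec 1) = v := by
    rw [hD1 0 h0Z, hp0, hV0]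
    have h1 : (fun w => φ ((0 : E3) 2, w)) =ᶠ[𝓝 y₀] id := by
      filter_upwards [Metric.ball_mem_nhds y₀ hφ.pos] with y hy using hφ.zero y hy
    rw [h1.fderiv_eq, fderiv_id]
    rfl
  have hL : ∀ z, fderiv ℝ Φ 0 z = z 0 • n + z 1 • v + z 2 • X y₀ := by
    intro z
    conv_lhs => rw [eq_sum_stdVec z]
    rw [map_add, map_add, map_smul, map_smul, map_smul, hD0, hD1', hD2 0 h0Z, hΦ0]
  obtain ⟨L, hL'⟩ := exists_equiv_of_injective (fderiv ℝ Φ 0) (by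
    intro z hz
    rw [hL] at hz
    obtain ⟨h0, h1, h2⟩ := hind _ _ _ hz
    rw [eq_sum_stdVec z, h0, h1, h2]
    simp)
  -- the pullback of `θ`
  let γ : E3 → ℝ := fun z => θ (Φ z) (fderiv ℝ Φ z (stdVec 0))
  have hγ : ContDiffOn ℝ ∞ γ Z :=
    (hθ.comp hΦsm fun z hz => hsub (hΦmem z hz)).clm_apply
      ((hΦsm.fderiv_of_isOpen hZ (by simp)).clm_apply contDiffOn_const)
  have hpull : ∀ z ∈ Z, ∀ w, θ (Φ z) (fderiv ℝ Φ z w) = γ z * w 0 := by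
    intro z hz w
    -- This partial derivative is the image of the vector V in ker θ under the flow of X, and that
    -- flow preserves ker θ.
    have h1 : θ (Φ z) (fderiv ℝ Φ z (stdVec 1)) = 0 := by
      rw [hD1 z hz]
      exact hφ.pullback_eq_zero hU₁ (hX.mono hsub) (hθ.mono hsub) (fun y hy => hθX y (hsub hy))
        hlamb (fun y hy => hd y (hsub hy)) hz.2 (hpmem z hz).2 (hθV _ (hpmem z hz).1)
    have h2 : θ (Φ z) (fderiv ℝ Φ z (stdVec 2)) = 0 := by
      rw [hD2 z hz]
      exact hθX _ (hsub (hΦmem z hz))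
    conv_lhs => rw [eq_sum_stdVec w]
    simp only [map_add, map_smul, h1, h2, mul_zero, add_zero, smul_eq_mul]
    exact mul_comm (w 0) (γ z)
  have hγ0 : γ 0 ≠ 0 := by
    change θ (Φ 0) (fderiv ℝ Φ 0 (stdVec 0)) ≠ 0
    rw [hΦ0, hD0]
    exact hn
  let Z₁ : Set E3 := Z ∩ γ ⁻¹' {0}ᶜ
  have hZ₁ : IsOpen Z₁ := hγ.continuousOn.isOpen_inter_preimage hZ isOpen_compl_singleton
  obtain ⟨P, h0P, hPZ, hPΦ, hPs⟩ := exists_smooth_localInverse hZ₁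
    (hΦsm.mono Set.inter_subset_left) ⟨h0Z, hγ0⟩ L (by
      rw [hL']; exact (hΦd 0 h0Z).hasFDerivAt)
  have hmt : ∀ y ∈ P.target, P.symm y ∈ Z₁ := fun y hy => hPZ (P.map_target hy)
  have hsubt : P.target ⊆ U := by
    intro y hy
    have := hΦmem _ (hmt y hy).1
    rw [← hPΦ, P.right_inv hy] at this
    exact hsub this
  -- The pullback of θ by Φ is γ dz₀, so x is the coordinate z₀ and g is γ, both read through the
  -- inverse of Φ.
  refine ⟨P.target, fun y => P.symm y 0, fun y => γ (P.symm y), P.open_target, ?_, hsubt, ?_, ?_,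
    fun y hy => ⟨?_, (hmt y hy).2⟩⟩
  · rw [← hΦ0, ← hPΦ]
    exact P.map_source h0P
  · exact (contDiff_coord 0).comp_contDiffOn hPs
  · exact hγ.comp hPs fun y hy => (hmt y hy).1
  · have hyn := P.open_target.mem_nhds hy
    have hds : DifferentiableAt ℝ P.symm y := (hPs.contDiffAt hyn).differentiableAt (by simp)
    have hid : (fun y => Φ (P.symm y)) =ᶠ[𝓝 y] id := by
      filter_upwards [hyn] with w hw
      rw [← hPΦ, P.right_inv hw, id]
    have hcomp : HasFDerivAt (fun y => Φ (P.symm y))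
        ((fderiv ℝ Φ (P.symm y)).comp (fderiv ℝ P.symm y)) y :=
      (hΦd _ (hmt y hy).1).hasFDerivAt.comp y hds.hasFDerivAt
    have h1 := hcomp.unique ((hasFDerivAt_id y).congr_of_eventuallyEq hid)
    have h2 : HasFDerivAt (fun y => P.symm y 0)
        ((EuclideanSpace.proj (𝕜 := ℝ) (0 : Fin 3) : E3 →L[ℝ] ℝ).comp (fderiv ℝ P.symm y)) y :=
      (EuclideanSpace.proj (𝕜 := ℝ) (0 : Fin 3) : E3 →L[ℝ] ℝ).hasFDerivAt.comp y hds.hasFDerivAt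
    rw [h2.fderiv]
    ext w
    have h3 := hpull _ (hmt y hy).1 (fderiv ℝ P.symm y w)
    have h4 := congrArg (fun M => M w) h1
    simp only [ContinuousLinearMap.comp_apply, ContinuousLinearMap.id_apply] at h4
    rw [h4, ← hPΦ, P.right_inv hy] at h3
    rw [h3]
    rfl

/-! ### Calculus of one-forms on coordinate space -/

/-- The determinant of three vectors. -/
def det3 (u v w : E3) : ℝ :=
  u 0 * (v 1 * w 2 - v 2 * w 1) - u 1 * (v 0 * w 2 - v 2 * w 0) + u 2 * (v 0 * w 1 - v 1 * w 0)

lemma clm_apply_eq_sum (a : E3 →L[ℝ] ℝ) (u : E3) :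
    a u = u 0 * a (stdVec 0) + u 1 * a (stdVec 1) + u 2 * a (stdVec 2) := by
  conv_lhs => rw [eq_sum_stdVec u]
  simp only [map_add, map_smul, smul_eq_mul]

lemma fderiv_apply_eq_sum (α : E3 → E3 →L[ℝ] ℝ) (y u v : E3) : fderiv ℝ α y u v
    = u 0 * (v 0 * fderiv ℝ α y (stdVec 0) (stdVec 0) + v 1 * fderiv ℝ α y (stdVec 0) (stdVec 1)
        + v 2 * fderiv ℝ α y (stdVec 0) (stdVec 2))
      + u 1 * (v 0 * fderiv ℝ α y (stdVec 1) (stdVec 0) + v 1 * fderiv ℝ α y (stdVec 1) (stdVec 1)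
        + v 2 * fderiv ℝ α y (stdVec 1) (stdVec 2))
      + u 2 * (v 0 * fderiv ℝ α y (stdVec 2) (stdVec 0) + v 1 * fderiv ℝ α y (stdVec 2) (stdVec 1)
        + v 2 * fderiv ℝ α y (stdVec 2) (stdVec 2)) := by
  rw [← clm_apply_eq_sum, ← clm_apply_eq_sum, ← clm_apply_eq_sum]
  conv_lhs => rw [eq_sum_stdVec u]
  simp only [map_add, map_smul, add_apply, smul_apply, smul_eq_mul]

/-- A three-form is determined by its value on the standard basis. -/
lemma wedgeD_eq_det3 (α β : E3 → E3 →L[ℝ] ℝ) (y u v w : E3) : wedgeD α β y u v w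
    = det3 u v w * wedgeD α β y (stdVec 0) (stdVec 1) (stdVec 2) := by
  simp only [wedgeD, extD, det3]
  rw [clm_apply_eq_sum (α y) u, clm_apply_eq_sum (α y) v, clm_apply_eq_sum (α y) w,
    fderiv_apply_eq_sum β y u v, fderiv_apply_eq_sum β y v u, fderiv_apply_eq_sum β y u w,
    fderiv_apply_eq_sum β y w u, fderiv_apply_eq_sum β y v w, fderiv_apply_eq_sum β y w v]
  ring

lemma det3_cramer (x u v z : E3) :
    det3 x u v • z = det3 z u v • x + det3 x z v • u + det3 x u z • v := by
  ext i
  fin_cases i <;> simp [det3] <;> ring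

lemma extD_smul_left (α : E3 → E3 →L[ℝ] ℝ) (y u v : E3) (c : ℝ) :
    extD α y (c • u) v = c * extD α y u v := by
  simp only [extD, map_smul, smul_apply, smul_eq_mul]; ring

lemma extD_congr {α β : E3 → E3 →L[ℝ] ℝ} {y : E3} (h : α =ᶠ[𝓝 y] β) (u v : E3) :
    extD α y u v = extD β y u v := by
  simp only [extD, h.fderiv_eq]

lemma wedgeD_congr {α β α' β' : E3 → E3 →L[ℝ] ℝ} {y : E3} (h : α =ᶠ[𝓝 y] β)
    (h' : α' =ᶠ[𝓝 y] β') (u v w : E3) : wedgeD α α' y u v w = wedgeD β β' y u v w := by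
  simp only [wedgeD, extD_congr h', h.self_of_nhds]

lemma extD_smul {f : E3 → ℝ} {α : E3 → E3 →L[ℝ] ℝ} {y : E3} (hf : DifferentiableAt ℝ f y)
    (hα : DifferentiableAt ℝ α y) (u v : E3) : extD (fun z => f z • α z) y u v
      = f y * extD α y u v + wedge (fderiv ℝ f y) (α y) u v := by
  have h : HasFDerivAt (fun z => f z • α z) _ y := hf.hasFDerivAt.smul hα.hasFDerivAt
  simp only [extD, h.fderiv, wedge, add_apply, smul_apply, ContinuousLinearMap.smulRight_apply,
    smul_eq_mul]
  ring

lemma extD_add {α β : E3 → E3 →L[ℝ] ℝ} {y : E3} (hα : DifferentiableAt ℝ α y)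
    (hβ : DifferentiableAt ℝ β y) (u v : E3) :
    extD (fun z => α z + β z) y u v = extD α y u v + extD β y u v := by
  have h : HasFDerivAt (fun z => α z + β z) _ y := hα.hasFDerivAt.add hβ.hasFDerivAt
  simp only [extD, h.fderiv, add_apply]
  ring

lemma extD_add_smul {f : E3 → ℝ} {α β : E3 → E3 →L[ℝ] ℝ} {y : E3} (hα : DifferentiableAt ℝ α y)
    (hf : DifferentiableAt ℝ f y) (hβ : DifferentiableAt ℝ β y) (u v : E3) :
    extD (fun z => α z + f z • β z) y u v
      = extD α y u v + (f y * extD β y u v + wedge (fderiv ℝ f y) (β y) u v) := by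
  have hs : DifferentiableAt ℝ (fun z => f z • β z) y := hf.smul hβ
  rw [extD_add hα hs, extD_smul hf hβ]

lemma extD_smul_add_smul {f g : E3 → ℝ} {α β : E3 → E3 →L[ℝ] ℝ} {y : E3}
    (hf : DifferentiableAt ℝ f y) (hα : DifferentiableAt ℝ α y) (hg : DifferentiableAt ℝ g y)
    (hβ : DifferentiableAt ℝ β y) (u v : E3) :
    extD (fun z => f z • α z + g z • β z) y u v
      = f y * extD α y u v + wedge (fderiv ℝ f y) (α y) u v
        + (g y * extD β y u v + wedge (fderiv ℝ g y) (β y) u v) := by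
  have hs : DifferentiableAt ℝ (fun z => f z • α z) y := hf.smul hα
  rw [extD_add_smul hs hg hβ, extD_smul hf hα]

lemma extD_fderiv {f : E3 → ℝ} {y : E3} (hf : ContDiffAt ℝ ∞ f y) (u v : E3) :
    extD (fderiv ℝ f) y u v = 0 := by
  have h : IsSymmSndFDerivAt ℝ f y := hf.isSymmSndFDerivAt (by simpa using two_le_infty)
  exact sub_eq_zero.2 (h u v)

lemma contDiffOn_extD {U : Set E3} (hU : IsOpen U) {α : E3 → E3 →L[ℝ] ℝ}
    (hα : ContDiffOn ℝ ∞ α U) (u v : E3) : ContDiffOn ℝ ∞ (fun y => extD α y u v) U := by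
  have h := hα.fderiv_of_isOpen hU (m := ∞) (by simp)
  exact ((h.clm_apply contDiffOn_const).clm_apply contDiffOn_const).sub
    ((h.clm_apply contDiffOn_const).clm_apply contDiffOn_const)

lemma contDiffOn_wedgeD {U : Set E3} (hU : IsOpen U) {α β : E3 → E3 →L[ℝ] ℝ}
    (hα : ContDiffOn ℝ ∞ α U) (hβ : ContDiffOn ℝ ∞ β U) (u v w : E3) :
    ContDiffOn ℝ ∞ (fun y => wedgeD α β y u v w) U :=
  ((((hα.clm_apply contDiffOn_const).mul (contDiffOn_extD hU hβ v w)).sub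
    ((hα.clm_apply contDiffOn_const).mul (contDiffOn_extD hU hβ u w))).add
    ((hα.clm_apply contDiffOn_const).mul (contDiffOn_extD hU hβ u v)))

lemma wedgeD_smul {f g : E3 → ℝ} {α β : E3 → E3 →L[ℝ] ℝ} {y : E3} (hg : DifferentiableAt ℝ g y)
    (hβ : DifferentiableAt ℝ β y) (u v w : E3) :
    wedgeD (fun z => f z • α z) (fun z => g z • β z) y u v w = f y * g y * wedgeD α β y u v w
      + f y * (α y u * wedge (fderiv ℝ g y) (β y) v w - α y v * wedge (fderiv ℝ g y) (β y) u w
        + α y w * wedge (fderiv ℝ g y) (β y) u v) := by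
  simp only [wedgeD, extD_smul hg hβ, smul_apply, smul_eq_mul]
  ring

/-! ### Balanced pairs of contact forms on open subsets of coordinate space -/

/-- `α, β` are balanced contact forms on the open set `U`, normalized with respect to the field
`X`, and `I` is their generating invariant. -/
structure IsBalancedOn (U : Set E3) (ε : ℝ) (X : E3 → E3) (I : E3 → ℝ)
    (α β : E3 → E3 →L[ℝ] ℝ) : Prop where
  isOpen : IsOpen U
  smooth₁ : ContDiffOn ℝ ∞ α U
  smooth₂ : ContDiffOn ℝ ∞ β U
  frame : ∀ y ∈ U, ∃ w₁ w₂ : E3, α y w₁ = 1 ∧ β y w₁ = 0 ∧ α y w₂ = 0 ∧ β y w₂ = 1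
  balanced : ∀ y ∈ U, ∀ u v w : E3, wedgeD α α y u v w = ε * wedgeD β β y u v w
  normalized : ∀ y ∈ U, ∀ v w : E3, wedgeD α α y (X y) v w = wedge (α y) (β y) v w
  invariant : ∀ y ∈ U, ∀ u v w : E3,
    I y * wedgeD α α y u v w = wedgeD α β y u v w + wedgeD β α y u v w

namespace IsBalancedOn

variable {U : Set E3} {ε : ℝ} {X : E3 → E3} {I : E3 → ℝ} {α β : E3 → E3 →L[ℝ] ℝ}

lemma mono (h : IsBalancedOn U ε X I α β) {W : Set E3} (hW : IsOpen W) (hWU : W ⊆ U) :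
    IsBalancedOn W ε X I α β :=
  ⟨hW, h.smooth₁.mono hWU, h.smooth₂.mono hWU, fun y hy => h.frame y (hWU hy),
    fun y hy => h.balanced y (hWU hy), fun y hy => h.normalized y (hWU hy),
    fun y hy => h.invariant y (hWU hy)⟩

lemma differentiableAt₁ (h : IsBalancedOn U ε X I α β) {y : E3} (hy : y ∈ U) :
    DifferentiableAt ℝ α y :=
  (h.smooth₁.contDiffAt (h.isOpen.mem_nhds hy)).differentiableAt (by simp)

lemma differentiableAt₂ (h : IsBalancedOn U ε X I α β) {y : E3} (hy : y ∈ U) :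
    DifferentiableAt ℝ β y :=
  (h.smooth₂.contDiffAt (h.isOpen.mem_nhds hy)).differentiableAt (by simp)

lemma axis (h : IsBalancedOn U ε X I α β) {y : E3} (hy : y ∈ U) :
    α y (X y) = 0 ∧ β y (X y) = 0 := by
  obtain ⟨w₁, w₂, h1, h2, h3, h4⟩ := h.frame y hy
  have e : ∀ w, wedge (α y) (β y) (X y) w = 0 := fun w => by
    have h0 : det3 (X y) (X y) w = 0 := by simp only [det3]; ring
    rw [← h.normalized y hy, wedgeD_eq_det3, h0, zero_mul]
  have e1 := e w₁
  have e2 := e w₂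
  simp only [wedge, h1, h2, h3, h4, mul_one, mul_zero, one_mul, zero_mul, sub_zero, zero_sub,
    neg_eq_zero] at e1 e2
  exact ⟨e2, e1⟩

lemma wedgeD_axis (h : IsBalancedOn U ε X I α β) {y : E3} (hy : y ∈ U) (v w : E3) :
    α y w * extD α y (X y) v - α y v * extD α y (X y) w = wedge (α y) (β y) v w := by
  rw [← h.normalized y hy]
  simp only [wedgeD, (h.axis hy).1]
  ring

/-- The Lie derivatives of `α` and `β` along `X`. -/
lemma lieDeriv (h : IsBalancedOn U ε X I α β) (hε : ε = 1 ∨ ε = -1) {y : E3} (hy : y ∈ U) :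
    ∃ k k' : ℝ, k - k' = I y ∧ (∀ v, extD α y (X y) v = k * α y v - β y v) ∧
      ∀ v, extD β y (X y) v = ε * α y v + k' * β y v := by
  obtain ⟨w₁, w₂, h1, h2, h3, h4⟩ := h.frame y hy
  have hεε : ε * ε = 1 := by rcases hε with rfl | rfl <;> norm_num
  -- Since α(X) = 0, the normalization reads −α ∧ i_X dα = α ∧ β. It fixes the β-coefficient of i_X
  -- dα and leaves the α-coefficient free.
  have ha : ∀ v, extD α y (X y) v = extD α y (X y) w₁ * α y v - β y v := by
    intro v
    have := h.wedgeD_axis hy w₁ v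
    simp only [wedge, h1, h2] at this
    linarith
  -- The balance condition gives i_X(β ∧ dβ) = ε α ∧ β, which fixes the α-coefficient of i_X dβ.
  have hb : ∀ v, extD β y (X y) v = ε * α y v + extD β y (X y) w₂ * β y v := by
    intro v
    have e1 := h.balanced y hy (X y) w₂ v
    rw [h.normalized y hy] at e1
    simp only [wedge, wedgeD, (h.axis hy).2, h3, h4] at e1
    have e2 := congrArg (fun r => ε * r) e1
    linear_combination e2 + (β y v * extD β y (X y) w₂ - extD β y (X y) v) * hεε
  refine ⟨extD α y (X y) w₁, extD β y (X y) w₂, ?_, ha, hb⟩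
  -- The definition of I, contracted with X and evaluated on the dual frame, compares the two free
  -- coefficients.
  have e := h.invariant y hy (X y) w₁ w₂
  rw [h.normalized y hy] at e
  simp only [wedge, wedgeD, (h.axis hy).1, (h.axis hy).2, h1, h2, h3, h4] at e
  linarith

lemma decompose (h : IsBalancedOn U ε X I α β) {y : E3} (hy : y ∈ U) {w₁ w₂ : E3}
    (h1 : α y w₁ = 1) (h2 : β y w₁ = 0) (h3 : α y w₂ = 0) (h4 : β y w₂ = 1) (z : E3) :
    ∃ a : ℝ, z = a • X y + α y z • w₁ + β y z • w₂ := by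
  have e := h.normalized y hy w₁ w₂
  have hdet : det3 (X y) w₁ w₂ ≠ 0 := by
    intro h0
    rw [wedgeD_eq_det3, h0] at e
    simp [wedge, h1, h2, h3, h4] at e
  obtain ⟨a, b, c, hz⟩ : ∃ a b c : ℝ, z = a • X y + b • w₁ + c • w₂ := by
    refine ⟨(det3 (X y) w₁ w₂)⁻¹ * det3 z w₁ w₂, (det3 (X y) w₁ w₂)⁻¹ * det3 (X y) z w₂,
      (det3 (X y) w₁ w₂)⁻¹ * det3 (X y) w₁ z, ?_⟩
    rw [mul_smul, mul_smul, mul_smul, ← smul_add, ← smul_add, ← det3_cramer, smul_smul,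
      inv_mul_cancel₀ hdet, one_smul]
  refine ⟨a, ?_⟩
  have hb : α y z = b := by simp [hz, h1, h3, (h.axis hy).1]
  have hc : β y z = c := by simp [hz, h2, h4, (h.axis hy).2]
  rw [hb, hc]
  exact hz

lemma eq_smul_axis (h : IsBalancedOn U ε X I α β) {y : E3} (hy : y ∈ U) {z : E3}
    (hα : α y z = 0) (hβ : β y z = 0) : ∃ a : ℝ, z = a • X y := by
  obtain ⟨w₁, w₂, h1, h2, h3, h4⟩ := h.frame y hy
  obtain ⟨a, ha⟩ := h.decompose hy h1 h2 h3 h4 z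
  exact ⟨a, by rw [ha, hα, hβ]; simp⟩

lemma volume_ne_zero (h : IsBalancedOn U ε X I α β) {y : E3} (hy : y ∈ U) :
    wedgeD α α y (stdVec 0) (stdVec 1) (stdVec 2) ≠ 0 := by
  obtain ⟨w₁, w₂, h1, h2, h3, h4⟩ := h.frame y hy
  intro h0
  have e := h.normalized y hy w₁ w₂
  rw [wedgeD_eq_det3, h0] at e
  simp [wedge, h1, h2, h3, h4] at e

lemma axis_ne_zero (h : IsBalancedOn U ε X I α β) {y : E3} (hy : y ∈ U) : X y ≠ 0 := by
  obtain ⟨w₁, w₂, h1, h2, h3, h4⟩ := h.frame y hy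
  intro h0
  have e := h.normalized y hy w₁ w₂
  rw [wedgeD_eq_det3, h0] at e
  simp [wedge, det3, h1, h2, h3, h4] at e

lemma smooth_invariant (h : IsBalancedOn U ε X I α β) : ContDiffOn ℝ ∞ I U := by
  refine (((contDiffOn_wedgeD h.isOpen h.smooth₁ h.smooth₂ (stdVec 0) (stdVec 1) (stdVec 2)).add
    (contDiffOn_wedgeD h.isOpen h.smooth₂ h.smooth₁ (stdVec 0) (stdVec 1) (stdVec 2))).div
    (contDiffOn_wedgeD h.isOpen h.smooth₁ h.smooth₁ (stdVec 0) (stdVec 1) (stdVec 2))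
    (fun y hy => h.volume_ne_zero hy)).congr fun y hy => ?_
  rw [Pi.div_apply, eq_div_iff (h.volume_ne_zero hy), h.invariant y hy]

/-- By the normalization the components of X are values of α ∧ β on pairs of basis vectors divided
by the volume α ∧ dα. -/
lemma smooth_axis (h : IsBalancedOn U ε X I α β) : ContDiffOn ℝ ∞ X U := by
  let vol : E3 → ℝ := fun y => wedgeD α α y (stdVec 0) (stdVec 1) (stdVec 2)
  have hvol : ContDiffOn ℝ ∞ vol U := contDiffOn_wedgeD h.isOpen h.smooth₁ h.smooth₁ _ _ _
  have hw : ∀ u v, ContDiffOn ℝ ∞ (fun y => wedge (α y) (β y) u v) U := fun u v =>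
    ((h.smooth₁.clm_apply contDiffOn_const).mul (h.smooth₂.clm_apply contDiffOn_const)).sub
      ((h.smooth₁.clm_apply contDiffOn_const).mul (h.smooth₂.clm_apply contDiffOn_const))
  have key : ∀ i j k : Fin 3, (∀ x : E3, det3 x (stdVec j) (stdVec k) = x i) →
      ContDiffOn ℝ ∞ (fun y => X y i) U := by
    intro i j k hijk
    refine ((hw (stdVec j) (stdVec k)).div hvol fun y hy => h.volume_ne_zero hy).congr
      fun y hy => ?_
    rw [Pi.div_apply, eq_div_iff (h.volume_ne_zero hy), ← h.normalized y hy,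
      wedgeD_eq_det3 α α y (X y), hijk]
  rw [contDiffOn_euclidean]
  intro i
  fin_cases i
  · exact key 0 1 2 (fun x => by simp [det3])
  · exact key 1 2 0 (fun x => by simp [det3])
  · exact key 2 0 1 (fun x => by simp [det3])

/-- A covector vanishing on the axis is a combination of `α` and `β`. -/
lemma exists_coeff (h : IsBalancedOn U ε X I α β) {y : E3} (hy : y ∈ U) {γ : E3 →L[ℝ] ℝ}
    (hγ : γ (X y) = 0) : ∃ a b : ℝ, γ = a • α y + b • β y := by
  obtain ⟨w₁, w₂, h1, h2, h3, h4⟩ := h.frame y hy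
  refine ⟨γ w₁, γ w₂, ?_⟩
  ext z
  obtain ⟨c, hc⟩ := h.decompose hy h1 h2 h3 h4 z
  conv_lhs => rw [hc]
  simp only [map_add, map_smul, hγ, add_apply, smul_apply, smul_eq_mul]
  ring

/-- The coefficients of a smooth one-form vanishing on the axis are smooth. -/
lemma smooth_coeff (h : IsBalancedOn U ε X I α β) {γ : E3 → E3 →L[ℝ] ℝ}
    (hγ : ContDiffOn ℝ ∞ γ U) {a b : E3 → ℝ} (hab : ∀ y ∈ U, γ y = a y • α y + b y • β y) :
    ContDiffOn ℝ ∞ a U ∧ ContDiffOn ℝ ∞ b U := by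
  have hw : ∀ {γ δ : E3 → E3 →L[ℝ] ℝ}, ContDiffOn ℝ ∞ γ U → ContDiffOn ℝ ∞ δ U → ∀ u v,
      ContDiffOn ℝ ∞ (fun y => wedge (γ y) (δ y) u v) U := fun hγ hδ u v =>
    ((hγ.clm_apply contDiffOn_const).mul (hδ.clm_apply contDiffOn_const)).sub
      ((hγ.clm_apply contDiffOn_const).mul (hδ.clm_apply contDiffOn_const))
  have key : ∀ y ∈ U, ContDiffAt ℝ ∞ a y ∧ ContDiffAt ℝ ∞ b y := by
    intro y hy
    obtain ⟨w₁, w₂, h1, h2, h3, h4⟩ := h.frame y hy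
    have h0 : wedge (α y) (β y) w₁ w₂ ≠ 0 := by simp [wedge, h1, h2, h3, h4]
    have hs := (hw h.smooth₁ h.smooth₂ w₁ w₂)
    have hn : ∀ᶠ z in 𝓝 y, z ∈ U ∧ wedge (α z) (β z) w₁ w₂ ≠ 0 :=
      (h.isOpen.eventually_mem hy).and
        ((hs.continuousOn.continuousAt (h.isOpen.mem_nhds hy)).eventually_ne h0)
    have hU := h.isOpen.mem_nhds hy
    constructor
    · refine ((hw hγ h.smooth₂ w₁ w₂).contDiffAt hU |>.div (hs.contDiffAt hU) h0
        ).congr_of_eventuallyEq ?_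
      filter_upwards [hn] with z hz
      change a z = wedge (γ z) (β z) w₁ w₂ / wedge (α z) (β z) w₁ w₂
      rw [eq_div_iff hz.2, hab z hz.1]
      simp only [wedge, add_apply, smul_apply, smul_eq_mul]
      ring
    · refine ((hw h.smooth₁ hγ w₁ w₂).contDiffAt hU |>.div (hs.contDiffAt hU) h0
        ).congr_of_eventuallyEq ?_
      filter_upwards [hn] with z hz
      change b z = wedge (α z) (γ z) w₁ w₂ / wedge (α z) (β z) w₁ w₂
      rw [eq_div_iff hz.2, hab z hz.1]
      simp only [wedge, add_apply, smul_apply, smul_eq_mul]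
      ring
  exact ⟨fun y hy => (key y hy).1.contDiffWithinAt, fun y hy => (key y hy).2.contDiffWithinAt⟩

/-- Balanced forms may be multiplied by a common non-zero factor. -/
lemma smul (h : IsBalancedOn U ε X I α β) {f : E3 → ℝ} (hf : ContDiffOn ℝ ∞ f U)
    (hf0 : ∀ y ∈ U, f y ≠ 0) :
    IsBalancedOn U ε X I (fun y => f y • α y) (fun y => f y • β y) := by
  have hd : ∀ y ∈ U, DifferentiableAt ℝ f y := fun y hy =>
    (hf.contDiffAt (h.isOpen.mem_nhds hy)).differentiableAt (by simp)
  -- All terms with df cancel: α ∧ df ∧ α = 0, and the two mixed terms in the equation for I are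
  -- opposite. What remains is a common factor f² on both sides of each identity.
  refine ⟨h.isOpen, hf.smul h.smooth₁, hf.smul h.smooth₂, fun y hy => ?_, fun y hy u v w => ?_,
    fun y hy v w => ?_, fun y hy u v w => ?_⟩
  · obtain ⟨w₁, w₂, h1, h2, h3, h4⟩ := h.frame y hy
    refine ⟨(f y)⁻¹ • w₁, (f y)⁻¹ • w₂, ?_, ?_, ?_, ?_⟩ <;> simp [h1, h2, h3, h4, hf0 y hy]
  · have e := h.balanced y hy u v w
    rw [wedgeD_smul (hd y hy) (h.differentiableAt₁ hy), wedgeD_smul (hd y hy)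
      (h.differentiableAt₂ hy)]
    simp only [wedge]
    linear_combination f y * f y * e
  · have e := h.normalized y hy v w
    rw [wedgeD_smul (hd y hy) (h.differentiableAt₁ hy)]
    simp only [wedge, smul_apply, smul_eq_mul] at e ⊢
    linear_combination f y * f y * e
  · have e := h.invariant y hy u v w
    rw [wedgeD_smul (hd y hy) (h.differentiableAt₁ hy), wedgeD_smul (hd y hy)
      (h.differentiableAt₂ hy), wedgeD_smul (hd y hy) (h.differentiableAt₁ hy)]
    simp only [wedge]
    linear_combination f y * f y * e

end IsBalancedOn

lemma exists_eventually_eq_smul {U : Set E3} (hU : IsOpen U) {α α' : E3 → E3 →L[ℝ] ℝ}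
    (hα : ContDiffOn ℝ ∞ α U) (hα' : ContDiffOn ℝ ∞ α' U) {y : E3} (hy : y ∈ U) (h0 : α y ≠ 0)
    (hker : ∀ z ∈ U, ∀ v, α z v = 0 → α' z v = 0) :
    ∃ f : E3 → ℝ, ContDiffAt ℝ ∞ f y ∧ α' =ᶠ[𝓝 y] fun z => f z • α z := by
  obtain ⟨w, hw⟩ : ∃ w, α y w ≠ 0 := by
    by_contra! h
    exact h0 (ContinuousLinearMap.ext h)
  have hs : ContDiffOn ℝ ∞ (fun z => α z w) U := hα.clm_apply contDiffOn_const
  have hs' : ContDiffOn ℝ ∞ (fun z => α' z w) U := hα'.clm_apply contDiffOn_const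
  refine ⟨fun z => α' z w / α z w,
    (hs'.contDiffAt (hU.mem_nhds hy)).div (hs.contDiffAt (hU.mem_nhds hy)) hw, ?_⟩
  filter_upwards [hU.mem_nhds hy,
    (hs.continuousOn.continuousAt (hU.mem_nhds hy)).eventually_ne hw] with z hz hzw
  ext v
  have h1 := hker z hz (v - (α z v / α z w) • w) (by simp [hzw])
  simp only [map_sub, map_smul, smul_eq_mul, sub_eq_zero] at h1
  simp only [smul_apply, smul_eq_mul, h1]
  ring

/-- Balanced forms are determined up to a common factor. -/
lemma IsBalancedOn.exists_factor {U : Set E3} {ε : ℝ} {X : E3 → E3} {I : E3 → ℝ}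
    {α β α' β' : E3 → E3 →L[ℝ] ℝ} (h : IsBalancedOn U ε X I α β)
    (h' : IsBalancedOn U ε X I α' β') (hα : ∀ z ∈ U, ∀ v, α z v = 0 → α' z v = 0)
    (hβ : ∀ z ∈ U, ∀ v, β z v = 0 → β' z v = 0) {y : E3} (hy : y ∈ U) :
    ∃ f : ℝ, f ≠ 0 ∧ α' y = f • α y ∧ β' y = f • β y := by
  obtain ⟨w₁, w₂, h1, h2, h3, h4⟩ := h.frame y hy
  obtain ⟨f, hf, hfα⟩ := exists_eventually_eq_smul h.isOpen h.smooth₁ h'.smooth₁ hy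
    (fun h0 => by simp [h0] at h1) hα
  obtain ⟨g, hg, hgβ⟩ := exists_eventually_eq_smul h.isOpen h.smooth₂ h'.smooth₂ hy
    (fun h0 => by simp [h0] at h4) hβ
  have e1 := hfα.self_of_nhds
  have e2 := hgβ.self_of_nhds
  have hf0 : f y ≠ 0 := by
    intro h0
    obtain ⟨w, -, hw, -⟩ := h'.frame y hy
    rw [e1] at hw
    simp [h0] at hw
  -- With α' = f α and β' = g β, the normalization i_X(α' ∧ dα') = α' ∧ β' reads f² = f g.
  have e3 := h'.normalized y hy w₁ w₂
  rw [wedgeD_congr hfα hfα, wedgeD_smul (hf.differentiableAt (by simp)) (h.differentiableAt₁ hy),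
    h.normalized y hy, e1, e2] at e3
  simp only [wedge, smul_apply, smul_eq_mul, h1, h2, h3, h4, (h.axis hy).1] at e3
  have e4 : f y = g y := by
    have : f y * (f y - g y) = 0 := by linarith
    rcases mul_eq_zero.1 this with h5 | h5
    · exact absurd h5 hf0
    · linarith
  exact ⟨f y, hf0, e1, by rw [e2, e4]⟩

/-! ### The Schwarzian derivative of the transition map -/

/-- The Schwarzian derivative of the transition map `f` between the affine coordinates
`q = -a₁/a₂` and `r = -b₁/b₂` of two moving lines. -/
theorem schwarzianDeriv_transition {a₁ a₂ b₁ b₂ g k k' I q r f : ℝ → ℝ} {ε I' : ℝ} (hε : ε ≠ 0)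
    (ha₁ : ∀ᶠ t in 𝓝 (0 : ℝ), HasDerivAt a₁ (g t * (k t * a₁ t - b₁ t)) t)
    (ha₂ : ∀ᶠ t in 𝓝 (0 : ℝ), HasDerivAt a₂ (g t * (k t * a₂ t - b₂ t)) t)
    (hb₁ : ∀ᶠ t in 𝓝 (0 : ℝ), HasDerivAt b₁ (g t * (ε * a₁ t + k' t * b₁ t)) t)
    (hb₂ : ∀ᶠ t in 𝓝 (0 : ℝ), HasDerivAt b₂ (g t * (ε * a₂ t + k' t * b₂ t)) t)
    (hk : ∀ᶠ t in 𝓝 (0 : ℝ), I t = k t - k' t) (hI : HasDerivAt I I' 0)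
    (hne : ∀ᶠ t in 𝓝 (0 : ℝ), a₂ t ≠ 0 ∧ b₂ t ≠ 0 ∧ g t ≠ 0)
    (hW : a₁ 0 * b₂ 0 - a₂ 0 * b₁ 0 ≠ 0)
    (hq : ∀ᶠ t in 𝓝 (0 : ℝ), a₁ t + q t * a₂ t = 0)
    (hr : ∀ᶠ t in 𝓝 (0 : ℝ), b₁ t + r t * b₂ t = 0)
    (hf : ContDiffAt ℝ ∞ f (q 0)) (hfr : ∀ᶠ t in 𝓝 (0 : ℝ), r t = f (q t)) :
    schwarzianDeriv f (q 0) * deriv q 0 ^ 2 = 2 * g 0 * I' := by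
  -- Both q' and r' are multiples of this determinant, so it cancels in f' = r'/q'. It is non-zero
  -- because the two lines are distinct.
  let W : ℝ → ℝ := fun t => a₁ t * b₂ t - a₂ t * b₁ t
  have hWc : ContinuousAt W 0 :=
    ((ha₁.self_of_nhds.continuousAt.mul hb₂.self_of_nhds.continuousAt).sub
      (ha₂.self_of_nhds.continuousAt.mul hb₁.self_of_nhds.continuousAt))
  have hWne : ∀ᶠ t in 𝓝 (0 : ℝ), W t ≠ 0 := hWc.eventually_ne hW
  let qd : ℝ → ℝ := fun t => -(g t * W t / a₂ t ^ 2)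
  have hqd : ∀ᶠ t in 𝓝 (0 : ℝ), HasDerivAt q (qd t) t := by
    filter_upwards [ha₁, ha₂, hne, (hne.and hq).eventually_nhds] with t h1 h2 h3 h4
    have h5 : q =ᶠ[𝓝 t] fun s => -(a₁ s / a₂ s) := by
      filter_upwards [h4] with s hs
      have := hs.1.1
      field_simp
      linarith [hs.2]
    refine ((h1.div h2 h3.1).neg.congr_of_eventuallyEq h5).congr_deriv ?_
    simp only [qd, W]
    ring
  have hrd : ∀ᶠ t in 𝓝 (0 : ℝ), HasDerivAt r (-(g t * ε * W t / b₂ t ^ 2)) t := by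
    filter_upwards [hb₁, hb₂, hne, (hne.and hr).eventually_nhds] with t h1 h2 h3 h4
    have h5 : r =ᶠ[𝓝 t] fun s => -(b₁ s / b₂ s) := by
      filter_upwards [h4] with s hs
      have := hs.1.2.1
      field_simp
      linarith [hs.2]
    refine ((h1.div h2 h3.2.1).neg.congr_of_eventuallyEq h5).congr_deriv ?_
    simp only [W]
    ring
  have hqc : ContinuousAt q 0 := hqd.self_of_nhds.continuousAt
  have hqdne : ∀ᶠ t in 𝓝 (0 : ℝ), qd t ≠ 0 := by
    filter_upwards [hne, hWne] with t h1 h2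
    exact neg_ne_zero.2 (div_ne_zero (mul_ne_zero h1.2.2 h2) (pow_ne_zero _ h1.1))
  have hf3 : ContDiffAt ℝ 3 f (q 0) := hf.of_le (WithTop.coe_le_coe.2 (le_top : (3 : ℕ∞) ≤ ⊤))
  have hf1 : ∀ᶠ t in 𝓝 (0 : ℝ), ContDiffAt ℝ 3 f (q t) :=
    hqc.eventually (hf3.eventually (by simp))
  -- the first derivative of `f` along `q`
  have hA : ∀ᶠ t in 𝓝 (0 : ℝ), deriv f (q t) = ε * (a₂ t / b₂ t) ^ 2 := by
    filter_upwards [hf1, hqd, hrd, hqdne, hne, hfr.eventually_nhds] with t h1 h2 h3 h4 h5 h6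
    have h7 : HasDerivAt (fun s => f (q s)) (deriv f (q t) * qd t) t :=
      (h1.differentiableAt (by simp)).hasDerivAt.comp t h2
    have h8 := (h7.congr_of_eventuallyEq h6).unique h3
    have e1 := h5.1
    have e2 := h5.2.1
    refine mul_right_cancel₀ h4 (h8.trans ?_)
    simp only [qd]
    field_simp
  -- the second derivative
  let P : ℝ → ℝ := fun t =>
    -2 * ((I t - b₂ t / a₂ t - ε * (a₂ t / b₂ t)) * (a₂ t ^ 2 / W t))
  -- P is the logarithmic derivative of ε(a₂/b₂)² in t, divided by q'. Of the coefficients k, k'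
  -- only the difference I survives.
  have hB : ∀ᶠ t in 𝓝 (0 : ℝ), deriv (deriv f) (q t) / deriv f (q t) = P t := by
    filter_upwards [hf1, hqd, hqdne, hne, hA.eventually_nhds, ha₂, hb₂, hk, hWne] with
      t h1 h2 h4 h5 h6 h7 h8 h9 h10
    have h11 : HasDerivAt (fun s => deriv f (q s)) (deriv (deriv f) (q t) * qd t) t := by
      have : DifferentiableAt ℝ (deriv f) (q t) :=
        (h1.derivWithin (m := 2) (by norm_num)).differentiableAt (by simp)
      exact this.hasDerivAt.comp t h2
    have h12 := ((h7.div h8 h5.2.1).pow 2).const_mul ε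
    have h13 := (h11.congr_of_eventuallyEq
      (f₁ := fun s => ε * (a₂ s / b₂ s) ^ 2) (by filter_upwards [h6] with s hs using hs.symm)).unique
        h12
    have e1 := h5.1
    have e2 := h5.2.1
    have e3 := h5.2.2
    rw [h6.self_of_nhds, div_eq_iff (mul_ne_zero hε (pow_ne_zero _ (div_ne_zero e1 e2)))]
    refine mul_right_cancel₀ h4 (h13.trans ?_)
    simp only [P, qd, h9, Pi.div_apply, Nat.reduceSub, pow_one, Nat.cast_ofNat]
    have h10' : W t ≠ 0 := h10
    field_simp
    ring
  have hC : deriv (fun s => deriv (deriv f) s / deriv f s) (q 0) * qd 0 = deriv P 0 := by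
    have h1 : DifferentiableAt ℝ (fun s => deriv (deriv f) s / deriv f s) (q 0) := by
      have hd1 : ContDiffAt ℝ 2 (deriv f) (q 0) := hf3.derivWithin (m := 2) (by norm_num)
      have hd2 : ContDiffAt ℝ 1 (deriv (deriv f)) (q 0) := hd1.derivWithin (m := 1) (by norm_num)
      refine (hd2.differentiableAt (by simp)).div (hd1.differentiableAt (by simp)) ?_
      rw [hA.self_of_nhds]
      exact mul_ne_zero hε (pow_ne_zero _ (div_ne_zero hne.self_of_nhds.1 hne.self_of_nhds.2.1))
    have h2 := h1.hasDerivAt.comp (0 : ℝ) hqd.self_of_nhds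
    exact (h2.congr_of_eventuallyEq (by filter_upwards [hB] with t ht using ht.symm)).deriv.symm
  have e1 := hne.self_of_nhds.1
  have e2 := hne.self_of_nhds.2.1
  have e3 := hne.self_of_nhds.2.2
  have A1 := ha₁.self_of_nhds
  have A2 := ha₂.self_of_nhds
  have B1 := hb₁.self_of_nhds
  have B2 := hb₂.self_of_nhds
  have hWd : HasDerivAt W (g 0 * (k 0 + k' 0) * W 0) 0 := by
    refine ((A1.mul B2).sub (A2.mul B1)).congr_deriv ?_
    simp only [W]
    ring
  have hPd : HasDerivAt P _ 0 :=
    (((hI.sub (B2.div A2 e1)).sub ((A2.div B2 e2).const_mul ε)).mul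
      ((A2.pow 2).div hWd hW)).const_mul (-2)
  have hqe : deriv q 0 = qd 0 := hqd.self_of_nhds.deriv
  -- With A = I − b₂/a₂ − ε a₂/b₂ one has P q' = 2gA and P' q' = 2gI' + 2g²A², so subtracting half
  -- the square leaves 2gI'.
  rw [schwarzianDeriv, hB.self_of_nhds, hqe, sub_mul, pow_two (qd 0), ← mul_assoc, hC, hPd.deriv]
  have hW0 : W 0 ≠ 0 := hW
  have hk0 := hk.self_of_nhds
  simp only [P, qd, Pi.sub_apply, Pi.div_apply, Pi.pow_apply, hk0]
  field_simp
  ring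

/-! ### The generating invariant is constant along the axis if the Schwarzian invariant vanishes -/

/-- The dual basis is taken in the span of w₁, w₂ by inverting the matrix that expresses a, b
through α, β. The last property is the initial condition that the two moving lines are distinct. -/
lemma exists_dual_pair {a b α β : E3 →L[ℝ] ℝ} {w₁ w₂ : E3} (h1 : α w₁ = 1) (h2 : β w₁ = 0)
    (h3 : α w₂ = 0) (h4 : β w₂ = 1) {a₁ a₂ b₁ b₂ : ℝ} (ha : a = a₁ • α + a₂ • β)
    (hb : b = b₁ • α + b₂ • β) (hab : LinearIndependent ℝ ![a, b]) :
    ∃ u v : E3, a u = 1 ∧ b u = 0 ∧ a v = 0 ∧ b v = 1 ∧ wedge α β u v ≠ 0 := by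
  rw [LinearIndependent.pair_iff] at hab
  have hdet : a₁ * b₂ - a₂ * b₁ ≠ 0 := by
    intro h0
    have e1 := hab b₂ (-a₂) (by
      ext z
      simp only [ha, hb, add_apply, smul_apply, smul_eq_mul, zero_apply]
      linear_combination α z * h0)
    have e2 := hab b₁ (-a₁) (by
      ext z
      simp only [ha, hb, add_apply, smul_apply, smul_eq_mul, zero_apply]
      linear_combination -β z * h0)
    have ha0 : a = 0 := by
      rw [ha, neg_eq_zero.1 e1.2, neg_eq_zero.1 e2.2]
      simp
    have := hab 1 0 (by simp [ha0])
    exact one_ne_zero this.1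
  refine ⟨(a₁ * b₂ - a₂ * b₁)⁻¹ • (b₂ • w₁ - b₁ • w₂),
    (a₁ * b₂ - a₂ * b₁)⁻¹ • (-a₂ • w₁ + a₁ • w₂), ?_, ?_, ?_, ?_, ?_⟩
  all_goals
    simp only [ha, hb, wedge, add_apply, smul_apply, smul_eq_mul, map_smul, map_add, map_sub,
      h1, h2, h3, h4]
  · field_simp
    ring
  · field_simp
    ring
  · field_simp
    ring
  · field_simp
    ring
  · have e : (a₁ * b₂ - a₂ * b₁)⁻¹ * (b₂ * 1 - b₁ * 0)
        * ((a₁ * b₂ - a₂ * b₁)⁻¹ * (-a₂ * 0 + a₁ * 1))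
        - (a₁ * b₂ - a₂ * b₁)⁻¹ * (-a₂ * 1 + a₁ * 0) * ((a₁ * b₂ - a₂ * b₁)⁻¹ * (b₂ * 0 - b₁ * 1))
        = (a₁ * b₂ - a₂ * b₁)⁻¹ := by
      field_simp
      ring
    rw [e]
    exact inv_ne_zero hdet

/-- The plane with affine coordinate q contains u + q v. This writes the coordinate as −γ(u)/γ(v), a
quotient of solutions of a linear system. -/
lemma ker_coordinates {γ a b : E3 →L[ℝ] ℝ} {u v : E3} {q : ℝ} (h1 : a u = 1) (h2 : b u = 0)
    (h3 : a v = 0) (h4 : b v = 1) (h : ∀ w, γ w = 0 ↔ (b - q • a) w = 0) :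
    γ v ≠ 0 ∧ γ u + q * γ v = 0 := by
  have e1 : γ u + q * γ v = 0 := by
    have := (h (u + q • v)).2 (by simp [h1, h2, h3, h4])
    simpa using this
  refine ⟨fun h0 => ?_, e1⟩
  have := (h v).1 h0
  simp [h3, h4] at this

/-- On the axis curve V = gX, so the pulled back forms, evaluated on a fixed dual pair, solve the
linear system of `schwarzianDeriv_transition`. At t = 0 the flow is the identity and g = 1, hence a
vanishing Schwarzian value means 2 X I = 0. -/
lemma IsBalancedOn.fderiv_invariant_axis {U : Set E3} {ε : ℝ} {X : E3 → E3} {I : E3 → ℝ}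
    {α β : E3 → E3 →L[ℝ] ℝ} (h : IsBalancedOn U ε X I α β) (hε : ε = 1 ∨ ε = -1) {y₀ : E3}
    (hy : y₀ ∈ U) {V : E3 → E3} {φ : ℝ × E3 → E3} {a b : E3 →L[ℝ] ℝ} {q r f : ℝ → ℝ}
    (hV0 : V y₀ = X y₀) (hV : ∃ N ∈ 𝓝 y₀, ContDiffOn ℝ ∞ V N)
    (hVαβ : ∀ᶠ z in 𝓝 y₀, α z (V z) = 0 ∧ β z (V z) = 0)
    (hφ : ∃ N ∈ 𝓝 ((0 : ℝ), y₀), ContDiffOn ℝ ∞ φ N) (hφ0 : ∀ᶠ z in 𝓝 y₀, φ (0, z) = z)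
    (hφd : ∀ᶠ x in 𝓝 ((0 : ℝ), y₀), HasDerivAt (fun t => φ (t, x.2)) (V (φ x)) x.1)
    (hab : LinearIndependent ℝ ![a, b]) (haV : a (V y₀) = 0) (hbV : b (V y₀) = 0)
    (hq : ∀ᶠ t in 𝓝 (0 : ℝ), ∀ w, α (φ (t, y₀)) (fderiv ℝ (fun z => φ (t, z)) y₀ w) = 0 ↔
      (b - q t • a) w = 0)
    (hr : ∀ᶠ t in 𝓝 (0 : ℝ), ∀ w, β (φ (t, y₀)) (fderiv ℝ (fun z => φ (t, z)) y₀ w) = 0 ↔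
      (b - r t • a) w = 0)
    (hf : ContDiffAt ℝ ∞ f (q 0)) (hfr : ∀ᶠ t in 𝓝 (0 : ℝ), r t = f (q t))
    (hs : schwarzianDeriv f (q 0) * deriv q 0 ^ 2 = 0) : fderiv ℝ I y₀ (X y₀) = 0 := by
  obtain ⟨w₁, w₂, h1, h2, h3, h4⟩ := h.frame y₀ hy
  obtain ⟨a₁, a₂, ha⟩ := h.exists_coeff hy (γ := a) (by rw [← hV0]; exact haV)
  obtain ⟨b₁, b₂, hb⟩ := h.exists_coeff hy (γ := b) (by rw [← hV0]; exact hbV)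
  obtain ⟨u, v, hu1, hu2, hv1, hv2, huv⟩ := exists_dual_pair h1 h2 h3 h4 ha hb hab
  obtain ⟨N, hN, hφN⟩ := hφ
  obtain ⟨N', hN', hVN⟩ := hV
  have hφc : ContinuousAt φ (0, y₀) := hφN.continuousOn.continuousAt hN
  have hφy : φ (0, y₀) = y₀ := hφ0.self_of_nhds
  have hφt : Filter.Tendsto (fun t : ℝ => φ (t, y₀)) (𝓝 0) (𝓝 y₀) := by
    have h5 : ContinuousAt (fun t : ℝ => φ (t, y₀)) 0 :=
      ContinuousAt.comp (f := fun t : ℝ => (t, y₀)) hφc (by fun_prop)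
    have h6 := h5.tendsto
    simp only [hφy] at h6
    exact h6
  have hpt : Filter.Tendsto (fun t : ℝ => (t, y₀)) (𝓝 0) (𝓝 ((0 : ℝ), y₀)) :=
    (show Continuous fun t : ℝ => (t, y₀) by fun_prop).tendsto 0
  have hVd : ∀ᶠ z in 𝓝 y₀, DifferentiableAt ℝ V z := by
    filter_upwards [eventually_mem_nhds_iff.2 hN'] with z hz
    exact (hVN.contDiffAt hz).differentiableAt (by simp)
  -- the coefficients of the equations of motion
  have hex : ∀ᶠ t in 𝓝 (0 : ℝ), ∃ c : ℝ × ℝ × ℝ, V (φ (t, y₀)) = c.1 • X (φ (t, y₀)) ∧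
      c.2.1 - c.2.2 = I (φ (t, y₀)) ∧
      (∀ w, extD α (φ (t, y₀)) (X (φ (t, y₀))) w
        = c.2.1 * α (φ (t, y₀)) w - β (φ (t, y₀)) w) ∧
      (∀ w, extD β (φ (t, y₀)) (X (φ (t, y₀))) w
        = ε * α (φ (t, y₀)) w + c.2.2 * β (φ (t, y₀)) w) := by
    filter_upwards [hφt.eventually (h.isOpen.mem_nhds hy), hφt.eventually hVαβ] with t ht ht'
    obtain ⟨g, hg⟩ := h.eq_smul_axis ht ht'.1 ht'.2
    obtain ⟨k, k', hk, e1, e2⟩ := h.lieDeriv hε ht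
    exact ⟨(g, k, k'), hg, hk, e1, e2⟩
  obtain ⟨c, hc⟩ := Filter.skolem.1 hex
  have hode : ∀ {γ : E3 → E3 →L[ℝ] ℝ}, (ContDiffOn ℝ ∞ γ U) →
      (∀ᶠ z in 𝓝 y₀, γ z (V z) = 0) → ∀ w : E3, ∀ᶠ t in 𝓝 (0 : ℝ),
      HasDerivAt (fun s => γ (φ (s, y₀)) (fderiv ℝ (fun z => φ (s, z)) y₀ w))
        ((c t).1 * extD γ (φ (t, y₀)) (X (φ (t, y₀)))
          (fderiv ℝ (fun z => φ (t, z)) y₀ w)) t := by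
    intro γ hγ hγV w
    filter_upwards [hpt.eventually (eventually_mem_nhds_iff.2 hN),
      hpt.eventually hφd.eventually_nhds, hφt.eventually hVd,
      hφt.eventually (h.isOpen.mem_nhds hy), hφt.eventually hγV.eventually_nhds, hc]
      with t e1 e2 e3 e4 e5 e6
    have := hasDerivAt_pullback (hφN.contDiffAt e1) e2 e3
      ((hγ.contDiffAt (h.isOpen.mem_nhds e4)).differentiableAt (by simp)) e5 w
    rwa [e6.1, extD_smul_left] at this
  have hVα : ∀ᶠ z in 𝓝 y₀, α z (V z) = 0 := hVαβ.mono fun z hz => hz.1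
  have hVβ : ∀ᶠ z in 𝓝 y₀, β z (V z) = 0 := hVαβ.mono fun z hz => hz.2
  have hα' : ∀ w, ∀ᶠ t in 𝓝 (0 : ℝ),
      HasDerivAt (fun s => α (φ (s, y₀)) (fderiv ℝ (fun z => φ (s, z)) y₀ w))
        ((c t).1 * ((c t).2.1 * α (φ (t, y₀)) (fderiv ℝ (fun z => φ (t, z)) y₀ w)
          - β (φ (t, y₀)) (fderiv ℝ (fun z => φ (t, z)) y₀ w))) t := by
    intro w
    filter_upwards [hode h.smooth₁ hVα w, hc] with t e1 e2
    rwa [e2.2.2.1] at e1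
  have hβ' : ∀ w, ∀ᶠ t in 𝓝 (0 : ℝ),
      HasDerivAt (fun s => β (φ (s, y₀)) (fderiv ℝ (fun z => φ (s, z)) y₀ w))
        ((c t).1 * (ε * α (φ (t, y₀)) (fderiv ℝ (fun z => φ (t, z)) y₀ w)
          + (c t).2.2 * β (φ (t, y₀)) (fderiv ℝ (fun z => φ (t, z)) y₀ w))) t := by
    intro w
    filter_upwards [hode h.smooth₂ hVβ w, hc] with t e1 e2
    rwa [e2.2.2.2] at e1
  have hqt : ∀ᶠ t in 𝓝 (0 : ℝ), α (φ (t, y₀)) (fderiv ℝ (fun z => φ (t, z)) y₀ v) ≠ 0 ∧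
      α (φ (t, y₀)) (fderiv ℝ (fun z => φ (t, z)) y₀ u)
        + q t * α (φ (t, y₀)) (fderiv ℝ (fun z => φ (t, z)) y₀ v) = 0 :=
    hq.mono fun t ht => ker_coordinates (γ := (α (φ (t, y₀))).comp
      (fderiv ℝ (fun z => φ (t, z)) y₀)) hu1 hu2 hv1 hv2 ht
  have hrt : ∀ᶠ t in 𝓝 (0 : ℝ), β (φ (t, y₀)) (fderiv ℝ (fun z => φ (t, z)) y₀ v) ≠ 0 ∧
      β (φ (t, y₀)) (fderiv ℝ (fun z => φ (t, z)) y₀ u)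
        + r t * β (φ (t, y₀)) (fderiv ℝ (fun z => φ (t, z)) y₀ v) = 0 :=
    hr.mono fun t ht => ker_coordinates (γ := (β (φ (t, y₀))).comp
      (fderiv ℝ (fun z => φ (t, z)) y₀)) hu1 hu2 hv1 hv2 ht
  have hid : fderiv ℝ (fun z => φ (0, z)) y₀ = ContinuousLinearMap.id ℝ E3 := by
    have h5 : (fun z => φ (0, z)) =ᶠ[𝓝 y₀] id := hφ0
    rw [h5.fderiv_eq, fderiv_id]
  have hVX : ∀ᶠ z in 𝓝 y₀, V z ≠ 0 := by
    have h5 : ContinuousAt V y₀ := hVN.continuousOn.continuousAt hN'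
    exact h5.eventually_ne (by rw [hV0]; exact h.axis_ne_zero hy)
  have hg0 : (c 0).1 = 1 := by
    have h5 := hc.self_of_nhds.1
    rw [hφy, hV0] at h5
    have h6 : (1 - (c 0).1) • X y₀ = 0 := by rw [sub_smul, one_smul, ← h5, sub_self]
    rcases smul_eq_zero.1 h6 with h7 | h7
    · linarith
    · exact absurd h7 (h.axis_ne_zero hy)
  have hI : HasDerivAt (fun t => I (φ (t, y₀))) (fderiv ℝ I y₀ (X y₀)) 0 := by
    have h5 : HasDerivAt (fun t => φ (t, y₀)) (X y₀) 0 := by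
      have := hφd.self_of_nhds
      simpa only [hφy, hV0] using this
    have h6 : HasFDerivAt I (fderiv ℝ I y₀) (φ (0, y₀)) := by
      rw [hφy]
      exact ((h.smooth_invariant.contDiffAt (h.isOpen.mem_nhds hy)).differentiableAt
        (by simp)).hasFDerivAt
    exact h6.comp_hasDerivAt (0 : ℝ) h5
  have key := schwarzianDeriv_transition (g := fun t => (c t).1) (k := fun t => (c t).2.1)
    (k' := fun t => (c t).2.2) (q := q) (r := r) (f := f)
    (by rcases hε with rfl | rfl <;> norm_num) (hα' u) (hα' v) (hβ' u) (hβ' v)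
    (hc.mono fun t ht => ht.2.1.symm) hI
    (by
      filter_upwards [hqt, hrt, hc, hφt.eventually hVX] with t e1 e2 e3 e4
      refine ⟨e1.1, e2.1, fun h0 => e4 ?_⟩
      rw [e3.1, h0, zero_smul])
    (by
      simp only [hid, hφy, ContinuousLinearMap.id_apply]
      exact huv)
    (hqt.mono fun t ht => ht.2) (hrt.mono fun t ht => ht.2) hf hfr
  rw [hs, hg0] at key
  linarith

/-! ### Normalized forms -/

/-- Balanced contact forms, scaled such that `dI = α + J β`. -/
structure IsNormalizedOn (U : Set E3) (ε : ℝ) (X : E3 → E3) (I J : E3 → ℝ)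
    (α β : E3 → E3 →L[ℝ] ℝ) : Prop extends IsBalancedOn U ε X I α β where
  smoothJ : ContDiffOn ℝ ∞ J U
  fderiv_invariant : ∀ y ∈ U, fderiv ℝ I y = α y + J y • β y

namespace IsNormalizedOn

variable {U : Set E3} {ε : ℝ} {X : E3 → E3} {I J : E3 → ℝ} {α β : E3 → E3 →L[ℝ] ℝ}

lemma differentiableAt_invariant (h : IsNormalizedOn U ε X I J α β) {y : E3} (hy : y ∈ U) :
    DifferentiableAt ℝ I y :=
  (h.smooth_invariant.contDiffAt (h.isOpen.mem_nhds hy)).differentiableAt (by simp)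

lemma differentiableAt_J (h : IsNormalizedOn U ε X I J α β) {y : E3} (hy : y ∈ U) :
    DifferentiableAt ℝ J y :=
  (h.smoothJ.contDiffAt (h.isOpen.mem_nhds hy)).differentiableAt (by simp)

lemma fderiv_invariant_axis (h : IsNormalizedOn U ε X I J α β) {y : E3} (hy : y ∈ U) :
    fderiv ℝ I y (X y) = 0 := by
  simp [h.fderiv_invariant y hy, h.axis hy]

/-- Contract d(α + Jβ) = d(dI) = 0 with X. Evaluation on w₁ gives k, then k − k' = I gives k', and
evaluation on w₂ gives the derivative of J along the axis. -/
lemma structure_equations (h : IsNormalizedOn U ε X I J α β) (hε : ε = 1 ∨ ε = -1) {y : E3}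
    (hy : y ∈ U) : fderiv ℝ J y (X y) = 1 + I y * J y + ε * J y ^ 2 ∧
      (∀ v, extD α y (X y) v = -(ε * J y) * α y v - β y v) ∧
      ∀ v, extD β y (X y) v = ε * α y v - (I y + ε * J y) * β y v := by
  obtain ⟨k, k', hk, ha, hb⟩ := h.lieDeriv hε hy
  obtain ⟨w₁, w₂, h1, h2, h3, h4⟩ := h.frame y hy
  have hU := h.isOpen.mem_nhds hy
  have e : ∀ v, extD α y (X y) v + (J y * extD β y (X y) v
      + wedge (fderiv ℝ J y) (β y) (X y) v) = 0 := by
    intro v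
    rw [← extD_add_smul (h.differentiableAt₁ hy) (h.differentiableAt_J hy)
        (h.differentiableAt₂ hy),
      ← extD_fderiv (h.smooth_invariant.contDiffAt hU) (X y) v]
    refine extD_congr ?_ _ _
    filter_upwards [hU] with z hz using (h.fderiv_invariant z hz).symm
  have e1 := e w₁
  have e2 := e w₂
  simp only [wedge, ha, hb, h1, h2, h3, h4, (h.axis hy).2] at e1 e2
  have hk1 : k = -(ε * J y) := by linarith
  have hk2 : k' = -(I y + ε * J y) := by linarith
  refine ⟨?_, fun v => by rw [ha, hk1], fun v => by rw [hb, hk2]; ring⟩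
  rw [hk2] at e2
  linarith

/-- The one-form `β - (I ± J) α`, which descends to the quotient by the axis. -/
def basicForm (ε : ℝ) (I J : E3 → ℝ) (α β : E3 → E3 →L[ℝ] ℝ) : E3 → E3 →L[ℝ] ℝ :=
  fun y => β y + (-(I y + ε * J y)) • α y

lemma smooth_basicForm (h : IsNormalizedOn U ε X I J α β) :
    ContDiffOn ℝ ∞ (basicForm ε I J α β) U :=
  h.smooth₂.add (((h.smooth_invariant.add (contDiffOn_const.mul h.smoothJ)).neg).smul h.smooth₁)

lemma basicForm_axis (h : IsNormalizedOn U ε X I J α β) {y : E3} (hy : y ∈ U) :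
    basicForm ε I J α β y (X y) = 0 := by
  simp [basicForm, h.axis hy]

lemma basicForm_ne_zero (h : IsNormalizedOn U ε X I J α β) {y : E3} (hy : y ∈ U) :
    basicForm ε I J α β y ≠ 0 := by
  obtain ⟨w₁, w₂, h1, h2, h3, h4⟩ := h.frame y hy
  intro h0
  have := congrArg (fun γ => γ w₂) h0
  simp [basicForm, h3, h4] at this

/-- The factor −(I + εJ) makes the β-terms cancel, and the α-terms cancel because I' = 0 and J' = 1
+ IJ + εJ². -/
lemma extD_basicForm_axis (h : IsNormalizedOn U ε X I J α β) (hε : ε = 1 ∨ ε = -1) {y : E3}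
    (hy : y ∈ U) (v : E3) : extD (basicForm ε I J α β) y (X y) v = 0 := by
  obtain ⟨hJ, ha, hb⟩ := h.structure_equations hε hy
  have hd : HasFDerivAt (fun y => -(I y + ε * J y)) (-(fderiv ℝ I y + ε • fderiv ℝ J y)) y :=
    ((h.differentiableAt_invariant hy).hasFDerivAt.add
      ((h.differentiableAt_J hy).hasFDerivAt.const_mul ε)).neg
  rw [show basicForm ε I J α β = fun y => β y + (-(I y + ε * J y)) • α y from rfl,
    extD_add_smul (h.differentiableAt₂ hy) hd.differentiableAt (h.differentiableAt₁ hy), ha, hb,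
    hd.fderiv]
  simp only [wedge, neg_apply, add_apply, smul_apply, smul_eq_mul, (h.axis hy).1,
    h.fderiv_invariant_axis hy, hJ]
  ring

/-- The one-form `J (± J α + β)`, which is integrable if `J` is constant along the axis. -/
def degenerateForm (ε : ℝ) (J : E3 → ℝ) (α β : E3 → E3 →L[ℝ] ℝ) : E3 → E3 →L[ℝ] ℝ :=
  fun y => (ε * (J y * J y)) • α y + J y • β y

lemma smooth_degenerateForm (h : IsNormalizedOn U ε X I J α β) :
    ContDiffOn ℝ ∞ (degenerateForm ε J α β) U :=
  ((contDiffOn_const.mul (h.smoothJ.mul h.smoothJ)).smul h.smooth₁).add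
    (h.smoothJ.smul h.smooth₂)

lemma degenerateForm_axis (h : IsNormalizedOn U ε X I J α β) {y : E3} (hy : y ∈ U) :
    degenerateForm ε J α β y (X y) = 0 := by
  simp [degenerateForm, h.axis hy]

lemma degenerateForm_ne_zero (h : IsNormalizedOn U ε X I J α β) {y : E3} (hy : y ∈ U)
    (hJ : J y ≠ 0) : degenerateForm ε J α β y ≠ 0 := by
  obtain ⟨w₁, w₂, h1, h2, h3, h4⟩ := h.frame y hy
  intro h0
  have := congrArg (fun γ => γ w₂) h0
  simp [degenerateForm, h3, h4, hJ] at this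

/-- Here J' = 0, so only the Lie derivatives of α and β contribute; the quadratic relation for J
makes the resulting combination proportional to the form itself. -/
lemma extD_degenerateForm_axis (h : IsNormalizedOn U ε X I J α β) (hε : ε = 1 ∨ ε = -1) {y : E3}
    (hy : y ∈ U) (hJ' : 1 + I y * J y + ε * J y ^ 2 = 0) (hJ0 : J y ≠ 0) (v : E3) :
    extD (degenerateForm ε J α β) y (X y) v
      = (1 - ε * J y ^ 2) / J y * degenerateForm ε J α β y v := by
  obtain ⟨hJ, ha, hb⟩ := h.structure_equations hε hy
  have hdJ := h.differentiableAt_J hy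
  have hd : HasFDerivAt (fun y => ε * (J y * J y)) (ε • (J y • fderiv ℝ J y + J y • fderiv ℝ J y))
      y := (hdJ.hasFDerivAt.mul hdJ.hasFDerivAt).const_mul ε
  rw [show degenerateForm ε J α β = fun y => (ε * (J y * J y)) • α y + J y • β y from rfl,
    extD_smul_add_smul hd.differentiableAt (h.differentiableAt₁ hy) hdJ (h.differentiableAt₂ hy),
    ha, hb, hd.fderiv]
  simp only [wedge, add_apply, smul_apply, smul_eq_mul, (h.axis hy).1, (h.axis hy).2, hJ, hJ']
  field_simp
  linear_combination -(β y v) * hJ'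

end IsNormalizedOn


/-! ### Pullback of one-forms by smooth maps -/

/-- The pullback of the one-form `α` by `τ`. -/
def pullForm (τ : E3 → E3) (α : E3 → E3 →L[ℝ] ℝ) (y : E3) : E3 →L[ℝ] ℝ :=
  (α (τ y)).comp (fderiv ℝ τ y)

@[simp] lemma pullForm_apply (τ : E3 → E3) (α : E3 → E3 →L[ℝ] ℝ) (y v : E3) :
    pullForm τ α y v = α (τ y) (fderiv ℝ τ y v) := rfl

/-- The second derivative of τ drops out by symmetry. -/
lemma extD_pullForm {τ : E3 → E3} {α : E3 → E3 →L[ℝ] ℝ} {y : E3} (hτ : ContDiffAt ℝ ∞ τ y)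
    (hα : DifferentiableAt ℝ α (τ y)) (u v : E3) :
    extD (pullForm τ α) y u v = extD α (τ y) (fderiv ℝ τ y u) (fderiv ℝ τ y v) := by
  have hτ' : DifferentiableAt ℝ (fderiv ℝ τ) y :=
    (hτ.fderiv_right (m := 1) (by rw [one_add_one_eq_two]; exact two_le_infty)).differentiableAt
      (by simp)
  have hs : IsSymmSndFDerivAt ℝ τ y := hτ.isSymmSndFDerivAt (by simpa using two_le_infty)
  have h1 : HasFDerivAt (fun y => α (τ y)) _ y :=
    hα.hasFDerivAt.comp y (hτ.differentiableAt (by simp)).hasFDerivAt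
  have h2 : HasFDerivAt (pullForm τ α) _ y := h1.clm_comp hτ'.hasFDerivAt
  have h3 : fderiv ℝ (fderiv ℝ τ) y u v = fderiv ℝ (fderiv ℝ τ) y v u := hs u v
  simp only [extD, h2.fderiv]
  simp [h3]

lemma wedgeD_pullForm {τ : E3 → E3} {α β : E3 → E3 →L[ℝ] ℝ} {y : E3} (hτ : ContDiffAt ℝ ∞ τ y)
    (hβ : DifferentiableAt ℝ β (τ y)) (u v w : E3) :
    wedgeD (pullForm τ α) (pullForm τ β) y u v w
      = wedgeD α β (τ y) (fderiv ℝ τ y u) (fderiv ℝ τ y v) (fderiv ℝ τ y w) := by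
  simp only [wedgeD, extD_pullForm hτ hβ, pullForm_apply]

lemma contDiffOn_pullForm {τ : E3 → E3} {α : E3 → E3 →L[ℝ] ℝ} {U W : Set E3} (hW : IsOpen W)
    (hτ : ContDiffOn ℝ ∞ τ W) (hα : ContDiffOn ℝ ∞ α U) (hWU : Set.MapsTo τ W U) :
    ContDiffOn ℝ ∞ (pullForm τ α) W :=
  (hα.comp hτ hWU).clm_comp (hτ.fderiv_of_isOpen hW (by simp))

lemma IsBalancedOn.pullForm {U W : Set E3} {ε : ℝ} {X X' : E3 → E3} {I I' : E3 → ℝ}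
    {α β : E3 → E3 →L[ℝ] ℝ} (h : IsBalancedOn U ε X I α β) {τ : E3 → E3} (hW : IsOpen W)
    (hτ : ContDiffOn ℝ ∞ τ W) (hWU : Set.MapsTo τ W U)
    (hsurj : ∀ y ∈ W, Function.Surjective (fderiv ℝ τ y))
    (hX : ∀ y ∈ W, fderiv ℝ τ y (X' y) = X (τ y)) (hI : ∀ y ∈ W, I' y = I (τ y)) :
    IsBalancedOn W ε X' I' (pullForm τ α) (pullForm τ β) := by
  have hτy : ∀ y ∈ W, ContDiffAt ℝ ∞ τ y := fun y hy => hτ.contDiffAt (hW.mem_nhds hy)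
  refine ⟨hW, contDiffOn_pullForm hW hτ h.smooth₁ hWU, contDiffOn_pullForm hW hτ h.smooth₂ hWU,
    fun y hy => ?_, fun y hy u v w => ?_, fun y hy v w => ?_, fun y hy u v w => ?_⟩
  · obtain ⟨w₁, w₂, h1, h2, h3, h4⟩ := h.frame _ (hWU hy)
    obtain ⟨v₁, rfl⟩ := hsurj y hy w₁
    obtain ⟨v₂, rfl⟩ := hsurj y hy w₂
    exact ⟨v₁, v₂, h1, h2, h3, h4⟩
  · rw [wedgeD_pullForm (hτy y hy) (h.differentiableAt₁ (hWU hy)),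
      wedgeD_pullForm (hτy y hy) (h.differentiableAt₂ (hWU hy)), h.balanced _ (hWU hy)]
  · rw [wedgeD_pullForm (hτy y hy) (h.differentiableAt₁ (hWU hy)), hX y hy,
      h.normalized _ (hWU hy)]
    rfl
  · rw [wedgeD_pullForm (hτy y hy) (h.differentiableAt₁ (hWU hy)),
      wedgeD_pullForm (hτy y hy) (h.differentiableAt₂ (hWU hy)),
      wedgeD_pullForm (hτy y hy) (h.differentiableAt₁ (hWU hy)), hI y hy,
      h.invariant _ (hWU hy)]

lemma fderiv_comp_of_eqOn {f g : E3 → ℝ} {τ : E3 → E3} {W : Set E3} (hW : IsOpen W) {y : E3}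
    (hy : y ∈ W) (hτ : DifferentiableAt ℝ τ y) (hf : DifferentiableAt ℝ f (τ y))
    (hg : ∀ z ∈ W, g z = f (τ z)) : fderiv ℝ g y = (fderiv ℝ f (τ y)).comp (fderiv ℝ τ y) := by
  have h1 : g =ᶠ[𝓝 y] fun z => f (τ z) := by
    filter_upwards [hW.mem_nhds hy] with z hz using hg z hz
  rw [h1.fderiv_eq]
  exact (hf.hasFDerivAt.comp y hτ.hasFDerivAt).fderiv

lemma IsNormalizedOn.pullForm {U W : Set E3} {ε : ℝ} {X X' : E3 → E3} {I I' J J' : E3 → ℝ}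
    {α β : E3 → E3 →L[ℝ] ℝ} (h : IsNormalizedOn U ε X I J α β) {τ : E3 → E3} (hW : IsOpen W)
    (hτ : ContDiffOn ℝ ∞ τ W) (hWU : Set.MapsTo τ W U)
    (hsurj : ∀ y ∈ W, Function.Surjective (fderiv ℝ τ y))
    (hX : ∀ y ∈ W, fderiv ℝ τ y (X' y) = X (τ y)) (hI : ∀ y ∈ W, I' y = I (τ y))
    (hJ : ∀ y ∈ W, J' y = J (τ y)) :
    IsNormalizedOn W ε X' I' J' (ContactPair.pullForm τ α) (ContactPair.pullForm τ β) := by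
  refine ⟨h.toIsBalancedOn.pullForm hW hτ hWU hsurj hX hI, (h.smoothJ.comp hτ hWU).congr hJ,
    fun y hy => ?_⟩
  rw [fderiv_comp_of_eqOn hW hy ((hτ.contDiffAt (hW.mem_nhds hy)).differentiableAt (by simp))
    (h.differentiableAt_invariant (hWU hy)) hI, h.fderiv_invariant _ (hWU hy), hJ y hy]
  rfl

/-! ### Charts -/

section Chart

variable {M : Type*} [TopologicalSpace M] [ChartedSpace E3 M] [IsManifold 𝓘(ℝ, E3) ∞ M]

/-- The charts of the smooth structure of `M`. -/
abbrev smoothCharts (M : Type*) [TopologicalSpace M] [ChartedSpace E3 M]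
    [IsManifold 𝓘(ℝ, E3) ∞ M] : Set (OpenPartialHomeomorph M E3) :=
  IsManifold.maximalAtlas 𝓘(ℝ, E3) ∞ M

variable {e e' : OpenPartialHomeomorph M E3}

lemma mdifferentiable_chart_of_mem (he : e ∈ smoothCharts M) :
    e.MDifferentiable 𝓘(ℝ, E3) 𝓘(ℝ, E3) :=
  ⟨(contMDiffOn_of_mem_maximalAtlas he).mdifferentiableOn (by simp),
    (contMDiffOn_symm_of_mem_maximalAtlas he).mdifferentiableOn (by simp)⟩

lemma chartD_injective (he : e ∈ smoothCharts M) {p : M} (hp : p ∈ e.source) :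
    Function.Injective (chartD e p) := (mdifferentiable_chart_of_mem he).mfderiv_injective hp

lemma chartD_surjective (he : e ∈ smoothCharts M) {p : M} (hp : p ∈ e.source) :
    Function.Surjective (chartD e p) := (mdifferentiable_chart_of_mem he).mfderiv_surjective hp

/-- The coordinate change from the chart `e` to the chart `e'`. -/
def transition (e e' : OpenPartialHomeomorph M E3) : E3 → E3 := fun y => e' (e.symm y)

lemma isOpen_transition (e : OpenPartialHomeomorph M E3) {s : Set M} (hs : IsOpen s) :
    IsOpen (e.target ∩ e.symm ⁻¹' s) := e.symm.isOpen_inter_preimage hs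

lemma contDiffOn_transition (he : e ∈ smoothCharts M) (he' : e' ∈ smoothCharts M) :
    ContDiffOn ℝ ∞ (transition e e') (e.target ∩ e.symm ⁻¹' e'.source) := by
  rw [← contMDiffOn_iff_contDiffOn]
  exact (contMDiffOn_of_mem_maximalAtlas he').comp
    ((contMDiffOn_symm_of_mem_maximalAtlas he).mono Set.inter_subset_left) fun y hy => hy.2

lemma fderiv_transition (he : e ∈ smoothCharts M) (he' : e' ∈ smoothCharts M) {p : M}
    (hp : p ∈ e.source) (hp' : p ∈ e'.source) (v : TangentSpace 𝓘(ℝ, E3) p) :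
    fderiv ℝ (transition e e') (e p) (chartD e p v) = chartD e' p v := by
  have hy : e p ∈ e.target ∩ e.symm ⁻¹' e'.source :=
    ⟨e.map_source hp, by rw [Set.mem_preimage, e.left_inv hp]; exact hp'⟩
  have h1 : MDifferentiableAt 𝓘(ℝ, E3) 𝓘(ℝ, E3) (transition e e') (e p) :=
    (((contDiffOn_transition he he').contDiffAt
      ((isOpen_transition e e'.open_source).mem_nhds hy)).differentiableAt
        (by simp)).mdifferentiableAt
  have h2 := (mdifferentiable_chart_of_mem he).mdifferentiableAt hp
  have h3 := mfderiv_comp p h1 h2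
  have h4 : transition e e' ∘ e =ᶠ[𝓝 p] e' := by
    filter_upwards [e.open_source.mem_nhds hp] with q hq
    simp only [Function.comp_apply, transition, e.left_inv hq]
  rw [h4.mfderiv_eq, mfderiv_eq_fderiv] at h3
  rw [chartD, chartD, h3]
  rfl

lemma surjective_fderiv_transition (he : e ∈ smoothCharts M) (he' : e' ∈ smoothCharts M) {p : M}
    (hp : p ∈ e.source) (hp' : p ∈ e'.source) :
    Function.Surjective (fderiv ℝ (transition e e') (e p)) := by
  intro w
  obtain ⟨v, rfl⟩ := chartD_surjective he' hp' w
  exact ⟨chartD e p v, fderiv_transition he he' hp hp' v⟩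

lemma contMDiffAt_iff_chart (he : e ∈ smoothCharts M) {p : M} (hp : p ∈ e.source) {f : M → ℝ} :
    ContMDiffAt 𝓘(ℝ, E3) 𝓘(ℝ, ℝ) ∞ f p ↔ ContDiffAt ℝ ∞ (fun y => f (e.symm y)) (e p) := by
  rw [← contMDiffAt_iff_contDiffAt]
  constructor
  · intro h
    have h' : ContMDiffAt 𝓘(ℝ, E3) 𝓘(ℝ, ℝ) ∞ f (e.symm (e p)) := by rwa [e.left_inv hp]
    exact h'.comp (e p) (contMDiffAt_symm_of_mem_maximalAtlas he (e.map_source hp))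
  · intro h
    have h1 := h.comp p (contMDiffAt_of_mem_maximalAtlas he hp)
    refine h1.congr_of_eventuallyEq ?_
    filter_upwards [e.open_source.mem_nhds hp] with q hq
    simp only [Function.comp_apply, e.left_inv hq]

lemma mfderiv_eq_chart (he : e ∈ smoothCharts M) {p : M} (hp : p ∈ e.source) {f : M → ℝ}
    (hf : DifferentiableAt ℝ (fun y => f (e.symm y)) (e p)) (v : TangentSpace 𝓘(ℝ, E3) p) :
    mfderiv 𝓘(ℝ, E3) 𝓘(ℝ, ℝ) f p v = fderiv ℝ (fun y => f (e.symm y)) (e p) (chartD e p v) := by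
  have h3 := mfderiv_comp p hf.mdifferentiableAt
    ((mdifferentiable_chart_of_mem he).mdifferentiableAt hp)
  have h4 : (fun y => f (e.symm y)) ∘ e =ᶠ[𝓝 p] f := by
    filter_upwards [e.open_source.mem_nhds hp] with q hq
    simp only [Function.comp_apply, e.left_inv hq]
  rw [h4.mfderiv_eq, mfderiv_eq_fderiv] at h3
  rw [h3]
  rfl

lemma mem_distInChart (he : e ∈ smoothCharts M) {p : M} (hp : p ∈ e.source)
    (ξ : ∀ m : M, Submodule ℝ (TangentSpace 𝓘(ℝ, E3) m)) (v : TangentSpace 𝓘(ℝ, E3) p) :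
    chartD e p v ∈ distInChart e ξ (e p) ↔ v ∈ ξ p := by
  have key : ∀ q : M, q = p → ((∃ w ∈ ξ q, (chartD e q w : E3) = chartD e p v) ↔ v ∈ ξ p) := by
    rintro q rfl
    constructor
    · rintro ⟨w, hw, h⟩
      rwa [← chartD_injective he hp h]
    · exact fun h => ⟨v, h, rfl⟩
  exact key _ (e.left_inv hp)

lemma vecInChart_apply (e : OpenPartialHomeomorph M E3) {p : M} (hp : p ∈ e.source)
    (X : ∀ m : M, TangentSpace 𝓘(ℝ, E3) m) : vecInChart e X (e p) = chartD e p (X p) := by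
  have key : ∀ q : M, q = p → (chartD e q (X q) : E3) = chartD e p (X p) := by
    rintro q rfl
    rfl
  exact key _ (e.left_inv hp)

/-- New coordinates `Ψ ∘ e` around `m`, with a ball as range. -/
lemma exists_chart_of_coordinates (he : e ∈ smoothCharts M) {m : M} {W : Set E3}
    (hW : IsOpen W) (hm : m ∈ e.source) (hmW : e m ∈ W) {Ψ : E3 → E3} (hΨ : ContDiffOn ℝ ∞ Ψ W)
    (hinj : ∀ v, fderiv ℝ Ψ (e m) v = 0 → v = 0) :
    ∃ (e' : OpenPartialHomeomorph M E3) (r : ℝ), e' ∈ smoothCharts M ∧ m ∈ e'.source ∧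
      (∀ p ∈ e'.source, p ∈ e.source ∧ e p ∈ W) ∧ (∀ p, e' p = Ψ (e p)) ∧ 0 < r ∧
      e'.target = Metric.ball (e' m) r := by
  obtain ⟨L, hL⟩ := exists_equiv_of_injective _ hinj
  have hmW' : e m ∈ W ∩ e.target := ⟨hmW, e.map_source hm⟩
  obtain ⟨P, hmP, hPW, hPΨ, hPs⟩ := exists_smooth_localInverse (hW.inter e.open_target)
    (hΨ.mono Set.inter_subset_left) hmW' L (by
      rw [hL]
      exact ((hΨ.contDiffAt (hW.mem_nhds hmW)).differentiableAt (by simp)).hasFDerivAt)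
  have hPt : Ψ (e m) ∈ P.target := by rw [← hPΨ]; exact P.map_source hmP
  -- A ball as range is convex, which later allows a function with vanishing partial derivative to
  -- be treated as independent of that coordinate.
  obtain ⟨r, hr, hball⟩ := Metric.isOpen_iff.1 P.open_target _ hPt
  let B : Set E3 := Metric.ball (Ψ (e m)) r
  have hB : IsOpen B := Metric.isOpen_ball
  let Q : OpenPartialHomeomorph E3 E3 := (P.symm.restr B).symm
  have hQt : Q.target = B := by
    change (P.symm.restr B).source = B
    rw [P.symm.restr_source' _ hB]
    exact Set.inter_eq_right.2 hball
  have hQs : Q.source = P.source ∩ P ⁻¹' B := by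
    change (P.symm.restr B).target = _
    rw [OpenPartialHomeomorph.restr_target, hB.interior_eq]
    rfl
  have hQsub : Q.source ⊆ W ∩ e.target := fun y hy => by rw [hQs] at hy; exact hPW hy.1
  have hQΨ : ∀ y, Q y = Ψ y := hPΨ
  let e' := e.trans Q
  have hsrc : ∀ p ∈ e'.source, p ∈ e.source ∧ e p ∈ Q.source := by
    intro p hp
    rw [OpenPartialHomeomorph.trans_source] at hp
    exact hp
  have htgt : e'.target = B := by
    rw [OpenPartialHomeomorph.trans_target, hQt, Set.inter_eq_left]
    intro y hy
    exact (hQsub (Q.map_target (by rw [hQt]; exact hy))).2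
  refine ⟨e', r, ?_, ?_, fun p hp => ⟨(hsrc p hp).1, (hQsub (hsrc p hp).2).1⟩, fun p => hQΨ _, hr,
    ?_⟩
  · refine OpenPartialHomeomorph.mem_maximalAtlas_of_contMDiffOn (I := 𝓘(ℝ, E3)) e' ?_ ?_
    · have h1 : ContMDiffOn 𝓘(ℝ, E3) 𝓘(ℝ, E3) ∞ Ψ W := contMDiffOn_iff_contDiffOn.2 hΨ
      refine (h1.comp ((contMDiffOn_of_mem_maximalAtlas he).mono fun p hp => (hsrc p hp).1)
        fun p hp => (hQsub (hsrc p hp).2).1).congr fun p hp => hQΨ _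
    · have h1 : ContMDiffOn 𝓘(ℝ, E3) 𝓘(ℝ, E3) ∞ P.symm B :=
        contMDiffOn_iff_contDiffOn.2 (hPs.mono hball)
      rw [htgt]
      refine (contMDiffOn_symm_of_mem_maximalAtlas he).comp h1 fun y hy => ?_
      exact (hPW (P.map_target (hball hy))).2
  · rw [OpenPartialHomeomorph.trans_source]
    refine ⟨hm, ?_⟩
    rw [Set.mem_preimage, hQs]
    refine ⟨hmP, ?_⟩
    rw [Set.mem_preimage, hPΨ]
    exact Metric.mem_ball_self hr
  · rw [htgt, show e' m = Ψ (e m) from hQΨ _]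

end Chart

/-! ### Balanced forms in charts -/

section Forms

variable {M : Type*} [TopologicalSpace M] [ChartedSpace E3 M] [IsManifold 𝓘(ℝ, E3) ∞ M]
  {ξ ξ' : ∀ m : M, Submodule ℝ (TangentSpace 𝓘(ℝ, E3) m)} {ε : ℝ}
  {X : ∀ m : M, TangentSpace 𝓘(ℝ, E3) m} {I J : M → ℝ} {e e' : OpenPartialHomeomorph M E3}
  {U : Set E3} {α β : E3 → E3 →L[ℝ] ℝ}

/-- In the chart `e`, the planes `ξ` and `ξ'` are the kernels of the forms `α` and `β` on `U`. -/
structure IsKernelForms (ξ ξ' : ∀ m : M, Submodule ℝ (TangentSpace 𝓘(ℝ, E3) m))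
    (e : OpenPartialHomeomorph M E3) (U : Set E3) (α β : E3 → E3 →L[ℝ] ℝ) : Prop where
  subset : U ⊆ e.target
  ker₁ : ∀ p ∈ e.source, e p ∈ U → ∀ v : TangentSpace 𝓘(ℝ, E3) p,
    v ∈ ξ p ↔ α (e p) (chartD e p v) = 0
  ker₂ : ∀ p ∈ e.source, e p ∈ U → ∀ v : TangentSpace 𝓘(ℝ, E3) p,
    v ∈ ξ' p ↔ β (e p) (chartD e p v) = 0

lemma IsContactFormFor.mem_iff (he : e ∈ smoothCharts M) (h : IsContactFormFor e ξ α) {p : M}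
    (hp : p ∈ e.source) (v : TangentSpace 𝓘(ℝ, E3) p) :
    v ∈ ξ p ↔ α (e p) (chartD e p v) = 0 := by
  rw [← mem_distInChart he hp ξ v, h.2 _ (e.map_source hp)]
  exact LinearMap.mem_ker

lemma distInChart_eq_ker (he : e ∈ smoothCharts M)
    (h : ∀ p ∈ e.source, ∀ v : TangentSpace 𝓘(ℝ, E3) p,
      v ∈ ξ p ↔ α (e p) (chartD e p v) = 0) {y : E3} (hy : y ∈ e.target) :
    distInChart e ξ y = LinearMap.ker (α y).toLinearMap := by
  have hp := e.map_target hy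
  have hey := e.right_inv hy
  generalize e.symm y = p at hp hey
  subst hey
  ext w
  obtain ⟨v, rfl⟩ := chartD_surjective he hp w
  rw [mem_distInChart he hp, h p hp]
  exact LinearMap.mem_ker.symm

/-- The domain, in the chart `e'`, of forms defined on the subset `U` of the chart `e`. -/
def transitionDomain (e' e : OpenPartialHomeomorph M E3) (U : Set E3) : Set E3 :=
  e'.target ∩ e'.symm ⁻¹' (e.source ∩ e ⁻¹' U)

lemma isOpen_transitionDomain (e' e : OpenPartialHomeomorph M E3) (hU : IsOpen U) :
    IsOpen (transitionDomain e' e U) :=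
  isOpen_transition e' (e.isOpen_inter_preimage hU)

lemma mem_transitionDomain {p : M} (hp' : p ∈ e'.source) (hp : p ∈ e.source) (hU : e p ∈ U) :
    e' p ∈ transitionDomain e' e U := by
  refine ⟨e'.map_source hp', ?_⟩
  rw [Set.mem_preimage, e'.left_inv hp']
  exact ⟨hp, hU⟩

lemma exists_of_mem_transitionDomain {y : E3} (hy : y ∈ transitionDomain e' e U) :
    ∃ p, p ∈ e'.source ∧ p ∈ e.source ∧ e p ∈ U ∧ e' p = y ∧ transition e' e y = e p :=
  ⟨e'.symm y, e'.map_target hy.1, hy.2.1, hy.2.2, e'.right_inv hy.1, rfl⟩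

lemma fderiv_transition_vecInChart (he : e ∈ smoothCharts M) (he' : e' ∈ smoothCharts M)
    {y : E3} (hy : y ∈ transitionDomain e' e U) :
    fderiv ℝ (transition e' e) y (vecInChart e' X y) = vecInChart e X (transition e' e y) := by
  obtain ⟨p, hp', hp, -, rfl, h⟩ := exists_of_mem_transitionDomain hy
  rw [h, vecInChart_apply e' hp', vecInChart_apply e hp, fderiv_transition he' he hp' hp]

lemma contDiffOn_transitionDomain (he : e ∈ smoothCharts M) (he' : e' ∈ smoothCharts M) :
    ContDiffOn ℝ ∞ (transition e' e) (transitionDomain e' e U) :=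
  (contDiffOn_transition he' he).mono fun _ hy => ⟨hy.1, hy.2.1⟩

lemma surjective_transitionDomain (he : e ∈ smoothCharts M) (he' : e' ∈ smoothCharts M) {y : E3}
    (hy : y ∈ transitionDomain e' e U) :
    Function.Surjective (fderiv ℝ (transition e' e) y) := by
  obtain ⟨p, hp', hp, -, rfl, h⟩ := exists_of_mem_transitionDomain hy
  exact surjective_fderiv_transition he' he hp' hp

lemma transition_fun {f : M → ℝ} {y : E3} (hy : y ∈ transitionDomain e' e U) :
    f (e'.symm y) = f (e.symm (transition e' e y)) := by
  obtain ⟨p, hp', hp, -, rfl, h⟩ := exists_of_mem_transitionDomain hy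
  rw [h, e'.left_inv hp', e.left_inv hp]

lemma mapsTo_transitionDomain :
    Set.MapsTo (transition e' e) (transitionDomain e' e U) U := fun _ hy => hy.2.2

lemma IsKernelForms.transport (h : IsKernelForms ξ ξ' e U α β) (he : e ∈ smoothCharts M)
    (he' : e' ∈ smoothCharts M) :
    IsKernelForms ξ ξ' e' (transitionDomain e' e U) (pullForm (transition e' e) α)
      (pullForm (transition e' e) β) := by
  refine ⟨fun y hy => hy.1, fun p hp' hy v => ?_, fun p hp' hy v => ?_⟩ <;>
  obtain ⟨q, hq', hq, hqU, hqp, h2⟩ := exists_of_mem_transitionDomain hy <;>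
  have hqp' : q = p := e'.injOn hq' hp' hqp <;>
  subst hqp' <;>
  rw [pullForm_apply, fderiv_transition he' he hq' hq, h2]
  · exact h.ker₁ q hq hqU v
  · exact h.ker₂ q hq hqU v

lemma IsBalancedOn.transport
    (h : IsBalancedOn U ε (vecInChart e X) (fun y => I (e.symm y)) α β)
    (he : e ∈ smoothCharts M) (he' : e' ∈ smoothCharts M) :
    IsBalancedOn (transitionDomain e' e U) ε (vecInChart e' X) (fun y => I (e'.symm y))
      (ContactPair.pullForm (transition e' e) α) (ContactPair.pullForm (transition e' e) β) :=
  h.pullForm (isOpen_transitionDomain e' e h.isOpen) (contDiffOn_transitionDomain he he')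
    mapsTo_transitionDomain (fun _ hy => surjective_transitionDomain he he' hy)
    (fun _ hy => fderiv_transition_vecInChart he he' hy) (fun _ hy => transition_fun hy)

lemma IsNormalizedOn.transport
    (h : IsNormalizedOn U ε (vecInChart e X) (fun y => I (e.symm y)) (fun y => J (e.symm y)) α β)
    (he : e ∈ smoothCharts M) (he' : e' ∈ smoothCharts M) :
    IsNormalizedOn (transitionDomain e' e U) ε (vecInChart e' X) (fun y => I (e'.symm y))
      (fun y => J (e'.symm y)) (ContactPair.pullForm (transition e' e) α)
      (ContactPair.pullForm (transition e' e) β) :=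
  h.pullForm (isOpen_transitionDomain e' e h.isOpen) (contDiffOn_transitionDomain he he')
    mapsTo_transitionDomain (fun _ hy => surjective_transitionDomain he he' hy)
    (fun _ hy => fderiv_transition_vecInChart he he' hy) (fun _ hy => transition_fun hy)
    (fun _ hy => transition_fun hy)

lemma exists_dual_vector {a b : E3 →L[ℝ] ℝ} (ha : a ≠ 0)
    (h : ∀ v, ∃ u w, v = u + w ∧ a u = 0 ∧ b w = 0) : ∃ w, a w = 1 ∧ b w = 0 := by
  obtain ⟨v, hv⟩ : ∃ v, a v ≠ 0 := by
    by_contra! h0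
    exact ha (ContinuousLinearMap.ext h0)
  obtain ⟨u, w, rfl, hu, hw⟩ := h v
  rw [map_add, hu, zero_add] at hv
  exact ⟨(a w)⁻¹ • w, by simp [hv], by simp [hw]⟩

lemma IsContactForm.ne_zero (h : IsContactForm U α) {y : E3} (hy : y ∈ U) : α y ≠ 0 := by
  intro h0
  obtain ⟨u, v, w, h1⟩ := h.2 y hy
  simp [wedgeD, h0] at h1

/-- Transversality enters as the dual frame: a vector outside ξ splits into a part in ξ and a part
in ξ', and the second part is killed by β but not by α; the other dual vector arises in the same
way. -/
lemma exists_balanced_forms (hpair : IsContactPair ξ ξ' ε)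
    (hI : IsGeneratingInvariant ξ ξ' ε X I) (m : M) :
    ∃ (e : OpenPartialHomeomorph M E3) (α β : E3 → E3 →L[ℝ] ℝ), e ∈ smoothCharts M ∧
      m ∈ e.source ∧ IsKernelForms ξ ξ' e e.target α β ∧
      IsBalancedOn e.target ε (vecInChart e X) (fun y => I (e.symm y)) α β := by
  obtain ⟨e, α, β, ⟨he, hm⟩, ⟨hα, hβ, hbal, hnorm⟩, hinv⟩ := hI m
  refine ⟨e, α, β, he, hm, ⟨subset_rfl, fun p hp _ v => hα.mem_iff he hp v,
    fun p hp _ v => hβ.mem_iff he hp v⟩, ⟨e.open_target, hα.1.1, hβ.1.1, fun y hy => ?_, hbal,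
    hnorm, hinv⟩⟩
  have hp := e.map_target hy
  have hey := e.right_inv hy
  generalize e.symm y = p at hp hey
  subst hey
  have hsum : ∀ v : E3, ∃ u w, v = u + w ∧ α (e p) u = 0 ∧ β (e p) w = 0 := by
    intro v
    obtain ⟨v, rfl⟩ := chartD_surjective he hp v
    have hv : v ∈ ξ p ⊔ ξ' p := by rw [hpair.1 p]; trivial
    obtain ⟨u, hu, w, hw, rfl⟩ := Submodule.mem_sup.1 hv
    exact ⟨_, _, map_add _ u w, (hα.mem_iff he hp u).1 hu, (hβ.mem_iff he hp w).1 hw⟩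
  obtain ⟨w₁, h1, h2⟩ := exists_dual_vector (hα.1.ne_zero hy) hsum
  obtain ⟨w₂, h3, h4⟩ := exists_dual_vector (a := β (e p)) (b := α (e p)) (hβ.1.ne_zero hy)
    (fun v => by
      obtain ⟨u, w, h, hu, hw⟩ := hsum v
      exact ⟨w, u, by rw [h, add_comm], hw, hu⟩)
  exact ⟨w₁, w₂, h1, h2, h4, h3⟩

/-- If the Schwarzian invariant vanishes, the generating invariant is constant along the axis. -/
lemma mfderiv_invariant_axis (hε : ε = 1 ∨ ε = -1) (hpair : IsContactPair ξ ξ' ε)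
    (hI : IsGeneratingInvariant ξ ξ' ε X I) (hS : SchwarzianVanishes ξ ξ') (m : M) :
    mfderiv 𝓘(ℝ, E3) 𝓘(ℝ, ℝ) I m (X m) = 0 := by
  obtain ⟨e₀, α₀, β₀, he₀, hm₀, hK₀, hB₀⟩ := exists_balanced_forms hpair hI m
  have hm₀' := e₀.map_source hm₀
  have hax := hB₀.axis hm₀'
  rw [vecInChart_apply e₀ hm₀] at hax
  have hX0 : X m ≠ 0 := by
    intro h0
    have := hB₀.axis_ne_zero hm₀'
    rw [vecInChart_apply e₀ hm₀, h0, map_zero] at this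
    exact this rfl
  obtain ⟨e, V, φ, a, b, q, r, f, ⟨he, hm⟩, hV0, hV, hVspan, hφ, hφ0, hφd, hab, haV, hbV, hq, hr,
    hf, hfr, hs⟩ := hS m (X m) ⟨(hK₀.ker₁ m hm₀ hm₀' _).2 hax.1, (hK₀.ker₂ m hm₀ hm₀' _).2 hax.2⟩
      hX0
  have hK := hK₀.transport he₀ he
  have hB := hB₀.transport he₀ he
  set W := transitionDomain e e₀ e₀.target with hWdef
  set α := pullForm (transition e e₀) α₀ with hαdef
  set β := pullForm (transition e e₀) β₀ with hβdef
  have hmW : e m ∈ W := mem_transitionDomain hm hm₀ hm₀'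
  have hker : ∀ z ∈ W, distInChart e ξ z = LinearMap.ker (α z).toLinearMap ∧
      distInChart e ξ' z = LinearMap.ker (β z).toLinearMap := by
    intro z hz
    have hp := e.map_target (hK.subset hz)
    have hey := e.right_inv (hK.subset hz)
    generalize e.symm z = p at hp hey
    subst hey
    constructor <;>
    · ext w
      obtain ⟨v, rfl⟩ := chartD_surjective he hp w
      rw [mem_distInChart he hp]
      first
        | exact hK.ker₁ p hp hz v
        | exact hK.ker₂ p hp hz v
  have hWn : ∀ᶠ z in 𝓝 (e m), z ∈ W := hB.isOpen.mem_nhds hmW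
  have hφt : Filter.Tendsto (fun t : ℝ => φ (t, e m)) (𝓝 0) (𝓝 (e m)) := by
    obtain ⟨N, hN, hφN⟩ := hφ
    have h5 : ContinuousAt (fun t : ℝ => φ (t, e m)) 0 :=
      ContinuousAt.comp (f := fun t : ℝ => (t, e m)) (hφN.continuousOn.continuousAt hN)
        (by fun_prop)
    have h6 := h5.tendsto
    simp only [hφ0.self_of_nhds] at h6
    exact h6
  have key := hB.fderiv_invariant_axis hε hmW (V := V) (φ := φ) (a := a) (b := b) (q := q)
    (r := r) (f := f) (by rw [hV0, vecInChart_apply e hm]) hV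
    (by
      filter_upwards [hVspan, hWn] with z h1 h2
      have h3 : V z ∈ distInChart e ξ z ⊓ distInChart e ξ' z := by
        rw [h1]; exact Submodule.mem_span_singleton_self _
      rw [(hker z h2).1, (hker z h2).2] at h3
      exact ⟨h3.1, h3.2⟩) hφ hφ0 hφd hab haV hbV
    (by
      filter_upwards [hq, hφt.eventually hWn] with t h1 h2 w
      rw [(hker _ h2).1] at h1
      exact SetLike.ext_iff.1 h1 w)
    (by
      filter_upwards [hr, hφt.eventually hWn] with t h1 h2 w
      rw [(hker _ h2).2] at h1
      exact SetLike.ext_iff.1 h1 w) hf hfr hs.symm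
  rw [mfderiv_eq_chart he hm ((hB.smooth_invariant.contDiffAt (hB.isOpen.mem_nhds hmW)
    ).differentiableAt (by simp)), ← vecInChart_apply e hm]
  exact key

/-- Balanced forms at a point are determined up to a common factor. -/
lemma exists_factor_of_forms (he : e ∈ smoothCharts M) (he' : e' ∈ smoothCharts M)
    {U' : Set E3} {α' β' : E3 → E3 →L[ℝ] ℝ} (hK : IsKernelForms ξ ξ' e U α β)
    (hB : IsBalancedOn U ε (vecInChart e X) (fun y => I (e.symm y)) α β)
    (hK' : IsKernelForms ξ ξ' e' U' α' β')
    (hB' : IsBalancedOn U' ε (vecInChart e' X) (fun y => I (e'.symm y)) α' β') {p : M}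
    (hp : p ∈ e.source) (hpU : e p ∈ U) (hp' : p ∈ e'.source) (hpU' : e' p ∈ U') :
    ∃ c : ℝ, c ≠ 0 ∧ pullForm (transition e' e) α (e' p) = c • α' (e' p) ∧
      pullForm (transition e' e) β (e' p) = c • β' (e' p) := by
  have hK₁ := hK.transport he he'
  have hB₁ := hB.transport he he'
  have hmem := mem_transitionDomain hp' hp hpU
  have hO : IsOpen (transitionDomain e' e U ∩ U') := hB₁.isOpen.inter hB'.isOpen
  refine (hB'.mono hO Set.inter_subset_right).exists_factor (hB₁.mono hO Set.inter_subset_left)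
    (fun z hz v hv => ?_) (fun z hz v hv => ?_) ⟨hmem, hpU'⟩ <;>
  · have hq := e'.map_target hz.1.1
    have hey := e'.right_inv hz.1.1
    generalize e'.symm z = q at hq hey
    subst hey
    obtain ⟨v, rfl⟩ := chartD_surjective he' hq v
    first
      | exact (hK₁.ker₁ q hq hz.1 v).1 ((hK'.ker₁ q hq hz.2 v).2 hv)
      | exact (hK₁.ker₂ q hq hz.1 v).1 ((hK'.ker₂ q hq hz.2 v).2 hv)

lemma fderiv_transition_fun (he : e ∈ smoothCharts M) (he' : e' ∈ smoothCharts M) {f : M → ℝ}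
    {p : M} (hp : p ∈ e.source) (hp' : p ∈ e'.source)
    (hf : DifferentiableAt ℝ (fun y => f (e.symm y)) (e p)) :
    fderiv ℝ (fun y => f (e'.symm y)) (e' p)
      = (fderiv ℝ (fun y => f (e.symm y)) (e p)).comp (fderiv ℝ (transition e' e) (e' p)) := by
  have hmem : e' p ∈ transitionDomain e' e Set.univ := mem_transitionDomain hp' hp trivial
  have hO := isOpen_transitionDomain e' e isOpen_univ
  have hτ : transition e' e (e' p) = e p := by rw [transition, e'.left_inv hp']
  have h := fderiv_comp_of_eqOn (f := fun y => f (e.symm y)) (g := fun y => f (e'.symm y)) hO hmem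
    (((contDiffOn_transitionDomain he he').contDiffAt (hO.mem_nhds hmem)).differentiableAt
      (by simp)) (by rw [hτ]; exact hf) (fun z hz => transition_fun hz)
  rwa [hτ] at h

/-- Balanced forms on the whole range of a chart. -/
lemma IsBalancedOn.isBalanced (he : e ∈ smoothCharts M)
    (hK : IsKernelForms ξ ξ' e e.target α β)
    (hB : IsBalancedOn e.target ε (vecInChart e X) (fun y => I (e.symm y)) α β) :
    IsBalanced ξ ξ' ε X e α β := by
  refine ⟨⟨⟨hB.smooth₁, fun y hy => ⟨_, _, _, hB.volume_ne_zero hy⟩⟩, fun y hy =>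
      distInChart_eq_ker he (fun p hp v => hK.ker₁ p hp (e.map_source hp) v) hy⟩,
    ⟨⟨hB.smooth₂, fun y hy => ⟨stdVec 0, stdVec 1, stdVec 2, fun h0 => ?_⟩⟩, fun y hy =>
      distInChart_eq_ker he (fun p hp v => hK.ker₂ p hp (e.map_source hp) v) hy⟩,
    hB.balanced, hB.normalized⟩
  apply hB.volume_ne_zero hy
  rw [hB.balanced y hy, h0, mul_zero]

/-- The invariant `J`, and balanced forms normalized by `dI = α + J β`. -/
theorem exists_normalized_forms (hε : ε = 1 ∨ ε = -1) (hpair : IsContactPair ξ ξ' ε)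
    (hI : IsGeneratingInvariant ξ ξ' ε X I) (hS : SchwarzianVanishes ξ ξ')
    (hj : ∀ m : M, ∃ v ∈ ξ' m, mfderiv 𝓘(ℝ, E3) 𝓘(ℝ, ℝ) I m v ≠ 0) :
    ∃ J : M → ℝ, ContMDiff 𝓘(ℝ, E3) 𝓘(ℝ, ℝ) ∞ J ∧ IsJInvariant ξ ξ' ε X I J ∧
      ∀ m : M, ∃ (e : OpenPartialHomeomorph M E3) (α β : E3 → E3 →L[ℝ] ℝ), e ∈ smoothCharts M ∧
        m ∈ e.source ∧ IsKernelForms ξ ξ' e e.target α β ∧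
        IsNormalizedOn e.target ε (vecInChart e X) (fun y => I (e.symm y))
          (fun y => J (e.symm y)) α β := by
  -- Since X I = 0, dI = c₁ α + c₂ β. On ξ' = ker β it restricts to c₁ α, so c₁ ≠ 0.
  have hcoeff : ∀ (e : OpenPartialHomeomorph M E3) (α β : E3 → E3 →L[ℝ] ℝ),
      e ∈ smoothCharts M → IsKernelForms ξ ξ' e e.target α β →
      IsBalancedOn e.target ε (vecInChart e X) (fun y => I (e.symm y)) α β →
      ∀ y ∈ e.target, ∃ c : ℝ × ℝ, c.1 ≠ 0 ∧
        fderiv ℝ (fun z => I (e.symm z)) y = c.1 • α y + c.2 • β y := by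
    intro e α β he hK hB y hy
    have hd : DifferentiableAt ℝ (fun y => I (e.symm y)) y :=
      (hB.smooth_invariant.contDiffAt (hB.isOpen.mem_nhds hy)).differentiableAt (by simp)
    have hp := e.map_target hy
    have hey := e.right_inv hy
    generalize e.symm y = p at hp hey
    subst hey
    have h0 := mfderiv_invariant_axis hε hpair hI hS p
    rw [mfderiv_eq_chart he hp hd, ← vecInChart_apply e hp] at h0
    obtain ⟨c₁, c₂, hc⟩ := hB.exists_coeff hy h0
    refine ⟨(c₁, c₂), fun hc0 => ?_, hc⟩
    obtain ⟨v, hv, hv0⟩ := hj p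
    rw [mfderiv_eq_chart he hp hd, hc] at hv0
    have hβ := (hK.ker₂ p hp hy v).1 hv
    have hc0' : c₁ = 0 := hc0
    simp only [hc0', add_apply, smul_apply, hβ, zero_smul, smul_zero, add_zero] at hv0
    exact hv0 rfl
  have hJ : ∀ m : M, ∃ j : ℝ, ∃ (e : OpenPartialHomeomorph M E3) (α β : E3 → E3 →L[ℝ] ℝ),
      e ∈ smoothCharts M ∧ m ∈ e.source ∧ IsKernelForms ξ ξ' e e.target α β ∧
      IsBalancedOn e.target ε (vecInChart e X) (fun y => I (e.symm y)) α β ∧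
      ∃ c : ℝ, c ≠ 0 ∧ fderiv ℝ (fun z => I (e.symm z)) (e m)
        = c • (α (e m) + j • β (e m)) := by
    intro m
    obtain ⟨e, α, β, he, hm, hK, hB⟩ := exists_balanced_forms hpair hI m
    obtain ⟨c, hc0, hc⟩ := hcoeff e α β he hK hB _ (e.map_source hm)
    refine ⟨c.2 / c.1, e, α, β, he, hm, hK, hB, c.1, hc0, ?_⟩
    rw [hc, smul_add, smul_smul, mul_div_cancel₀ _ hc0]
  choose J hJ using hJ
  -- `J` does not depend on the choices
  have huniq : ∀ (e : OpenPartialHomeomorph M E3) (α β : E3 → E3 →L[ℝ] ℝ),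
      e ∈ smoothCharts M → IsKernelForms ξ ξ' e e.target α β →
      IsBalancedOn e.target ε (vecInChart e X) (fun y => I (e.symm y)) α β →
      ∀ p ∈ e.source, ∀ c₁ c₂ : ℝ, c₁ ≠ 0 →
        fderiv ℝ (fun z => I (e.symm z)) (e p) = c₁ • α (e p) + c₂ • β (e p) →
        J p = c₂ / c₁ := by
    intro e α β he hK hB p hp c₁ c₂ hc₁ hc
    obtain ⟨e', α', β', he', hp', hK', hB', c, hc0, hc'⟩ := hJ p
    have hy := e.map_source hp
    have hy' := e'.map_source hp'
    -- Two balanced pairs at the same point differ by a common factor f, which cancels in c₂ / c₁.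
    obtain ⟨f, hf, hfα, hfβ⟩ := exists_factor_of_forms he he' hK hB hK' hB' hp hy hp' hy'
    have hd : DifferentiableAt ℝ (fun y => I (e.symm y)) (e p) :=
      (hB.smooth_invariant.contDiffAt (hB.isOpen.mem_nhds hy)).differentiableAt (by simp)
    have h1 := fderiv_transition_fun he he' hp hp' hd
    rw [hc, hc'] at h1
    obtain ⟨w₁, w₂, e1, e2, e3, e4⟩ := hB'.frame _ hy'
    have hτ : transition e' e (e' p) = e p := by rw [transition, e'.left_inv hp']
    have key : ∀ w, c * (α' (e' p) w + J p * β' (e' p) w)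
        = c₁ * (f * α' (e' p) w) + c₂ * (f * β' (e' p) w) := by
      intro w
      have h2 := congrArg (fun γ => γ w) h1
      have h3 := congrArg (fun γ => γ w) hfα
      have h4 := congrArg (fun γ => γ w) hfβ
      simp only [pullForm_apply, hτ, smul_apply, smul_eq_mul] at h3 h4
      simp only [ContinuousLinearMap.comp_apply, add_apply, smul_apply, smul_eq_mul, h3, h4] at h2
      exact h2
    have k1 := key w₁
    have k2 := key w₂
    simp only [e1, e2, e3, e4, mul_zero, add_zero, mul_one, zero_add] at k1 k2
    rw [eq_div_iff hc₁]
    refine mul_left_cancel₀ hf ?_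
    calc f * (J p * c₁) = (c₁ * f) * J p := by ring
      _ = f * c₂ := by rw [← k1, k2]; ring
  have hforms : ∀ m : M, ∃ (e : OpenPartialHomeomorph M E3) (α β : E3 → E3 →L[ℝ] ℝ)
      (j₁ j₂ : E3 → ℝ), e ∈ smoothCharts M ∧ m ∈ e.source ∧ IsKernelForms ξ ξ' e e.target α β ∧
      IsBalancedOn e.target ε (vecInChart e X) (fun y => I (e.symm y)) α β ∧
      ContDiffOn ℝ ∞ j₁ e.target ∧ ContDiffOn ℝ ∞ j₂ e.target ∧ ∀ y ∈ e.target,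
        fderiv ℝ (fun z => I (e.symm z)) y = j₁ y • α y + j₂ y • β y ∧ j₁ y ≠ 0 ∧
        J (e.symm y) = j₂ y / j₁ y := by
    intro m
    obtain ⟨e, α, β, he, hm, hK, hB⟩ := exists_balanced_forms hpair hI m
    have h1 : ∀ y, ∃ c : ℝ × ℝ, y ∈ e.target → c.1 ≠ 0 ∧
        fderiv ℝ (fun z => I (e.symm z)) y = c.1 • α y + c.2 • β y := by
      intro y
      by_cases hy : y ∈ e.target
      · obtain ⟨c, hc⟩ := hcoeff e α β he hK hB y hy
        exact ⟨c, fun _ => hc⟩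
      · exact ⟨0, fun h => absurd h hy⟩
    choose c hc using h1
    have hs := hB.smooth_coeff (γ := fderiv ℝ (fun z => I (e.symm z)))
      (hB.smooth_invariant.fderiv_of_isOpen hB.isOpen (by simp)) (a := fun y => (c y).1)
      (b := fun y => (c y).2) (fun y hy => (hc y hy).2)
    refine ⟨e, α, β, fun y => (c y).1, fun y => (c y).2, he, hm, hK, hB, hs.1, hs.2,
      fun y hy => ⟨(hc y hy).2, (hc y hy).1, ?_⟩⟩
    refine huniq e α β he hK hB _ (e.map_target hy) _ _ (hc y hy).1 ?_
    rw [e.right_inv hy]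
    exact (hc y hy).2
  have hJs : ∀ (e : OpenPartialHomeomorph M E3) (j₁ j₂ : E3 → ℝ), ContDiffOn ℝ ∞ j₁ e.target →
      ContDiffOn ℝ ∞ j₂ e.target → (∀ y ∈ e.target, j₁ y ≠ 0 ∧ J (e.symm y) = j₂ y / j₁ y) →
      ContDiffOn ℝ ∞ (fun y => J (e.symm y)) e.target := fun e j₁ j₂ h1 h2 h =>
    (h2.div h1 fun y hy => (h y hy).1).congr fun y hy => (h y hy).2
  refine ⟨J, fun m => ?_, fun m => ?_, fun m => ?_⟩
  · obtain ⟨e, α, β, j₁, j₂, he, hm, hK, hB, h1, h2, h⟩ := hforms m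
    rw [contMDiffAt_iff_chart he hm]
    exact (hJs e j₁ j₂ h1 h2 fun y hy => (h y hy).2).contDiffAt
      (e.open_target.mem_nhds (e.map_source hm))
  · obtain ⟨e, α, β, j₁, j₂, he, hm, hK, hB, h1, h2, h⟩ := hforms m
    exact ⟨e, α, β, j₁, j₂, ⟨he, hm⟩, hB.isBalanced he hK, h⟩
  · obtain ⟨e, α, β, j₁, j₂, he, hm, hK, hB, h1, h2, h⟩ := hforms m
    -- Multiplying both forms by j₁ achieves dI = α + Jβ and keeps them balanced.
    have h0 : ∀ y ∈ e.target, j₁ y ≠ 0 := fun y hy => (h y hy).2.1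
    refine ⟨e, _, _, he, hm, ⟨subset_rfl, fun p hp hy v => ?_, fun p hp hy v => ?_⟩,
      ⟨hB.smul h1 h0, hJs e j₁ j₂ h1 h2 fun y hy => (h y hy).2, fun y hy => ?_⟩⟩
    · rw [hK.ker₁ p hp hy]
      simp [h0 _ hy]
    · rw [hK.ker₂ p hp hy]
      simp [h0 _ hy]
    · rw [(h y hy).1, (h y hy).2.2, smul_smul, div_mul_cancel₀ _ (h0 y hy)]

end Forms

/-! ### The generic normal form -/

/-- The map with the three given coordinate functions. -/
def coordMap (f g h : E3 → ℝ) (y : E3) : E3 := WithLp.toLp 2 ![f y, g y, h y]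

@[simp] lemma coordMap_zero (f g h : E3 → ℝ) (y : E3) : coordMap f g h y 0 = f y := rfl
@[simp] lemma coordMap_one (f g h : E3 → ℝ) (y : E3) : coordMap f g h y 1 = g y := rfl
@[simp] lemma coordMap_two (f g h : E3 → ℝ) (y : E3) : coordMap f g h y 2 = h y := rfl

lemma contDiffOn_coordMap {W : Set E3} {f g h : E3 → ℝ} (hf : ContDiffOn ℝ ∞ f W)
    (hg : ContDiffOn ℝ ∞ g W) (hh : ContDiffOn ℝ ∞ h W) : ContDiffOn ℝ ∞ (coordMap f g h) W := by
  refine contDiffOn_euclidean.2 fun i => ?_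
  fin_cases i
  exacts [hf, hg, hh]

lemma fderiv_coord {τ : E3 → E3} {y : E3} (h : DifferentiableAt ℝ τ y) (i : Fin 3) (v : E3) :
    fderiv ℝ (fun z => τ z i) y v = fderiv ℝ τ y v i := by
  have h1 := ((EuclideanSpace.proj (𝕜 := ℝ) i : E3 →L[ℝ] ℝ).hasFDerivAt.comp y
    h.hasFDerivAt).fderiv
  have h2 := congrArg (fun L => L v) h1
  exact h2

lemma fderiv_eq_zero_of_coordMap {f g h : E3 → ℝ} {y : E3}
    (hd : DifferentiableAt ℝ (coordMap f g h) y) {v : E3} (hv : fderiv ℝ (coordMap f g h) y v = 0) :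
    fderiv ℝ f y v = 0 ∧ fderiv ℝ g y v = 0 ∧ fderiv ℝ h y v = 0 := by
  have e := fun i => fderiv_coord hd i v
  rw [hv] at e
  exact ⟨e 0, e 1, e 2⟩

lemma fderiv_coord_apply (i : Fin 3) (y v : E3) : fderiv ℝ (fun z : E3 => z i) y v = v i := by
  have := fderiv_coord (τ := id) (y := y) differentiableAt_id i v
  simpa using this

namespace IsNormalizedOn

variable {U : Set E3} {ε : ℝ} {X : E3 → E3} {I J : E3 → ℝ} {α β : E3 → E3 →L[ℝ] ℝ}

/-- Integrability of the basic form comes from i_X dθ = 0. The sign of the factor is absorbed by x ↦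
−x, which is the origin of B > 0. -/
lemma exists_positive_factor (h : IsNormalizedOn U ε X I J α β) (hε : ε = 1 ∨ ε = -1) {y₀ : E3}
    (hy₀ : y₀ ∈ U) :
    ∃ (W : Set E3) (x g : E3 → ℝ), IsOpen W ∧ y₀ ∈ W ∧ W ⊆ U ∧ ContDiffOn ℝ ∞ x W ∧
      ContDiffOn ℝ ∞ g W ∧ ∀ y ∈ W, basicForm ε I J α β y = g y • fderiv ℝ x y ∧ 0 < g y := by
  obtain ⟨W, x, g, hW, hyW, hWU, hx, hg, hθ⟩ := exists_integrating_factor h.isOpen hy₀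
    (lam := fun _ => 0) h.smooth_axis h.smooth_basicForm continuousOn_const
    (h.axis_ne_zero hy₀) (h.basicForm_ne_zero hy₀) (fun y hy => h.basicForm_axis hy)
    (fun y hy v => by rw [h.extD_basicForm_axis hε hy, zero_mul])
  rcases lt_or_gt_of_ne (hθ y₀ hyW).2 with h0 | h0
  · refine ⟨W ∩ g ⁻¹' Set.Iio 0, fun y => -x y, fun y => -g y,
      hg.continuousOn.isOpen_inter_preimage hW isOpen_Iio, ⟨hyW, h0⟩,
      fun y hy => hWU hy.1, hx.neg.mono Set.inter_subset_left,
      hg.neg.mono Set.inter_subset_left, fun y hy => ⟨?_, neg_pos.2 hy.2⟩⟩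
    rw [(hθ y hy.1).1, fderiv_fun_neg, neg_smul_neg]
  · exact ⟨W ∩ g ⁻¹' Set.Ioi 0, x, g,
      hg.continuousOn.isOpen_inter_preimage hW isOpen_Ioi, ⟨hyW, h0⟩,
      fun y hy => hWU hy.1, hx.mono Set.inter_subset_left, hg.mono Set.inter_subset_left,
      fun y hy => ⟨(hθ y hy.1).1, hy.2⟩⟩

/-- The determinant of (dI, θ) with respect to (α, β) is D = 1 + IJ + εJ², and D is also the
derivative of J along the axis. So D ≠ 0 makes θ, dI, dJ independent. -/
lemma eq_zero_of_basicForm (h : IsNormalizedOn U ε X I J α β) (hε : ε = 1 ∨ ε = -1) {y v : E3}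
    (hy : y ∈ U) (hD : 1 + I y * J y + ε * J y ^ 2 ≠ 0) (h0 : basicForm ε I J α β y v = 0)
    (h1 : fderiv ℝ I y v = 0) (h2 : fderiv ℝ J y v = 0) : v = 0 := by
  simp only [h.fderiv_invariant y hy, basicForm, add_apply, smul_apply,
    smul_eq_mul] at h0 h1
  have hα : α y v = 0 := by
    have : (1 + I y * J y + ε * J y ^ 2) * α y v = 0 := by linear_combination h1 - J y * h0
    exact (mul_eq_zero.1 this).resolve_left hD
  have hβ : β y v = 0 := by simpa [hα] using h0
  obtain ⟨a, rfl⟩ := h.eq_smul_axis hy hα hβ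
  rw [map_smul, (h.structure_equations hε hy).1, smul_eq_mul] at h2
  rw [(mul_eq_zero.1 h2).resolve_right hD, zero_smul]

/-- This and the next identity solve dI = α + Jβ and θ = β − (I + εJ)α for α and β; their right-hand
sides are the equations of ξ and ξ' in the generic normal form. -/
lemma smul_first_eq (h : IsNormalizedOn U ε X I J α β) {y : E3} (hy : y ∈ U) (v : E3) :
    (1 + I y * J y + ε * J y ^ 2) * α y v
      = fderiv ℝ I y v - J y * basicForm ε I J α β y v := by
  simp only [h.fderiv_invariant y hy, basicForm, add_apply, smul_apply,
    smul_eq_mul]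
  ring

lemma smul_second_eq (h : IsNormalizedOn U ε X I J α β) {y : E3} (hy : y ∈ U) (v : E3) :
    (1 + I y * J y + ε * J y ^ 2) * β y v
      = (I y + ε * J y) * fderiv ℝ I y v + basicForm ε I J α β y v := by
  simp only [h.fderiv_invariant y hy, basicForm, add_apply, smul_apply,
    smul_eq_mul]
  ring

/-- In coordinates in which the basic form is a multiple `b dx` and `X` is tangent to the third
axis, the coefficient `b` does not depend on the third coordinate. -/
lemma fderiv_coefficient_eq_zero (h : IsNormalizedOn U ε X I J α β) (hε : ε = 1 ∨ ε = -1)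
    {b : E3 → ℝ} (hb : ContDiffOn ℝ ∞ b U) (hb0 : ∀ y ∈ U, 0 < b y)
    (hθ : ∀ y ∈ U, ∀ v : E3, basicForm ε I J α β y v = b y * v 0) (hI : ∀ y ∈ U, I y = y 1)
    {y : E3} (hy : y ∈ U) :
    fderiv ℝ b y (stdVec 2) = 0 := by
  have hU := h.isOpen.mem_nhds hy
  have hX0 : X y 0 = 0 := by
    have := hθ y hy (X y)
    rw [h.basicForm_axis hy] at this
    exact (mul_eq_zero.1 this.symm).resolve_left (hb0 y hy).ne'
  have hX1 : X y 1 = 0 := by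
    have e : I =ᶠ[𝓝 y] fun z => z 1 := by
      filter_upwards [hU] with z hz using hI z hz
    have := h.fderiv_invariant_axis hy
    rwa [e.fderiv_eq, fderiv_coord_apply] at this
  obtain ⟨c, hX⟩ : ∃ c : ℝ, X y = c • stdVec 2 := by
    refine ⟨X y 2, ?_⟩
    conv_lhs => rw [eq_sum_stdVec (X y)]
    simp [hX0, hX1]
  have hc : c ≠ 0 := by
    rintro rfl
    exact h.axis_ne_zero hy (by rw [hX, zero_smul])
  have hbd : DifferentiableAt ℝ b y := (hb.contDiffAt hU).differentiableAt (by simp)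
  have e : basicForm ε I J α β
      =ᶠ[𝓝 y] fun z => b z • (EuclideanSpace.proj (𝕜 := ℝ) 0 : E3 →L[ℝ] ℝ) := by
    filter_upwards [hU] with z hz
    ext v
    simpa using hθ z hz v
  -- With θ = b dx and X = c ∂₂, c ≠ 0, the vanishing value dθ(X, ∂₀) equals c ∂₂b.
  have h1 := h.extD_basicForm_axis hε hy (stdVec 0)
  rw [extD_congr e, extD_smul hbd (differentiableAt_const _)] at h1
  simp only [extD, fderiv_fun_const, wedge, hX, map_smul] at h1
  simpa [hc] using h1

end IsNormalizedOn

/-- The projection of coordinate space to the plane of the second and the first coordinate. -/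
def planeProj : E3 →L[ℝ] ℝ × ℝ :=
  (EuclideanSpace.proj (𝕜 := ℝ) (1 : Fin 3) : E3 →L[ℝ] ℝ).prod
    (EuclideanSpace.proj (𝕜 := ℝ) (0 : Fin 3) : E3 →L[ℝ] ℝ)

@[simp] lemma planeProj_apply (y : E3) : planeProj y = (y 1, y 0) := rfl

lemma isOpenMap_planeProj : IsOpenMap planeProj :=
  planeProj.isOpenMap fun z => ⟨WithLp.toLp 2 ![z.2, z.1, 0], by simp⟩

/-- The point with the given coordinates. -/
def point (a b c : ℝ) : E3 := WithLp.toLp 2 ![a, b, c]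

@[simp] lemma point_zero (a b c : ℝ) : point a b c 0 = a := rfl
@[simp] lemma point_one (a b c : ℝ) : point a b c 1 = b := rfl
@[simp] lemma point_two (a b c : ℝ) : point a b c 2 = c := rfl

lemma contDiff_point {E : Type*} [NormedAddCommGroup E] [NormedSpace ℝ E] {a b c : E → ℝ}
    (ha : ContDiff ℝ ∞ a) (hb : ContDiff ℝ ∞ b) (hc : ContDiff ℝ ∞ c) :
    ContDiff ℝ ∞ fun z => point (a z) (b z) (c z) := by
  refine contDiff_euclidean.2 fun i => ?_
  fin_cases i
  exacts [ha, hb, hc]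

lemma point_mem_ball {z y : E3} {r : ℝ} (hy : y ∈ Metric.ball z r) :
    point (y 0) (y 1) (z 2) ∈ Metric.ball z r := by
  refine lt_of_le_of_lt ?_ (Metric.mem_ball.1 hy)
  rw [EuclideanSpace.dist_eq, EuclideanSpace.dist_eq]
  refine Real.sqrt_le_sqrt ?_
  simp only [Fin.sum_univ_three, point_zero, point_one, point_two, dist_self]
  have := sq_nonneg (dist (y 2) (z 2))
  linarith

lemma eq_of_fderiv_direction_eq_zero {s : Set E3} (hs : Convex ℝ s) (hso : IsOpen s)
    {b : E3 → ℝ} (hb : DifferentiableOn ℝ b s) {y w : E3} (hy : y ∈ s) (hw : w ∈ s)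
    (h : ∀ z ∈ s, fderiv ℝ b z (y - w) = 0) : b y = b w := by
  have hmem : ∀ t ∈ Set.Icc (0 : ℝ) 1, w + t • (y - w) ∈ s := fun t ht =>
    hs.add_smul_sub_mem hw hy ht
  have hd : ∀ t ∈ Set.Icc (0 : ℝ) 1, HasDerivAt (fun t : ℝ => b (w + t • (y - w))) 0 t := by
    intro t ht
    have h1 := (hb.differentiableAt (hso.mem_nhds (hmem t ht))).hasFDerivAt
    have h2 : HasDerivAt (fun t : ℝ => w + t • (y - w)) (y - w) t := by
      simpa using ((hasDerivAt_id t).smul_const (y - w)).const_add w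
    have h3 := h1.comp_hasDerivAt t h2
    rwa [h _ (hmem t ht)] at h3
  have h4 := constant_of_has_deriv_right_zero
    (fun t ht => (hd t ht).continuousAt.continuousWithinAt)
    (fun t ht => (hd t (Set.Ico_subset_Icc_self ht)).hasDerivWithinAt) 1 (by simp)
  simpa using h4

/-- A function on a ball whose third partial derivative vanishes depends on the first two
coordinates only. -/
lemma eq_of_fderiv_third_eq_zero {z : E3} {r : ℝ} {b : E3 → ℝ}
    (hb : DifferentiableOn ℝ b (Metric.ball z r))
    (h : ∀ y ∈ Metric.ball z r, fderiv ℝ b y (stdVec 2) = 0) {y : E3} (hy : y ∈ Metric.ball z r) :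
    b y = b (point (y 0) (y 1) (z 2)) := by
  refine eq_of_fderiv_direction_eq_zero (convex_ball z r) Metric.isOpen_ball hb hy
    (point_mem_ball hy) fun w hw => ?_
  have hyw : y - point (y 0) (y 1) (z 2) = (y 2 - z 2) • stdVec 2 := by
    ext i
    fin_cases i <;> simp
  rw [hyw, map_smul, h w hw, smul_zero]

/-! ### Existence of charts in generic normal form. -/

section Charts

open IsNormalizedOn (basicForm)

variable {M : Type*} [TopologicalSpace M] [ChartedSpace E3 M] [IsManifold 𝓘(ℝ, E3) ∞ M]
  {ξ ξ' : ∀ m : M, Submodule ℝ (TangentSpace 𝓘(ℝ, E3) m)} {ε : ℝ}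
  {X : ∀ m : M, TangentSpace 𝓘(ℝ, E3) m} {I J : M → ℝ} {e e' : OpenPartialHomeomorph M E3}
  {α β : E3 → E3 →L[ℝ] ℝ}

lemma transitionDomain_eq_target (h : ∀ p ∈ e'.source, p ∈ e.source) :
    transitionDomain e' e e.target = e'.target := by
  refine Set.inter_eq_left.2 fun y hy => ?_
  have := h _ (e'.map_target hy)
  exact ⟨this, e.map_source this⟩

/-- Normalized forms of the pair on the whole domain of a chart. -/
structure IsAdapted (ξ ξ' : ∀ m : M, Submodule ℝ (TangentSpace 𝓘(ℝ, E3) m)) (ε : ℝ)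
    (X : ∀ m : M, TangentSpace 𝓘(ℝ, E3) m) (I J : M → ℝ) (e : OpenPartialHomeomorph M E3)
    (α β : E3 → E3 →L[ℝ] ℝ) : Prop where
  mem : e ∈ smoothCharts M
  kernel : IsKernelForms ξ ξ' e e.target α β
  normalized : IsNormalizedOn e.target ε (vecInChart e X) (fun y => I (e.symm y))
    (fun y => J (e.symm y)) α β

lemma IsAdapted.transport (h : IsAdapted ξ ξ' ε X I J e α β) (he' : e' ∈ smoothCharts M)
    (hs : ∀ p ∈ e'.source, p ∈ e.source) :
    IsAdapted ξ ξ' ε X I J e' (pullForm (transition e' e) α) (pullForm (transition e' e) β) := by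
  have hd := transitionDomain_eq_target hs
  refine ⟨he', ?_, ?_⟩
  · simpa only [hd] using h.kernel.transport h.mem he'
  · simpa only [hd] using h.normalized.transport h.mem he'

/-- The derivative in a subordinate chart of a function given in the larger chart. -/
lemma fderiv_subchart (he : e ∈ smoothCharts M) (he' : e' ∈ smoothCharts M)
    (hs : ∀ p ∈ e'.source, p ∈ e.source) {f : E3 → ℝ} {k : E3 → ℝ}
    (hfk : ∀ p ∈ e'.source, k (e' p) = f (e p)) {y : E3} (hy : y ∈ e'.target)
    (hf : DifferentiableAt ℝ f (transition e' e y)) :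
    fderiv ℝ k y = (fderiv ℝ f (transition e' e y)).comp (fderiv ℝ (transition e' e) y) := by
  have hd := transitionDomain_eq_target hs
  refine fderiv_comp_of_eqOn e'.open_target hy ?_ hf fun z hz => ?_
  · refine ((contDiffOn_transitionDomain (U := e.target) he he').contDiffAt ?_).differentiableAt
      (by simp)
    rw [hd]
    exact e'.open_target.mem_nhds hy
  · rw [transition, ← hfk _ (e'.map_target hz), e'.right_inv hz]

lemma fderiv_of_coordinate {f : M → ℝ} {i : Fin 3} (h : ∀ p ∈ e.source, e p i = f p) {y : E3}
    (hy : y ∈ e.target) (v : E3) : fderiv ℝ (fun y => f (e.symm y)) y v = v i := by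
  have e1 : (fun y => f (e.symm y)) =ᶠ[𝓝 y] fun z => z i := by
    filter_upwards [e.open_target.mem_nhds hy] with z hz
    rw [← h _ (e.map_target hz), e.right_inv hz]
  rw [e1.fderiv_eq, fderiv_coord_apply]

/-- In a generic chart the kernel relations follow from the form of the basic form. -/
lemma IsAdapted.isGenericNormalForm (h : IsAdapted ξ ξ' ε X I J e α β) {m : M}
    (hm : m ∈ e.source) (hIJ : ∀ p ∈ e.source, e p 1 = I p ∧ e p 2 = J p) {B : ℝ × ℝ → ℝ}
    (hB : ContDiffOn ℝ ∞ B ((fun y : E3 => (y 1, y 0)) '' e.target))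
    (hB0 : ∀ y ∈ e.target, 0 < B (y 1, y 0))
    (hD : ∀ p ∈ e.source, 1 + I p * J p + ε * J p ^ 2 ≠ 0)
    (hθ : ∀ y ∈ e.target, ∀ v : E3, basicForm ε (fun y => I (e.symm y)) (fun y => J (e.symm y))
      α β y v = B (y 1, y 0) * v 0) : IsGenericNormalForm ξ ξ' ε I J m e B := by
  have hdI := fun y hy v => fderiv_of_coordinate (fun p hp => (hIJ p hp).1) (y := y) hy v
  refine ⟨⟨h.mem, hm⟩, hIJ, hB, fun p hp => ?_, fun p hp v => ?_, fun p hp v => ?_⟩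
  · rw [← (hIJ p hp).1]
    exact hB0 _ (e.map_source hp)
  · have hy := e.map_source hp
    have h1 := h.normalized.smul_first_eq hy (chartD e p v)
    rw [hdI _ hy, hθ _ hy, (hIJ p hp).1, e.left_inv hp] at h1
    rw [h.kernel.ker₁ p hp hy, ← mul_right_inj' (hD p hp), h1, mul_zero, sub_eq_zero,
      ← mul_assoc, mul_comm (J p)]
  · have hy := e.map_source hp
    have h1 := h.normalized.smul_second_eq hy (chartD e p v)
    rw [hdI _ hy, hθ _ hy, (hIJ p hp).1, e.left_inv hp] at h1
    rw [h.kernel.ker₂ p hp hy, ← mul_right_inj' (hD p hp), h1, mul_zero]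

lemma pullForm_basicForm {τ : E3 → E3} {f g : E3 → ℝ} {y : E3} {f' g' : E3 → ℝ}
    (hf : f' y = f (τ y)) (hg : g' y = g (τ y)) :
    basicForm ε f' g' (pullForm τ α) (pullForm τ β) y = pullForm τ (basicForm ε f g α β) y := by
  ext v
  simp [basicForm, pullForm_apply, hf, hg]

/-- The coordinates are x from θ = g dx, together with I and J. On a ball the coefficient of θ does
not depend on J, so freezing J at its value at m defines B as a function of (I, x). -/
theorem IsAdapted.exists_generic_chart (h : IsAdapted ξ ξ' ε X I J e α β)
    (hε : ε = 1 ∨ ε = -1) (hD : ∀ p : M, 1 + I p * J p + ε * J p ^ 2 ≠ 0) {m : M}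
    (hm : m ∈ e.source) :
    ∃ (e' : OpenPartialHomeomorph M E3) (α' β' : E3 → E3 →L[ℝ] ℝ) (B : ℝ × ℝ → ℝ),
      IsAdapted ξ ξ' ε X I J e' α' β' ∧ IsGenericNormalForm ξ ξ' ε I J m e' B ∧
      ∀ y ∈ e'.target, ∀ v : E3, basicForm ε (fun y => I (e'.symm y)) (fun y => J (e'.symm y))
        α' β' y v = B (y 1, y 0) * v 0 := by
  have hN := h.normalized
  have hy := e.map_source hm
  obtain ⟨W, x, g, hW, hyW, hWU, hx, hg, hθ⟩ := hN.exists_positive_factor hε hy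
  have hΨ := contDiffOn_coordMap hx (hN.smooth_invariant.mono hWU) (hN.smoothJ.mono hWU)
  obtain ⟨e', r, he', hm', hs, hΨe, hr, ht⟩ := exists_chart_of_coordinates h.mem hW hm hyW hΨ
    (fun v hv => by
      obtain ⟨h0, h1, h2⟩ := fderiv_eq_zero_of_coordMap
        ((hΨ.contDiffAt (hW.mem_nhds hyW)).differentiableAt (by simp)) hv
      refine hN.eq_zero_of_basicForm hε hy ?_ ?_ h1 h2
      · simpa using hD (e.symm (e m))
      · rw [(hθ _ hyW).1, smul_apply, h0, smul_zero])
  have hs1 : ∀ p ∈ e'.source, p ∈ e.source := fun p hp => (hs p hp).1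
  have hA := h.transport he' hs1
  have hdom := transitionDomain_eq_target hs1
  have hτW : Set.MapsTo (transition e' e) e'.target W := fun y hy => (hs _ (e'.map_target hy)).2
  have hτ : ContDiffOn ℝ ∞ (transition e' e) e'.target := by
    simpa only [hdom] using contDiffOn_transitionDomain (U := e.target) h.mem he'
  have hIJ : ∀ p ∈ e'.source, e' p 1 = I p ∧ e' p 2 = J p := by
    intro p hp
    simp [hΨe, e.left_inv (hs1 p hp)]
  set b : E3 → ℝ := fun y => g (transition e' e y) with hbdef
  have hb : ContDiffOn ℝ ∞ b e'.target := hg.comp hτ hτW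
  have hb0 : ∀ y ∈ e'.target, 0 < b y := fun y hy => (hθ _ (hτW hy)).2
  have hbθ : ∀ y ∈ e'.target, ∀ v : E3, basicForm ε (fun y => I (e'.symm y))
      (fun y => J (e'.symm y)) (pullForm (transition e' e) α) (pullForm (transition e' e) β) y v
        = b y * v 0 := by
    intro y hy v
    have hyd : y ∈ transitionDomain e' e e.target := by rwa [hdom]
    rw [pullForm_basicForm (f := fun y => I (e.symm y)) (g := fun y => J (e.symm y))
      (transition_fun hyd) (transition_fun hyd), pullForm_apply, (hθ _ (hτW hy)).1, smul_apply,
      smul_eq_mul]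
    have h1 := fderiv_subchart h.mem he' hs1 (f := x) (k := fun y => y 0)
      (fun p hp => by rw [hΨe, coordMap_zero]) hy
      ((hx.contDiffAt (hW.mem_nhds (hτW hy))).differentiableAt (by simp))
    have h2 := congrArg (fun L => L v) h1
    simp only [fderiv_coord_apply, ContinuousLinearMap.comp_apply] at h2
    rw [← h2]
  have hb3 : ∀ y ∈ e'.target, fderiv ℝ b y (stdVec 2) = 0 := fun y hy =>
    hA.normalized.fderiv_coefficient_eq_zero hε hb hb0 hbθ
      (fun y hy => by rw [← (hIJ _ (e'.map_target hy)).1, e'.right_inv hy]) hy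
  have hbB : ∀ y ∈ e'.target, b y = b (point (y 0) (y 1) (e' m 2)) := by
    rw [ht] at hb hb3 ⊢
    exact fun y hy => eq_of_fderiv_third_eq_zero (hb.differentiableOn (by simp)) hb3 hy
  set B : ℝ × ℝ → ℝ := fun w => b (point w.2 w.1 (e' m 2)) with hB
  have hθB : ∀ y ∈ e'.target, ∀ v : E3, basicForm ε (fun y => I (e'.symm y))
      (fun y => J (e'.symm y)) (pullForm (transition e' e) α) (pullForm (transition e' e) β) y v
        = B (y 1, y 0) * v 0 := fun y hy v => by rw [hbθ y hy, hbB y hy]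
  refine ⟨e', _, _, B, hA, hA.isGenericNormalForm hm' hIJ ?_ ?_ (fun p _ => hD p) hθB, hθB⟩
  · refine hb.comp (contDiff_point contDiff_snd contDiff_fst contDiff_const).contDiffOn ?_
    rintro _ ⟨y, hy, rfl⟩
    rw [ht] at hy ⊢
    exact point_mem_ball hy
  · intro y hy
    have := hb0 y hy
    rwa [hbB y hy] at this

end Charts

/-! ### The degenerate normal form -/

namespace IsNormalizedOn

variable {U : Set E3} {ε : ℝ} {X : E3 → E3} {I J : E3 → ℝ} {α β : E3 → E3 →L[ℝ] ℝ}

/-- Differentiating the quadratic relation gives J dI + (I + 2εJ) dJ = 0. If I + 2εJ vanished,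
evaluation on a vector with dI = 1 would give J = 0, contradicting the relation itself. -/
lemma root_derivative_ne_zero (h : IsNormalizedOn U ε X I J α β)
    (hJ : ∀ y ∈ U, 1 + I y * J y + ε * J y ^ 2 = 0) {y : E3} (hy : y ∈ U) :
    I y + 2 * ε * J y ≠ 0 := by
  intro hs
  have hId := h.differentiableAt_invariant hy
  have hJd := h.differentiableAt_J hy
  have e : (fun z => 1 + I z * J z + ε * J z ^ 2) =ᶠ[𝓝 y] fun _ => (0 : ℝ) := by
    filter_upwards [h.isOpen.mem_nhds hy] with z hz using hJ z hz
  have hd : HasFDerivAt (fun z => 1 + I z * J z + ε * J z ^ 2) _ y :=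
    ((hId.hasFDerivAt.mul hJd.hasFDerivAt).const_add 1).add
      ((hJd.hasFDerivAt.pow 2).const_mul ε)
  have h0 := hd.unique (((hasFDerivAt_const (0 : ℝ) y)).congr_of_eventuallyEq e)
  obtain ⟨w₁, w₂, h1, h2, h3, h4⟩ := h.frame y hy
  have h5 := congrArg (fun L => L w₁) h0
  simp only [h.fderiv_invariant y hy, add_apply, smul_apply, smul_eq_mul, h1, h2,
    zero_apply] at h5
  have hJ0 : J y = 0 := by
    norm_num at h5
    linear_combination h5 - fderiv ℝ J y w₁ * hs
  simpa [hJ0] using hJ y hy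

/-- This and the next identity solve dI = α + Jβ and θ = J(εJα + β) for α and β; they turn the
kernels into dI = θ and εJ² dI = θ. -/
lemma degenerate_first_eq (h : IsNormalizedOn U ε X I J α β) {y : E3} (hy : y ∈ U) (v : E3) :
    (1 - ε * J y ^ 2) * α y v = fderiv ℝ I y v - degenerateForm ε J α β y v := by
  simp only [h.fderiv_invariant y hy, degenerateForm, add_apply, smul_apply, smul_eq_mul]
  ring

lemma degenerate_second_eq (h : IsNormalizedOn U ε X I J α β) {y : E3} (hy : y ∈ U) (v : E3) :
    -(J y * (1 - ε * J y ^ 2)) * β y v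
      = ε * J y ^ 2 * fderiv ℝ I y v - degenerateForm ε J α β y v := by
  simp only [h.fderiv_invariant y hy, degenerateForm, add_apply, smul_apply, smul_eq_mul]
  ring

/-- By the quadratic relation J(I + 2εJ) = εJ² − 1, so the claim is that the root is simple. -/
lemma one_sub_ne_zero (h : IsNormalizedOn U ε X I J α β)
    (hJ : ∀ y ∈ U, 1 + I y * J y + ε * J y ^ 2 = 0) {y : E3} (hy : y ∈ U) :
    J y ≠ 0 ∧ 1 - ε * J y ^ 2 ≠ 0 := by
  have hJ0 : J y ≠ 0 := fun h0 => by simpa [h0] using hJ y hy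
  refine ⟨hJ0, fun h0 => ?_⟩
  have : J y * (I y + 2 * ε * J y) = 0 := by linear_combination hJ y hy - h0
  exact (mul_ne_zero hJ0 (h.root_derivative_ne_zero hJ hy)) this

/-- The kernel of dx and dI consists of multiples of X. From θ = g dx one gets i_X dθ = (X g) dx,
and this equals ((1 − εJ²)/J) θ ≠ 0; so X g ≠ 0 and g is a third coordinate. -/
lemma eq_zero_of_degenerateForm (h : IsNormalizedOn U ε X I J α β) (hε : ε = 1 ∨ ε = -1)
    (hJ : ∀ y ∈ U, 1 + I y * J y + ε * J y ^ 2 = 0) {W : Set E3} (hW : IsOpen W) {x g : E3 → ℝ}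
    (hx : ContDiffOn ℝ ∞ x W) (hg : ContDiffOn ℝ ∞ g W)
    (hθ : ∀ y ∈ W, degenerateForm ε J α β y = g y • fderiv ℝ x y ∧ g y ≠ 0) {y v : E3}
    (hy : y ∈ U) (hyW : y ∈ W) (h0 : fderiv ℝ x y v = 0) (h1 : fderiv ℝ I y v = 0)
    (h2 : fderiv ℝ g y v = 0) : v = 0 := by
  obtain ⟨hJ0, hJ1⟩ := h.one_sub_ne_zero hJ hy
  have hθv : degenerateForm ε J α β y v = 0 := by rw [(hθ y hyW).1, smul_apply, h0, smul_zero]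
  have hα : α y v = 0 := by
    have := h.degenerate_first_eq hy v
    rw [h1, hθv, sub_zero] at this
    exact (mul_eq_zero.1 this).resolve_left hJ1
  have hβ : β y v = 0 := by
    have := h.degenerate_second_eq hy v
    rw [h1, hθv, mul_zero, sub_zero] at this
    exact (mul_eq_zero.1 this).resolve_left (neg_ne_zero.2 (mul_ne_zero hJ0 hJ1))
  obtain ⟨a, rfl⟩ := h.eq_smul_axis hy hα hβ
  obtain ⟨w, hw⟩ : ∃ w, degenerateForm ε J α β y w ≠ 0 := by
    by_contra! h3
    exact h.degenerateForm_ne_zero hy hJ0 (ContinuousLinearMap.ext h3)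
  have hWn := hW.mem_nhds hyW
  have hx' : ContDiffAt ℝ ∞ x y := hx.contDiffAt hWn
  have e : degenerateForm ε J α β =ᶠ[𝓝 y] fun z => g z • fderiv ℝ x z := by
    filter_upwards [hWn] with z hz using (hθ z hz).1
  have hX : fderiv ℝ x y (X y) = 0 := by
    have := h.degenerateForm_axis hy
    rw [(hθ y hyW).1, smul_apply, smul_eq_mul] at this
    exact (mul_eq_zero.1 this).resolve_left (hθ y hyW).2
  have e1 := h.extD_degenerateForm_axis hε hy (hJ y hy) hJ0 w
  rw [extD_congr e, extD_smul ((hg.contDiffAt hWn).differentiableAt (by simp))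
    ((hx'.fderiv_right (m := ∞) (by simp)).differentiableAt (by simp)), extD_fderiv hx', wedge, hX,
    mul_zero, mul_zero, zero_add, sub_zero] at e1
  have hgX : fderiv ℝ g y (X y) ≠ 0 := by
    intro h3
    rw [h3, zero_mul] at e1
    exact mul_ne_zero (div_ne_zero hJ1 hJ0) hw e1.symm
  rw [map_smul, smul_eq_mul] at h2
  rw [(mul_eq_zero.1 h2).resolve_right hgX, zero_smul]

end IsNormalizedOn

/-! ### Existence of charts in degenerate normal form. -/

section Charts

open IsNormalizedOn (degenerateForm)

variable {M : Type*} [TopologicalSpace M] [ChartedSpace E3 M] [IsManifold 𝓘(ℝ, E3) ∞ M]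
  {ξ ξ' : ∀ m : M, Submodule ℝ (TangentSpace 𝓘(ℝ, E3) m)} {ε : ℝ}
  {X : ∀ m : M, TangentSpace 𝓘(ℝ, E3) m} {I J : M → ℝ} {e e' : OpenPartialHomeomorph M E3}
  {α β : E3 → E3 →L[ℝ] ℝ}

lemma pullForm_degenerateForm {τ : E3 → E3} {g : E3 → ℝ} {y : E3} {g' : E3 → ℝ}
    (hg : g' y = g (τ y)) :
    degenerateForm ε g' (pullForm τ α) (pullForm τ β) y
      = pullForm τ (degenerateForm ε g α β) y := by
  ext v
  simp [degenerateForm, pullForm_apply, hg]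

/-- The root of `1 + t X ± X²` that belongs to the sign `σ` of the derivative `t ± 2 X`. -/
def quadraticRoot (ε σ t : ℝ) : ℝ := ε * (-t + σ * Real.sqrt (t ^ 2 - 4 * ε)) / 2

lemma quadratic_discriminant {t u : ℝ} (hε : ε = 1 ∨ ε = -1) (h : 1 + t * u + ε * u ^ 2 = 0) :
    (t + 2 * ε * u) ^ 2 = t ^ 2 - 4 * ε := by
  have hεε : ε * ε = 1 := by rcases hε with rfl | rfl <;> norm_num
  linear_combination 4 * ε * h

/-- Completing the square: t + 2εu is a square root of t² − 4ε, and σ tells which one. -/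
lemma eq_quadraticRoot {t u σ : ℝ} (hε : ε = 1 ∨ ε = -1) (hσ : σ = 1 ∨ σ = -1)
    (h : 1 + t * u + ε * u ^ 2 = 0) (hs : 0 < σ * (t + 2 * ε * u)) :
    u = quadraticRoot ε σ t := by
  have hεε : ε * ε = 1 := by rcases hε with rfl | rfl <;> norm_num
  have hσσ : σ * σ = 1 := by rcases hσ with rfl | rfl <;> norm_num
  have h1 : Real.sqrt (t ^ 2 - 4 * ε) = σ * (t + 2 * ε * u) := by
    rw [← Real.sqrt_sq hs.le, ← quadratic_discriminant hε h]
    congr 1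
    linear_combination (-(t + 2 * ε * u) ^ 2) * hσσ
  rw [quadraticRoot, h1]
  linear_combination (-u) * hεε - ε * (t + 2 * ε * u) / 2 * hσσ

/-- The domain is shrunk until I + 2εJ has a constant sign σ, so that J is one fixed branch of the
quadratic in I. The branch is smooth since the discriminant (I + 2εJ)² does not vanish. The third
coordinate p is the integrating factor of θ. -/
theorem IsAdapted.exists_degenerate_chart (h : IsAdapted ξ ξ' ε X I J e α β)
    (hε : ε = 1 ∨ ε = -1) (hJ : ∀ p : M, 1 + I p * J p + ε * J p ^ 2 = 0) {m : M}
    (hm : m ∈ e.source) :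
    ∃ (e' : OpenPartialHomeomorph M E3) (j : ℝ → ℝ),
      IsDegenerateNormalForm ξ ξ' ε I J m e' j := by
  have hN := h.normalized
  have hy := e.map_source hm
  have hJe : ∀ y ∈ e.target, 1 + I (e.symm y) * J (e.symm y) + ε * J (e.symm y) ^ 2 = 0 :=
    fun y _ => hJ _
  obtain ⟨hJ0, hJ1⟩ := hN.one_sub_ne_zero hJe hy
  obtain ⟨W, x, g, hW, hyW, hWU, hx, hg, hθ⟩ := exists_integrating_factor
    (U := e.target) hN.isOpen hy hN.smooth_axis hN.smooth_degenerateForm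
    (lam := fun y => (1 - ε * J (e.symm y) ^ 2) / J (e.symm y))
    ((continuousOn_const.sub (continuousOn_const.mul (hN.smoothJ.continuousOn.pow 2))).div
      hN.smoothJ.continuousOn fun y hy => (hN.one_sub_ne_zero hJe hy).1)
    (hN.axis_ne_zero hy) (hN.degenerateForm_ne_zero hy hJ0)
    (fun y hy => hN.degenerateForm_axis hy)
    (fun y hy v => hN.extD_degenerateForm_axis hε hy (hJe y hy) (hN.one_sub_ne_zero hJe hy).1 v)
  obtain ⟨σ, hσ, hσ0⟩ : ∃ σ : ℝ, (σ = 1 ∨ σ = -1) ∧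
      0 < σ * (I (e.symm (e m)) + 2 * ε * J (e.symm (e m))) := by
    rcases lt_or_gt_of_ne (hN.root_derivative_ne_zero hJe hy) with h0 | h0
    · exact ⟨-1, Or.inr rfl, by linarith⟩
    · exact ⟨1, Or.inl rfl, by linarith⟩
  have hsc : ContinuousOn (fun y => σ * (I (e.symm y) + 2 * ε * J (e.symm y))) W :=
    (continuousOn_const.mul (hN.smooth_invariant.continuousOn.add
      (continuousOn_const.mul hN.smoothJ.continuousOn))).mono hWU
  have hVo := hsc.isOpen_inter_preimage hW (isOpen_Ioi (a := (0 : ℝ)))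
  have hΨ := contDiffOn_coordMap hx (hN.smooth_invariant.mono hWU) hg
  obtain ⟨e', r, he', hm', hs, hΨe, hr, ht⟩ := exists_chart_of_coordinates h.mem hVo hm ⟨hyW, hσ0⟩
    (hΨ.mono Set.inter_subset_left)
    (fun v hv => by
      obtain ⟨h0, h1, h2⟩ := fderiv_eq_zero_of_coordMap
        ((hΨ.contDiffAt (hW.mem_nhds hyW)).differentiableAt (by simp)) hv
      exact hN.eq_zero_of_degenerateForm hε hJe hW hx hg hθ hy hyW h0 h1 h2)
  have hs1 : ∀ p ∈ e'.source, p ∈ e.source := fun p hp => (hs p hp).1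
  have hA := h.transport he' hs1
  have hdom := transitionDomain_eq_target hs1
  have hτW : Set.MapsTo (transition e' e) e'.target W := fun y hy =>
    (hs _ (e'.map_target hy)).2.1
  have hI : ∀ p ∈ e'.source, e' p 1 = I p := by
    intro p hp
    simp [hΨe, e.left_inv (hs1 p hp)]
  have hdI := fun y hy v => fderiv_of_coordinate hI (y := y) hy v
  have hθ' : ∀ y ∈ e'.target, ∀ v : E3, degenerateForm ε (fun y => J (e'.symm y))
      (pullForm (transition e' e) α) (pullForm (transition e' e) β) y v = y 2 * v 0 := by
    intro y hy v
    have hyd : y ∈ transitionDomain e' e e.target := by rwa [hdom]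
    rw [pullForm_degenerateForm (g := fun y => J (e.symm y))
      (transition_fun hyd), pullForm_apply, (hθ _ (hτW hy)).1, smul_apply, smul_eq_mul]
    have h1 := fderiv_subchart h.mem he' hs1 (f := x) (k := fun y => y 0)
      (fun p hp => by rw [hΨe, coordMap_zero]) hy
      ((hx.contDiffAt (hW.mem_nhds (hτW hy))).differentiableAt (by simp))
    have h2 := congrArg (fun L => L v) h1
    simp only [fderiv_coord_apply, ContinuousLinearMap.comp_apply] at h2
    have h3 : y 2 = g (transition e' e y) := by
      rw [transition]
      conv_lhs => rw [← e'.right_inv hy, hΨe, coordMap_two]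
    rw [← h2, h3]
  have hroot : ∀ p ∈ e'.source, J p = quadraticRoot ε σ (I p) := by
    intro p hp
    have h1 := (hs p hp).2.2
    rw [Set.mem_preimage, Set.mem_Ioi, e.left_inv (hs1 p hp)] at h1
    exact eq_quadraticRoot hε hσ (hJ p) h1
  have hne : ∀ p ∈ e'.source, J p ≠ 0 ∧ 1 - ε * J p ^ 2 ≠ 0 := by
    intro p hp
    have := hN.one_sub_ne_zero hJe (e.map_source (hs1 p hp))
    rwa [e.left_inv (hs1 p hp)] at this
  refine ⟨e', quadraticRoot ε σ, ⟨he', hm'⟩, hI, ?_, fun p hp => ⟨hroot p hp, ?_⟩,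
    fun p hp v => ?_, fun p hp v => ?_⟩
  · rintro _ ⟨p, hp, rfl⟩
    have h1 := hN.root_derivative_ne_zero hJe (e.map_source (hs1 p hp))
    rw [e.left_inv (hs1 p hp)] at h1
    have h2 : I p ^ 2 - 4 * ε ≠ 0 := by
      rw [← quadratic_discriminant hε (hJ p)]
      exact pow_ne_zero 2 h1
    refine ContDiffAt.contDiffWithinAt ?_
    exact (contDiffAt_const.mul (contDiffAt_id.neg.add (contDiffAt_const.mul
      (((contDiffAt_id.pow 2).sub contDiffAt_const).sqrt h2)))).div_const 2
  · rw [← hroot p hp]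
    exact hJ p
  · have hy := e'.map_source hp
    have h1 := hA.normalized.degenerate_first_eq hy (chartD e' p v)
    rw [hdI _ hy, hθ' _ hy, e'.left_inv hp] at h1
    rw [hA.kernel.ker₁ p hp hy, ← mul_right_inj' (hne p hp).2, h1, mul_zero, sub_eq_zero]
  · have hy := e'.map_source hp
    have h1 := hA.normalized.degenerate_second_eq hy (chartD e' p v)
    rw [hdI _ hy, hθ' _ hy, e'.left_inv hp] at h1
    rw [hA.kernel.ker₂ p hp hy,
      ← mul_right_inj' (neg_ne_zero.2 (mul_ne_zero (hne p hp).1 (hne p hp).2)), h1, mul_zero,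
      sub_eq_zero, ← hroot p hp]

end Charts

/-! ### Vector fields and Lie brackets in charts -/

section LieBracket

variable {M : Type*} [TopologicalSpace M] [ChartedSpace E3 M] [IsManifold 𝓘(ℝ, E3) ∞ M]
  {ξ ξ' : ∀ m : M, Submodule ℝ (TangentSpace 𝓘(ℝ, E3) m)}
  {Y Z : ∀ m : M, TangentSpace 𝓘(ℝ, E3) m} {e : OpenPartialHomeomorph M E3}

lemma inverse_chartD_apply (he : e ∈ smoothCharts M) {p : M} (hp : p ∈ e.source)
    (v : TangentSpace 𝓘(ℝ, E3) p) : (chartD e p).inverse (chartD e p v) = v := by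
  obtain ⟨L, hL⟩ : (chartD e p).IsInvertible :=
    ⟨(mdifferentiable_chart_of_mem he).mfderiv hp, rfl⟩
  rw [← hL, ContinuousLinearMap.inverse_equiv]
  exact L.symm_apply_apply v

lemma mpullback_symm (he : e ∈ smoothCharts M) {y : E3} (hy : y ∈ e.target) :
    VectorField.mpullback 𝓘(ℝ, E3) 𝓘(ℝ, E3) e.symm Y y = vecInChart e Y y := by
  have hd := mdifferentiable_chart_of_mem he
  have h1 := hd.comp_symm_deriv hy
  have h2 := hd.symm_comp_deriv (e.map_target hy)
  rw [VectorField.mpullback_apply]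
  refine congrArg (fun L => L (Y (e.symm y))) (?_ : _ = chartD e (e.symm y))
  rw [e.right_inv hy] at h2
  exact ContinuousLinearMap.inverse_eq h2 h1

lemma isInvertible_mfderiv_chart (he : e ∈ smoothCharts M) {p : M} (hp : p ∈ e.source) :
    (mfderiv 𝓘(ℝ, E3) 𝓘(ℝ, E3) e p).IsInvertible :=
  ⟨(mdifferentiable_chart_of_mem he).mfderiv hp, rfl⟩

lemma isInvertible_mfderiv_chart_symm (he : e ∈ smoothCharts M) {y : E3} (hy : y ∈ e.target) :
    (mfderiv 𝓘(ℝ, E3) 𝓘(ℝ, E3) e.symm y).IsInvertible :=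
  ⟨(mdifferentiable_chart_of_mem he).symm.mfderiv hy, rfl⟩

lemma contMDiffAt_chart (he : e ∈ smoothCharts M) {p : M} (hp : p ∈ e.source) :
    ContMDiffAt 𝓘(ℝ, E3) 𝓘(ℝ, E3) ∞ e p :=
  (contMDiffOn_of_mem_maximalAtlas he).contMDiffAt (e.open_source.mem_nhds hp)

lemma contMDiffAt_chart_symm (he : e ∈ smoothCharts M) {y : E3} (hy : y ∈ e.target) :
    ContMDiffAt 𝓘(ℝ, E3) 𝓘(ℝ, E3) ∞ e.symm y :=
  (contMDiffOn_symm_of_mem_maximalAtlas he).contMDiffAt (e.open_target.mem_nhds hy)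

instance : IsManifold 𝓘(ℝ, E3) 1 M := IsManifold.of_le (n := ∞) (by simp)

instance : IsManifold 𝓘(ℝ, E3) (minSmoothness ℝ 2) M :=
  IsManifold.of_le (n := ∞) (by simpa using two_le_infty)

lemma contDiffAt_vecInChart (he : e ∈ smoothCharts M) {p : M} (hp : p ∈ e.source)
    (hY : ContMDiffAt 𝓘(ℝ, E3) 𝓘(ℝ, E3).tangent ∞
      (fun x => (⟨x, Y x⟩ : TangentBundle 𝓘(ℝ, E3) M)) p) :
    ContDiffAt ℝ ∞ (vecInChart e Y) (e p) := by
  have hy := e.map_source hp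
  have h1 : ContMDiffAt 𝓘(ℝ, E3) 𝓘(ℝ, E3).tangent ∞
      (fun x => (⟨x, VectorField.mpullback 𝓘(ℝ, E3) 𝓘(ℝ, E3) e.symm Y x⟩ :
        TangentBundle 𝓘(ℝ, E3) E3)) (e p) := by
    refine ContMDiffAt.mpullback_vectorField_preimage (n := ∞) ?_ (contMDiffAt_chart_symm he hy)
      (isInvertible_mfderiv_chart_symm he hy) (by simp)
    rwa [e.left_inv hp]
  refine (contMDiffAt_vectorSpace_iff_contDiffAt.1 h1).congr_of_eventuallyEq ?_
  filter_upwards [e.open_target.mem_nhds hy] with y hy using (mpullback_symm he hy).symm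

/-- The vector field on `M` given in the chart `e` by a vector field on coordinate space. -/
def fieldOfChart (e : OpenPartialHomeomorph M E3) (V : E3 → E3) (p : M) :
    TangentSpace 𝓘(ℝ, E3) p := VectorField.mpullback 𝓘(ℝ, E3) 𝓘(ℝ, E3) e V p

lemma chartD_fieldOfChart (he : e ∈ smoothCharts M) {p : M} (hp : p ∈ e.source) (V : E3 → E3) :
    chartD e p (fieldOfChart e V p) = V (e p) := by
  obtain ⟨v, hv⟩ := chartD_surjective he hp (V (e p))
  have h := inverse_chartD_apply he hp v
  rw [hv] at h
  exact (congrArg (chartD e p) h).trans hv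

lemma contMDiffAt_fieldOfChart (he : e ∈ smoothCharts M) {p : M} (hp : p ∈ e.source)
    {V : E3 → E3} (hV : ContDiffAt ℝ ∞ V (e p)) :
    ContMDiffAt 𝓘(ℝ, E3) 𝓘(ℝ, E3).tangent ∞
      (fun x => (⟨x, fieldOfChart e V x⟩ : TangentBundle 𝓘(ℝ, E3) M)) p :=
  ContMDiffAt.mpullback_vectorField_preimage (n := ∞)
    (contMDiffAt_vectorSpace_iff_contDiffAt.2 hV) (contMDiffAt_chart he hp)
    (isInvertible_mfderiv_chart he hp) (by simp)

lemma mlieBracket_eq_fderiv (V W : ∀ y : E3, TangentSpace 𝓘(ℝ, E3) y) (y : E3) :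
    VectorField.mlieBracket 𝓘(ℝ, E3) V W y
      = fderiv ℝ (F := E3) W y (V y) - fderiv ℝ (F := E3) V y (W y) := by
  rw [← VectorField.mlieBracketWithin_univ, VectorField.mlieBracketWithin_eq_lieBracketWithin]
  exact congrFun (VectorField.lieBracketWithin_univ (𝕜 := ℝ) (E := E3) (V := V) (W := W)) y

lemma chartD_mlieBracket (he : e ∈ smoothCharts M) {p : M} (hp : p ∈ e.source)
    (hY : ContMDiffAt 𝓘(ℝ, E3) 𝓘(ℝ, E3).tangent ∞
      (fun x => (⟨x, Y x⟩ : TangentBundle 𝓘(ℝ, E3) M)) p)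
    (hZ : ContMDiffAt 𝓘(ℝ, E3) 𝓘(ℝ, E3).tangent ∞
      (fun x => (⟨x, Z x⟩ : TangentBundle 𝓘(ℝ, E3) M)) p) :
    chartD e p (VectorField.mlieBracket 𝓘(ℝ, E3) Y Z p)
      = fderiv ℝ (vecInChart e Z) (e p) (vecInChart e Y (e p))
        - fderiv ℝ (vecInChart e Y) (e p) (vecInChart e Z (e p)) := by
  have hy := e.map_source hp
  have hev : ∀ W : ∀ m : M, TangentSpace 𝓘(ℝ, E3) m,
      (fun x => VectorField.mpullback 𝓘(ℝ, E3) 𝓘(ℝ, E3) e.symm W x)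
        =ᶠ[𝓝 (e p)] vecInChart e W := by
    intro W
    filter_upwards [e.open_target.mem_nhds hy] with y hy using mpullback_symm he hy
  have h1 := VectorField.mpullback_mlieBracket (f := e.symm) (x₀ := e p) (n := ∞)
    (I := 𝓘(ℝ, E3)) (I' := 𝓘(ℝ, E3)) (V := Y) (W := Z)
    (by rw [e.left_inv hp]; exact hY.mdifferentiableAt (by simp))
    (by rw [e.left_inv hp]; exact hZ.mdifferentiableAt (by simp))
    (contMDiffAt_chart_symm he hy) (by simpa using two_le_infty)
  rw [mpullback_symm he hy, vecInChart_apply e hp] at h1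
  exact h1.trans (((hev Y).mlieBracket_vectorField_eq (hev Z)).trans
    (mlieBracket_eq_fderiv _ _ _))

/-- The Lie derivative of a one-form along a vector field. -/
def lieForm (γ : E3 → E3 →L[ℝ] ℝ) (V : E3 → E3) (y u : E3) : ℝ :=
  fderiv ℝ γ y (V y) u + γ y (fderiv ℝ V y u)

/-- Differentiating γ(Z) = 0 along V gives γ(D_V Z) = −(D_V γ)(Z). Hence γ of the bracket depends on
Z only through its value at the point. -/
lemma apply_lieBracket {γ : E3 → E3 →L[ℝ] ℝ} {V Z : E3 → E3} {y : E3}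
    (hγ : DifferentiableAt ℝ γ y) (hZ : DifferentiableAt ℝ Z y)
    (h : ∀ᶠ z in 𝓝 y, γ z (Z z) = 0) :
    γ y (fderiv ℝ Z y (V y) - fderiv ℝ V y (Z y)) = -lieForm γ V y (Z y) := by
  have h1 : (fun z => γ z (Z z)) =ᶠ[𝓝 y] fun _ => (0 : ℝ) := h
  have h2 := (hγ.hasFDerivAt.clm_apply hZ.hasFDerivAt).unique
    ((hasFDerivAt_const (0 : ℝ) y).congr_of_eventuallyEq h1)
  have h3 := congrArg (fun L => L (V y)) h2
  simp only [add_apply, ContinuousLinearMap.comp_apply, ContinuousLinearMap.flip_apply,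
    zero_apply] at h3
  rw [map_sub, lieForm]
  linarith

/-- Project the constant field u to ker γ along a fixed vector. Since every vector of the plane
extends to a local section, the bracket condition on sections becomes a condition on vectors. -/
lemma exists_section {γ : E3 → E3 →L[ℝ] ℝ} {y u : E3} (hγ : ContDiffAt ℝ ∞ γ y)
    (h0 : γ y ≠ 0) (hu : γ y u = 0) :
    ∃ Z : E3 → E3, ContDiffAt ℝ ∞ Z y ∧ Z y = u ∧ ∀ᶠ z in 𝓝 y, γ z (Z z) = 0 := by
  obtain ⟨n, hn⟩ : ∃ n, γ y n ≠ 0 := by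
    by_contra! h
    exact h0 (ContinuousLinearMap.ext h)
  have hn' : ContDiffAt ℝ ∞ (fun z => γ z n) y := hγ.clm_apply contDiffAt_const
  refine ⟨fun z => u - (γ z u / γ z n) • n, ?_, by simp [hu], ?_⟩
  · exact contDiffAt_const.sub
      (((hγ.clm_apply contDiffAt_const).div hn' hn).smul contDiffAt_const)
  · filter_upwards [hn'.continuousAt.eventually_ne hn] with z hz
    simp [hz]

/-- A vector field preserves a plane field if and only if the Lie derivative of a defining form
vanishes on the planes. -/
lemma preservesNear_iff (he : e ∈ smoothCharts M) {γ : E3 → E3 →L[ℝ] ℝ}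
    (hγ : ContDiffOn ℝ ∞ γ e.target) (hγ0 : ∀ y ∈ e.target, γ y ≠ 0)
    (hker : ∀ p ∈ e.source, ∀ v : TangentSpace 𝓘(ℝ, E3) p,
      v ∈ ξ p ↔ γ (e p) (chartD e p v) = 0) {m : M} (hm : m ∈ e.source)
    (hY : ∀ᶠ p in 𝓝 m, ContMDiffAt 𝓘(ℝ, E3) 𝓘(ℝ, E3).tangent ∞
      (fun x => (⟨x, Y x⟩ : TangentBundle 𝓘(ℝ, E3) M)) p) :
    PreservesNear ξ Y m ↔
      ∀ᶠ p in 𝓝 m, ∀ u, γ (e p) u = 0 → lieForm γ (vecInChart e Y) (e p) u = 0 := by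
  have key : ∀ p ∈ e.source, ContMDiffAt 𝓘(ℝ, E3) 𝓘(ℝ, E3).tangent ∞
      (fun x => (⟨x, Y x⟩ : TangentBundle 𝓘(ℝ, E3) M)) p →
      ((∀ Z : ∀ x : M, TangentSpace 𝓘(ℝ, E3) x,
        ContMDiffAt 𝓘(ℝ, E3) 𝓘(ℝ, E3).tangent ∞
          (fun x => (⟨x, Z x⟩ : TangentBundle 𝓘(ℝ, E3) M)) p →
        (∀ᶠ x in 𝓝 p, Z x ∈ ξ x) → VectorField.mlieBracket 𝓘(ℝ, E3) Y Z p ∈ ξ p) ↔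
      ∀ u, γ (e p) u = 0 → lieForm γ (vecInChart e Y) (e p) u = 0) := by
    intro p hp hYp
    have hy := e.map_source hp
    have hγp := hγ.contDiffAt (e.open_target.mem_nhds hy)
    have bracket : ∀ Z : ∀ x : M, TangentSpace 𝓘(ℝ, E3) x,
        ContMDiffAt 𝓘(ℝ, E3) 𝓘(ℝ, E3).tangent ∞
          (fun x => (⟨x, Z x⟩ : TangentBundle 𝓘(ℝ, E3) M)) p →
        (∀ᶠ z in 𝓝 (e p), γ z (vecInChart e Z z) = 0) →
        (VectorField.mlieBracket 𝓘(ℝ, E3) Y Z p ∈ ξ p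
          ↔ lieForm γ (vecInChart e Y) (e p) (vecInChart e Z (e p)) = 0) := by
      intro Z hZ hZξ
      rw [hker p hp, chartD_mlieBracket he hp hYp hZ, apply_lieBracket
        (hγp.differentiableAt (by simp))
        ((contDiffAt_vecInChart he hp hZ).differentiableAt (by simp)) hZξ, neg_eq_zero]
    constructor
    · intro h u hu
      obtain ⟨V, hV, hVu, hVγ⟩ := exists_section hγp (hγ0 _ hy) hu
      have hvec : ∀ x ∈ e.source, vecInChart e (fieldOfChart e V) (e x) = V (e x) := by
        intro x hx
        rw [vecInChart_apply e hx, chartD_fieldOfChart he hx]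
      have hsec : ∀ᶠ z in 𝓝 (e p), γ z (vecInChart e (fieldOfChart e V) z) = 0 := by
        filter_upwards [hVγ, e.open_target.mem_nhds hy] with z hz hzt
        have := hvec _ (e.map_target hzt)
        rw [e.right_inv hzt] at this
        rwa [this]
      have hZ := contMDiffAt_fieldOfChart he hp hV
      have h1 := (bracket _ hZ hsec).1 (h _ hZ ?_)
      · rwa [hvec p hp, hVu] at h1
      · filter_upwards [e.open_source.mem_nhds hp,
          (e.continuousAt hp).eventually hVγ] with x hx hxγ
        rw [hker x hx, chartD_fieldOfChart he hx]
        exact hxγ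
    · intro h Z hZ hZξ
      have hsec : ∀ᶠ z in 𝓝 (e p), γ z (vecInChart e Z z) = 0 := by
        have hc : ContinuousAt e.symm (e p) := e.symm.continuousAt hy
        rw [ContinuousAt, e.left_inv hp] at hc
        filter_upwards [hc.eventually hZξ, e.open_target.mem_nhds hy] with z hz hzt
        rw [hker _ (e.map_target hzt), e.right_inv hzt] at hz
        exact hz
      exact (bracket Z hZ hsec).2 (h _ hsec.self_of_nhds)
  constructor
  · intro h
    filter_upwards [h, hY, e.open_source.mem_nhds hm] with p h1 h2 h3 using (key p h3 h2).1 h1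
  · intro h
    filter_upwards [h, hY, e.open_source.mem_nhds hm] with p h1 h2 h3 using (key p h3 h2).2 h1

end LieBracket

/-! ### Symmetries in a generic chart -/

/-- The one-form `f dI + g dx`. -/
def coordForm (f g : E3 → ℝ) (y : E3) : E3 →L[ℝ] ℝ :=
  f y • (EuclideanSpace.proj (𝕜 := ℝ) (1 : Fin 3) : E3 →L[ℝ] ℝ)
    + g y • (EuclideanSpace.proj (𝕜 := ℝ) (0 : Fin 3) : E3 →L[ℝ] ℝ)

lemma coordForm_apply (f g : E3 → ℝ) (y u : E3) : coordForm f g y u = f y * u 1 + g y * u 0 := by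
  simp [coordForm]

lemma contDiffOn_coordForm {f g : E3 → ℝ} {s : Set E3} (hf : ContDiffOn ℝ ∞ f s)
    (hg : ContDiffOn ℝ ∞ g s) : ContDiffOn ℝ ∞ (coordForm f g) s :=
  (hf.smul contDiffOn_const).add (hg.smul contDiffOn_const)

lemma fderiv_coordForm {f g : E3 → ℝ} {y : E3} (hf : DifferentiableAt ℝ f y)
    (hg : DifferentiableAt ℝ g y) (v u : E3) :
    fderiv ℝ (coordForm f g) y v u = fderiv ℝ f y v * u 1 + fderiv ℝ g y v * u 0 := by
  have h : HasFDerivAt (coordForm f g) _ y :=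
    (hf.hasFDerivAt.smul_const (EuclideanSpace.proj (𝕜 := ℝ) (1 : Fin 3) : E3 →L[ℝ] ℝ)).add
      (hg.hasFDerivAt.smul_const (EuclideanSpace.proj (𝕜 := ℝ) (0 : Fin 3) : E3 →L[ℝ] ℝ))
  rw [h.fderiv]
  simp

lemma lieForm_coordForm {f g : E3 → ℝ} {V : E3 → E3} {y : E3} (hf : DifferentiableAt ℝ f y)
    (hg : DifferentiableAt ℝ g y) (u : E3) :
    lieForm (coordForm f g) V y u = fderiv ℝ f y (V y) * u 1 + fderiv ℝ g y (V y) * u 0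
      + (f y * fderiv ℝ V y u 1 + g y * fderiv ℝ V y u 0) := by
  rw [lieForm, fderiv_coordForm hf hg, coordForm_apply]

lemma fderiv_plane {B : ℝ × ℝ → ℝ} {y : E3} (hB : DifferentiableAt ℝ B (y 1, y 0)) (v : E3) :
    fderiv ℝ (fun z : E3 => B (z 1, z 0)) y v
      = v 1 * fderiv ℝ B (y 1, y 0) (1, 0) + v 0 * fderiv ℝ B (y 1, y 0) (0, 1) := by
  have h : HasFDerivAt (fun z : E3 => B (z 1, z 0)) _ y :=
    HasFDerivAt.comp y (f := planeProj) hB.hasFDerivAt planeProj.hasFDerivAt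
  have hv : planeProj v = v 1 • ((1 : ℝ), (0 : ℝ)) + v 0 • ((0 : ℝ), (1 : ℝ)) := by simp
  rw [h.fderiv, ContinuousLinearMap.comp_apply, hv, map_add, map_smul, map_smul]
  rfl

lemma differentiableAt_plane {B : ℝ × ℝ → ℝ} {y : E3} (hB : DifferentiableAt ℝ B (y 1, y 0)) :
    DifferentiableAt ℝ (fun z : E3 => B (z 1, z 0)) y :=
  DifferentiableAt.comp y (f := planeProj) hB planeProj.differentiableAt

/-- The form `dI - B J dx`, whose kernel is the first distribution. -/
def firstForm (B : ℝ × ℝ → ℝ) : E3 → E3 →L[ℝ] ℝ :=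
  coordForm (fun _ => 1) (fun y => -(B (y 1, y 0) * y 2))

/-- The form `(I ± J) dI + B dx`, whose kernel is the second distribution. -/
def secondForm (ε : ℝ) (B : ℝ × ℝ → ℝ) : E3 → E3 →L[ℝ] ℝ :=
  coordForm (fun y => y 1 + ε * y 2) (fun y => B (y 1, y 0))

section Pointwise

variable {ε : ℝ} {B : ℝ × ℝ → ℝ} {V : E3 → E3} {y : E3}

lemma lieForm_firstForm (hB : DifferentiableAt ℝ B (y 1, y 0)) (u : E3) :
    lieForm (firstForm B) V y u
      = -((V y 1 * fderiv ℝ B (y 1, y 0) (1, 0) + V y 0 * fderiv ℝ B (y 1, y 0) (0, 1)) * y 2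
          + B (y 1, y 0) * V y 2) * u 0
        + (fderiv ℝ V y u 1 - B (y 1, y 0) * y 2 * fderiv ℝ V y u 0) := by
  have hb := differentiableAt_plane hB
  have h2 : DifferentiableAt ℝ (fun z : E3 => z 2) y :=
    (contDiff_coord 2).contDiffAt.differentiableAt (by simp)
  rw [firstForm, lieForm_coordForm (differentiableAt_const _) (hb.fun_mul h2).fun_neg]
  have e : fderiv ℝ (fun z : E3 => -(B (z 1, z 0) * z 2)) y (V y)
      = -((V y 1 * fderiv ℝ B (y 1, y 0) (1, 0) + V y 0 * fderiv ℝ B (y 1, y 0) (0, 1)) * y 2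
          + B (y 1, y 0) * V y 2) := by
    rw [fderiv_fun_neg, fderiv_fun_mul hb h2]
    simp only [neg_apply, add_apply, smul_apply, smul_eq_mul, fderiv_plane hB, fderiv_coord_apply]
    ring
  rw [e, fderiv_fun_const]
  simp
  ring

lemma lieForm_secondForm (hB : DifferentiableAt ℝ B (y 1, y 0)) (u : E3) :
    lieForm (secondForm ε B) V y u
      = (V y 1 + ε * V y 2) * u 1
        + (V y 1 * fderiv ℝ B (y 1, y 0) (1, 0) + V y 0 * fderiv ℝ B (y 1, y 0) (0, 1)) * u 0
        + ((y 1 + ε * y 2) * fderiv ℝ V y u 1 + B (y 1, y 0) * fderiv ℝ V y u 0) := by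
  have hb := differentiableAt_plane hB
  have h1 : DifferentiableAt ℝ (fun z : E3 => z 1) y :=
    (contDiff_coord 1).contDiffAt.differentiableAt (by simp)
  have h2 : DifferentiableAt ℝ (fun z : E3 => z 2) y :=
    (contDiff_coord 2).contDiffAt.differentiableAt (by simp)
  rw [secondForm, lieForm_coordForm (h1.fun_add (h2.const_mul ε)) hb, fderiv_plane hB,
    fderiv_fun_add h1 (h2.const_mul ε), fderiv_const_mul h2]
  simp only [add_apply, smul_apply, smul_eq_mul, fderiv_coord_apply]

/-- The linear system for the first derivatives of a symmetry, as a polynomial in the third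
coordinate. -/
lemma symmetry_equations (hε : ε = 1 ∨ ε = -1) (hB : DifferentiableAt ℝ B (y 1, y 0))
    (hB0 : B (y 1, y 0) ≠ 0) (hD : 1 + y 1 * y 2 + ε * y 2 ^ 2 ≠ 0)
    (h₁ : ∀ u, firstForm B y u = 0 → lieForm (firstForm B) V y u = 0)
    (h₂ : ∀ u, secondForm ε B y u = 0 → lieForm (secondForm ε B) V y u = 0) :
    fderiv ℝ V y (stdVec 2) 0 = 0 ∧ fderiv ℝ V y (stdVec 2) 1 = 0 ∧
    ∀ T : ℝ, T = V y 1 * fderiv ℝ B (y 1, y 0) (1, 0) + V y 0 * fderiv ℝ B (y 1, y 0) (0, 1)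
        - B (y 1, y 0) * fderiv ℝ V y (stdVec 1) 1
        + B (y 1, y 0) * fderiv ℝ V y (stdVec 0) 0 →
      B (y 1, y 0) * V y 2 = fderiv ℝ V y (stdVec 0) 1 - y 2 * T
        - y 2 ^ 2 * B (y 1, y 0) ^ 2 * fderiv ℝ V y (stdVec 1) 0 ∧
      (V y 1 * B (y 1, y 0) + ε * fderiv ℝ V y (stdVec 0) 1 - y 1 * T
          - y 1 ^ 2 * fderiv ℝ V y (stdVec 0) 1 + B (y 1, y 0) ^ 2 * fderiv ℝ V y (stdVec 1) 0)
        + -2 * ε * (T + y 1 * fderiv ℝ V y (stdVec 0) 1) * y 2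
        + -(ε * B (y 1, y 0) ^ 2 * fderiv ℝ V y (stdVec 1) 0 + fderiv ℝ V y (stdVec 0) 1) * y 2 ^ 2
        = 0 := by
  have hεε : ε * ε = 1 := by rcases hε with rfl | rfl <;> norm_num
  -- The vector ∂_J lies in both planes; the other spanning vectors are ∂_x + BJ ∂_I for the first
  -- plane and B ∂_I − (I + εJ) ∂_x for the second.
  have e1 := h₁ (stdVec 2) (by simp [firstForm, coordForm_apply])
  have e2 := h₁ (stdVec 0 + (B (y 1, y 0) * y 2) • stdVec 1)
    (by simp [firstForm, coordForm_apply])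
  have e3 := h₂ (stdVec 2) (by simp [secondForm, coordForm_apply])
  have e4 := h₂ (B (y 1, y 0) • stdVec 1 - (y 1 + ε * y 2) • stdVec 0)
    (by simp [secondForm, coordForm_apply]; ring)
  rw [lieForm_firstForm hB] at e1 e2
  rw [lieForm_secondForm hB] at e3 e4
  simp only [map_add, map_sub, map_smul, PiLp.add_apply, PiLp.sub_apply, PiLp.smul_apply,
    smul_eq_mul, stdVec_apply] at e1 e2 e3 e4
  norm_num [show (0 : Fin 3) ≠ 2 by decide, show (1 : Fin 3) ≠ 2 by decide] at e1 e2 e3 e4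
  generalize fderiv ℝ V y (stdVec 0) 0 = A00 at *
  generalize fderiv ℝ V y (stdVec 0) 1 = A10 at *
  generalize fderiv ℝ V y (stdVec 1) 0 = A01 at *
  generalize fderiv ℝ V y (stdVec 1) 1 = A11 at *
  generalize fderiv ℝ V y (stdVec 2) 0 = A02 at *
  generalize fderiv ℝ V y (stdVec 2) 1 = A12 at *
  generalize fderiv ℝ B (y 1, y 0) (1, 0) = P at *
  generalize fderiv ℝ B (y 1, y 0) (0, 1) = Q at *
  generalize B (y 1, y 0) = b at *
  -- The conditions on ∂_J form a linear system with determinant DB for the J-derivatives of the x-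
  -- and I-components: a symmetry preserves the axis.
  have h02 : A02 = 0 := by
    have : ((1 + y 1 * y 2 + ε * y 2 ^ 2) * b) * A02 = 0 := by
      linear_combination e3 - (y 1 + ε * y 2) * e1
    exact (mul_eq_zero.1 this).resolve_left (mul_ne_zero hD hB0)
  have h12 : A12 = 0 := by
    rw [h02] at e1
    linarith
  refine ⟨h02, h12, fun T hT => ?_⟩
  -- The first plane determines the J-component. Inserted into the condition for the second plane,
  -- it leaves a polynomial of degree two in J.
  have hV2 : b * V y 2 = A10 - y 2 * T - y 2 ^ 2 * b ^ 2 * A01 := by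
    rw [hT]
    linear_combination -e2
  refine ⟨hV2, ?_⟩
  rw [hT] at hV2 ⊢
  linear_combination e4 - ε * hV2 + A10 * y 2 ^ 2 * hεε

/-- A field along the first axis with the right coefficient is an infinitesimal symmetry. -/
lemma lieForm_eq_zero (hB : DifferentiableAt ℝ B (y 1, y 0)) (hV1 : V y 1 = 0) (hV2 : V y 2 = 0)
    (h1 : ∀ u, fderiv ℝ V y u 1 = 0) {c : ℝ} (h0 : ∀ u, fderiv ℝ V y u 0 = c * u 0)
    (hc : V y 0 * fderiv ℝ B (y 1, y 0) (0, 1) + B (y 1, y 0) * c = 0) (u : E3) :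
    lieForm (firstForm B) V y u = 0 ∧ lieForm (secondForm ε B) V y u = 0 := by
  rw [lieForm_firstForm hB, lieForm_secondForm hB, hV1, hV2, h1, h0]
  constructor
  · linear_combination -(u 0 * y 2) * hc
  · linear_combination u 0 * hc

end Pointwise

/-- Evaluate at t and t ± r/2; the second and the first difference isolate p₂ and p₁. -/
lemma quadratic_coefficients_eq_zero {p₀ p₁ p₂ t : ℝ}
    (h : ∀ᶠ δ in 𝓝 (0 : ℝ), p₀ + p₁ * (t + δ) + p₂ * (t + δ) ^ 2 = 0) :
    p₀ = 0 ∧ p₁ = 0 ∧ p₂ = 0 := by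
  obtain ⟨r, hr, h1⟩ := Metric.eventually_nhds_iff.1 h
  have e0 := h1 (y := 0) (by simpa using hr)
  have e1 := h1 (y := r / 2) (by simp [abs_of_pos hr]; linarith)
  have e2 := h1 (y := -(r / 2)) (by simp [abs_of_pos hr]; linarith)
  have hp2 : p₂ = 0 := by
    have : r ^ 2 * p₂ = 0 := by linear_combination 2 * e1 + 2 * e2 - 4 * e0
    exact (mul_eq_zero.1 this).resolve_left (pow_ne_zero 2 hr.ne')
  have hp1 : p₁ = 0 := by
    have : r * p₁ = 0 := by rw [hp2] at e1 e2; linear_combination e1 - e2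
    exact (mul_eq_zero.1 this).resolve_left hr.ne'
  exact ⟨by simpa [hp1, hp2] using e0, hp1, hp2⟩

/-- If the third partial derivative of `f` vanishes on a convex open set, then `f` and its
derivative are invariant under translations along the third axis. -/
lemma translate_third {s : Set E3} (hs : Convex ℝ s) (hso : IsOpen s) {f : E3 → ℝ}
    (hf : DifferentiableOn ℝ f s) (h : ∀ z ∈ s, fderiv ℝ f z (stdVec 2) = 0) {y : E3} {δ : ℝ}
    (hy : y ∈ s) (hδ : y + δ • stdVec 2 ∈ s) :
    f (y + δ • stdVec 2) = f y ∧ fderiv ℝ f (y + δ • stdVec 2) = fderiv ℝ f y := by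
  have key : ∀ z ∈ s, z + δ • stdVec 2 ∈ s → f (z + δ • stdVec 2) = f z := fun z hz hz' =>
    eq_of_fderiv_direction_eq_zero hs hso hf hz' hz fun w hw => by
      rw [add_sub_cancel_left, map_smul, h w hw, smul_zero]
  refine ⟨key y hy hδ, ?_⟩
  have hc : Continuous fun z : E3 => z + δ • stdVec 2 := by fun_prop
  have e : (fun z => f (z + δ • stdVec 2)) =ᶠ[𝓝 y] f := by
    filter_upwards [hso.mem_nhds hy, hc.continuousAt.preimage_mem_nhds (hso.mem_nhds hδ)]
      with z hz hz' using key z hz hz'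
  rw [← e.fderiv_eq, fderiv_comp_add_right]

/-- The fields `c ∂_x` with `c` a function of `x` and `c B` independent of `x`. -/
structure IsReducedField (B : ℝ × ℝ → ℝ) (V : E3 → E3) (s : Set E3) : Prop where
  smooth : ContDiffOn ℝ ∞ V s
  second : ∀ y ∈ s, V y 1 = 0
  third : ∀ y ∈ s, V y 2 = 0
  fderiv_second : ∀ y ∈ s, fderiv ℝ V y (stdVec 1) 0 = 0
  fderiv_third : ∀ y ∈ s, fderiv ℝ V y (stdVec 2) 0 = 0
  fderiv_first : ∀ y ∈ s,
    V y 0 * fderiv ℝ B (y 1, y 0) (0, 1) + B (y 1, y 0) * fderiv ℝ V y (stdVec 0) 0 = 0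

/-- The x- and I-components V₀, V₁, their derivatives and T are unchanged by translation in J, so
the quadratic of `symmetry_equations` vanishes coefficient by coefficient. Its top coefficients give
T = −I ∂_x V₁ and ∂_x V₁ = −εB² ∂_I V₀; inserted into the constant term they leave B V₁ = 0. With V₁
= 0 the other conditions follow in turn. -/
theorem isReducedField_of_symmetry {ε : ℝ} (hε : ε = 1 ∨ ε = -1) {B : ℝ × ℝ → ℝ} {V : E3 → E3}
    {s : Set E3} (hs : Convex ℝ s) (hso : IsOpen s) (hV : ContDiffOn ℝ ∞ V s)
    (hB : ∀ y ∈ s, DifferentiableAt ℝ B (y 1, y 0)) (hB0 : ∀ y ∈ s, B (y 1, y 0) ≠ 0)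
    (hD : ∀ y ∈ s, 1 + y 1 * y 2 + ε * y 2 ^ 2 ≠ 0)
    (h₁ : ∀ y ∈ s, ∀ u, firstForm B y u = 0 → lieForm (firstForm B) V y u = 0)
    (h₂ : ∀ y ∈ s, ∀ u, secondForm ε B y u = 0 → lieForm (secondForm ε B) V y u = 0) :
    IsReducedField B V s := by
  have hεε : ε * ε = 1 := by rcases hε with rfl | rfl <;> norm_num
  have eqs := fun y hy => symmetry_equations hε (hB y hy) (hB0 y hy) (hD y hy) (h₁ y hy) (h₂ y hy)
  have hVd : ∀ y ∈ s, DifferentiableAt ℝ V y := fun y hy =>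
    (hV.contDiffAt (hso.mem_nhds hy)).differentiableAt (by simp)
  have hfd : ∀ y ∈ s, ∀ i v, fderiv ℝ V y v i = fderiv ℝ (fun z => V z i) y v := fun y hy i v =>
    (fderiv_coord (hVd y hy) i v).symm
  have hdiff : ∀ i, DifferentiableOn ℝ (fun z => V z i) s := fun i y hy =>
    (((contDiff_coord i).contDiffAt.comp y (hV.contDiffAt (hso.mem_nhds hy))).differentiableAt
      (by simp)).differentiableWithinAt
  have coeff : ∀ y ∈ s, ∀ T : ℝ,
      T = V y 1 * fderiv ℝ B (y 1, y 0) (1, 0) + V y 0 * fderiv ℝ B (y 1, y 0) (0, 1)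
        - B (y 1, y 0) * fderiv ℝ V y (stdVec 1) 1
        + B (y 1, y 0) * fderiv ℝ V y (stdVec 0) 0 →
      (V y 1 * B (y 1, y 0) + ε * fderiv ℝ V y (stdVec 0) 1 - y 1 * T
          - y 1 ^ 2 * fderiv ℝ V y (stdVec 0) 1 + B (y 1, y 0) ^ 2 * fderiv ℝ V y (stdVec 1) 0)
        = 0 ∧ -2 * ε * (T + y 1 * fderiv ℝ V y (stdVec 0) 1) = 0 ∧
        -(ε * B (y 1, y 0) ^ 2 * fderiv ℝ V y (stdVec 1) 0 + fderiv ℝ V y (stdVec 0) 1) = 0 := by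
    intro y hy T hT
    refine quadratic_coefficients_eq_zero (t := y 2) ?_
    have hc : Continuous fun δ : ℝ => y + δ • stdVec 2 := by fun_prop
    filter_upwards [hc.continuousAt.preimage_mem_nhds (x := (0 : ℝ))
      (hso.mem_nhds (by simpa using hy))] with δ hδ'
    have hδ : y + δ • stdVec 2 ∈ s := hδ'
    have t0 := translate_third hs hso (hdiff 0)
      (fun z hz => by rw [← hfd z hz]; exact (eqs z hz).1) hy hδ
    have t1 := translate_third hs hso (hdiff 1)
      (fun z hz => by rw [← hfd z hz]; exact (eqs z hz).2.1) hy hδ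
    have f0 : ∀ v, fderiv ℝ V (y + δ • stdVec 2) v 0 = fderiv ℝ V y v 0 := fun v => by
      rw [hfd _ hδ, hfd _ hy, t0.2]
    have f1 : ∀ v, fderiv ℝ V (y + δ • stdVec 2) v 1 = fderiv ℝ V y v 1 := fun v => by
      rw [hfd _ hδ, hfd _ hy, t1.2]
    have g0 : (y + δ • stdVec 2) 0 = y 0 := by simp
    have g1 : (y + δ • stdVec 2) 1 = y 1 := by simp
    have g2 : (y + δ • stdVec 2) 2 = y 2 + δ := by simp
    have e := (eqs _ hδ).2.2 T (by rw [g0, g1, t0.1, t1.1, f0, f1]; exact hT)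
    simp only [g0, g1, g2, t1.1, f0, f1] at e
    exact e.2
  have hV1 : ∀ y ∈ s, V y 1 = 0 := by
    intro y hy
    obtain ⟨e0, e1, e2⟩ := coeff y hy _ rfl
    have hε0 : ε ≠ 0 := by rintro rfl; simp at hεε
    have hT := (mul_eq_zero.1 e1).resolve_left (by simpa using hε0)
    have h3 : V y 1 * B (y 1, y 0) = 0 := by
      linear_combination e0 + y 1 * hT + ε * e2
        + B (y 1, y 0) ^ 2 * fderiv ℝ V y (stdVec 1) 0 * hεε
    exact (mul_eq_zero.1 h3).resolve_right (hB0 y hy)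
  have hV1' : ∀ y ∈ s, ∀ v, fderiv ℝ V y v 1 = 0 := by
    intro y hy v
    have e : (fun z => V z 1) =ᶠ[𝓝 y] fun _ => (0 : ℝ) := by
      filter_upwards [hso.mem_nhds hy] with z hz using hV1 z hz
    rw [hfd y hy, e.fderiv_eq, fderiv_fun_const]
    rfl
  have h01 : ∀ y ∈ s, fderiv ℝ V y (stdVec 1) 0 = 0 := by
    intro y hy
    obtain ⟨-, -, e2⟩ := coeff y hy _ rfl
    have hε0 : ε ≠ 0 := by rintro rfl; simp at hεε
    rw [hV1' y hy, add_zero, neg_eq_zero] at e2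
    exact (mul_eq_zero.1 e2).resolve_left (mul_ne_zero hε0 (pow_ne_zero 2 (hB0 y hy)))
  have hT : ∀ y ∈ s, V y 0 * fderiv ℝ B (y 1, y 0) (0, 1)
      + B (y 1, y 0) * fderiv ℝ V y (stdVec 0) 0 = 0 := by
    intro y hy
    obtain ⟨-, e1, -⟩ := coeff y hy _ rfl
    have hε0 : ε ≠ 0 := by rintro rfl; simp at hεε
    have h1 := (mul_eq_zero.1 e1).resolve_left (by simpa using hε0)
    rw [hV1' y hy, hV1' y hy, hV1 y hy] at h1
    linear_combination h1
  refine ⟨hV, hV1, fun y hy => ?_, h01, fun y hy => (eqs y hy).1, hT⟩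
  obtain ⟨e1, -⟩ := (eqs y hy).2.2 _ rfl
  rw [hV1' y hy, hV1' y hy, hV1 y hy, h01 y hy] at e1
  have h3 : B (y 1, y 0) * V y 2 = 0 := by linear_combination e1 - y 2 * hT y hy
  exact (mul_eq_zero.1 h3).resolve_left (hB0 y hy)

/-! ### Separability and the number of symmetries -/

lemma point_first_mem_ball {z y : E3} {r : ℝ} (hy : y ∈ Metric.ball z r) :
    point (y 0) (z 1) (z 2) ∈ Metric.ball z r := by
  refine lt_of_le_of_lt ?_ (Metric.mem_ball.1 hy)
  rw [EuclideanSpace.dist_eq, EuclideanSpace.dist_eq]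
  refine Real.sqrt_le_sqrt ?_
  simp only [Fin.sum_univ_three, point_zero, point_one, point_two, dist_self]
  have := sq_nonneg (dist (y 2) (z 2))
  have := sq_nonneg (dist (y 1) (z 1))
  linarith

/-- The x-component depends on x alone, and its product with B has zero x-derivative on the line
through the centre z. So the field is determined by its value at z. -/
lemma IsReducedField.mul_eq {B : ℝ × ℝ → ℝ} {V : E3 → E3} {z : E3} {r : ℝ}
    (h : IsReducedField B V (Metric.ball z r))
    (hB : ∀ y ∈ Metric.ball z r, DifferentiableAt ℝ B (y 1, y 0)) {y : E3}
    (hy : y ∈ Metric.ball z r) :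
    V y 0 * B (z 1, y 0) = V z 0 * B (z 1, z 0) := by
  have hVd : ∀ y ∈ Metric.ball z r, DifferentiableAt ℝ V y := fun y hy =>
    (h.smooth.contDiffAt (Metric.isOpen_ball.mem_nhds hy)).differentiableAt (by simp)
  have hc : ∀ y ∈ Metric.ball z r, DifferentiableAt ℝ (fun w => V w 0) y := fun y hy =>
    ((contDiff_coord 0).contDiffAt.differentiableAt (by simp)).comp y (hVd y hy)
  have hz : z ∈ Metric.ball z r :=
    Metric.mem_ball_self (lt_of_le_of_lt dist_nonneg (Metric.mem_ball.1 hy))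
  have hy' := point_first_mem_ball hy
  have e1 : V y 0 = V (point (y 0) (z 1) (z 2)) 0 := by
    refine eq_of_fderiv_direction_eq_zero (b := fun w => V w 0) (convex_ball z r)
      Metric.isOpen_ball (fun w hw => (hc w hw).differentiableWithinAt) hy hy' fun w hw => ?_
    have hd : y - point (y 0) (z 1) (z 2)
        = (y 1 - z 1) • stdVec 1 + (y 2 - z 2) • stdVec 2 := by
      ext i
      fin_cases i <;> simp
    rw [hd, map_add, map_smul, map_smul, fderiv_coord (hVd w hw), fderiv_coord (hVd w hw),
      h.fderiv_second w hw, h.fderiv_third w hw]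
    simp
  have e2 : V (point (y 0) (z 1) (z 2)) 0 * B (z 1, y 0) = V z 0 * B (z 1, z 0) := by
    refine eq_of_fderiv_direction_eq_zero (b := fun w => V w 0 * B (w 1, w 0)) (convex_ball z r)
      Metric.isOpen_ball
      (fun w hw => ((hc w hw).fun_mul (differentiableAt_plane (hB w hw))).differentiableWithinAt)
      hy' hz fun w hw => ?_
    have hd : point (y 0) (z 1) (z 2) - z = (y 0 - z 0) • stdVec 0 := by
      ext i
      fin_cases i <;> simp
    have hf := h.fderiv_first w hw
    rw [hd, map_smul, fderiv_fun_mul (hc w hw) (differentiableAt_plane (hB w hw))]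
    simp only [add_apply, smul_apply, smul_eq_mul, fderiv_plane (hB w hw),
      fderiv_coord (hVd w hw)]
    have s0 : stdVec 0 0 = 1 := by simp
    have s1 : stdVec 0 1 = 0 := by simp
    rw [s0, s1]
    linear_combination (y 0 - z 0) * hf
  rw [e1, e2]

/-- The derivative of `log B` with respect to the second variable. -/
def logSlope (B : ℝ × ℝ → ℝ) (w : ℝ × ℝ) : ℝ := fderiv ℝ B w (0, 1) / B w

lemma deriv_second {B : ℝ × ℝ → ℝ} {s t : ℝ} (hB : DifferentiableAt ℝ B (s, t)) :
    HasDerivAt (fun t => B (s, t)) (fderiv ℝ B (s, t) (0, 1)) t :=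
  hB.hasFDerivAt.comp_hasDerivAt t ((hasDerivAt_const t s).prodMk (hasDerivAt_id t))

lemma deriv_first {B : ℝ × ℝ → ℝ} {s t : ℝ} (hB : DifferentiableAt ℝ B (s, t)) :
    HasDerivAt (fun s => B (s, t)) (fderiv ℝ B (s, t) (1, 0)) s :=
  hB.hasFDerivAt.comp_hasDerivAt s ((hasDerivAt_id s).prodMk (hasDerivAt_const s t))

lemma deriv_log_second {B : ℝ × ℝ → ℝ} {s t : ℝ} (hB : DifferentiableAt ℝ B (s, t))
    (h0 : B (s, t) ≠ 0) : deriv (fun t => Real.log (B (s, t))) t = logSlope B (s, t) :=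
  ((deriv_second hB).log h0).deriv

section Plane

variable {Ω : Set (ℝ × ℝ)} {B : ℝ × ℝ → ℝ}

lemma contDiffOn_logSlope (hΩ : IsOpen Ω) (hB : ContDiffOn ℝ ∞ B Ω) (h0 : ∀ w ∈ Ω, 0 < B w) :
    ContDiffOn ℝ ∞ (logSlope B) Ω :=
  ((hB.fderiv_of_isOpen hΩ (by simp)).clm_apply contDiffOn_const).div hB fun w hw => (h0 w hw).ne'

lemma deriv_deriv_log (hΩ : IsOpen Ω) (hB : ContDiffOn ℝ ∞ B Ω) (h0 : ∀ w ∈ Ω, 0 < B w)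
    {w : ℝ × ℝ} (hw : w ∈ Ω) :
    deriv (fun s => deriv (fun t => Real.log (B (s, t))) w.2) w.1
      = deriv (fun s => logSlope B (s, w.2)) w.1 := by
  refine Filter.EventuallyEq.deriv_eq ?_
  have hc : Continuous fun s : ℝ => (s, w.2) := by fun_prop
  filter_upwards [hc.continuousAt.preimage_mem_nhds (x := w.1) (hΩ.mem_nhds hw)] with s hs
  exact deriv_log_second ((hB.contDiffAt (hΩ.mem_nhds hs)).differentiableAt (by simp))
    (h0 _ hs).ne'

/-- A ball of the plane in the max metric is a square, so it contains the segments in the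
I-direction along which the slope ∂_x log B is constant. -/
lemma isSeparableNear_iff (hΩ : IsOpen Ω) (hB : ContDiffOn ℝ ∞ B Ω) (h0 : ∀ w ∈ Ω, 0 < B w)
    {z : ℝ × ℝ} (hz : z ∈ Ω) :
    IsSeparableNear B z ↔ ∀ᶠ w in 𝓝 z, logSlope B w = logSlope B (z.1, w.2) := by
  constructor
  · intro h
    obtain ⟨r, hr, hball⟩ := Metric.eventually_nhds_iff_ball.1
      (Filter.Eventually.and h (hΩ.eventually_mem hz))
    filter_upwards [Metric.ball_mem_nhds z hr] with w hw
    rw [Metric.mem_ball, Prod.dist_eq, max_lt_iff] at hw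
    have hmem : ∀ s ∈ Metric.ball z.1 r, (s, w.2) ∈ Metric.ball z r := by
      intro s hs
      rw [Metric.mem_ball, Prod.dist_eq]
      exact max_lt hs hw.2
    refine Metric.isOpen_ball.is_const_of_deriv_eq_zero (𝕜 := ℝ)
      (f := fun s => logSlope B (s, w.2)) (convex_ball z.1 r).isPreconnected ?_ ?_
      (x := w.1) hw.1 (Metric.mem_ball_self hr)
    · intro s hs
      have h1 := (contDiffOn_logSlope hΩ hB h0).contDiffAt (hΩ.mem_nhds (hball _ (hmem s hs)).2)
      exact (deriv_first (h1.differentiableAt (by simp))).differentiableAt.differentiableWithinAt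
    · intro s hs
      have h1 := hball _ (hmem s hs)
      have h2 := deriv_deriv_log hΩ hB h0 h1.2
      exact h2.symm.trans h1.1
  · intro h
    filter_upwards [h.eventually_nhds, hΩ.eventually_mem hz] with w hw hwΩ
    rw [deriv_deriv_log hΩ hB h0 hwΩ]
    have hc : Continuous fun s : ℝ => (s, w.2) := by fun_prop
    have e : (fun s => logSlope B (s, w.2)) =ᶠ[𝓝 w.1] fun _ => logSlope B (z.1, w.2) :=
      (hc.continuousAt (x := w.1)).eventually hw
    rw [e.deriv_eq, deriv_const]

end Plane

/-! ### Symmetries of a pair in generic normal form. -/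

section Charts

variable {M : Type*} [TopologicalSpace M] [ChartedSpace E3 M] [IsManifold 𝓘(ℝ, E3) ∞ M]
  {ξ ξ' : ∀ m : M, Submodule ℝ (TangentSpace 𝓘(ℝ, E3) m)} {ε : ℝ}
  {X Y : ∀ m : M, TangentSpace 𝓘(ℝ, E3) m} {I J : M → ℝ} {e : OpenPartialHomeomorph M E3}
  {B : ℝ × ℝ → ℝ} {m : M}

lemma eventually_chart (hm : m ∈ e.source) {P : E3 → Prop} :
    (∀ᶠ p in 𝓝 m, P (e p)) ↔ ∀ᶠ y in 𝓝 (e m), P y := by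
  rw [← e.map_nhds_eq hm, Filter.eventually_map]

namespace IsGenericNormalForm

lemma isOpen_plane (_h : IsGenericNormalForm ξ ξ' ε I J m e B) :
    IsOpen ((fun y : E3 => (y 1, y 0)) '' e.target) := isOpenMap_planeProj _ e.open_target

lemma pos_target (h : IsGenericNormalForm ξ ξ' ε I J m e B) {y : E3} (hy : y ∈ e.target) :
    0 < B (y 1, y 0) := by
  have hp := e.map_target hy
  have := h.2.2.2.1 _ hp
  rwa [← (h.2.1 _ hp).1, e.right_inv hy] at this

lemma pos_plane (h : IsGenericNormalForm ξ ξ' ε I J m e B) :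
    ∀ w ∈ (fun y : E3 => (y 1, y 0)) '' e.target, 0 < B w := by
  rintro _ ⟨y, hy, rfl⟩
  exact h.pos_target hy

lemma contDiffAt_plane (h : IsGenericNormalForm ξ ξ' ε I J m e B) {y : E3} (hy : y ∈ e.target) :
    ContDiffAt ℝ ∞ B (y 1, y 0) :=
  h.2.2.1.contDiffAt (h.isOpen_plane.mem_nhds ⟨y, hy, rfl⟩)

lemma differentiableAt_plane (h : IsGenericNormalForm ξ ξ' ε I J m e B) {y : E3}
    (hy : y ∈ e.target) : DifferentiableAt ℝ B (y 1, y 0) :=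
  (h.contDiffAt_plane hy).differentiableAt (by simp)

lemma contDiffOn_coefficient (h : IsGenericNormalForm ξ ξ' ε I J m e B) :
    ContDiffOn ℝ ∞ (fun y : E3 => B (y 1, y 0)) e.target :=
  h.2.2.1.comp ((contDiff_coord 1).prodMk (contDiff_coord 0)).contDiffOn
    fun _ hy => Set.mem_image_of_mem _ hy

lemma contDiffOn_firstForm (h : IsGenericNormalForm ξ ξ' ε I J m e B) :
    ContDiffOn ℝ ∞ (firstForm B) e.target :=
  contDiffOn_coordForm contDiffOn_const
    (h.contDiffOn_coefficient.mul (contDiff_coord 2).contDiffOn).neg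

lemma contDiffOn_secondForm (h : IsGenericNormalForm ξ ξ' ε I J m e B) :
    ContDiffOn ℝ ∞ (secondForm ε B) e.target :=
  contDiffOn_coordForm ((contDiff_coord 1).contDiffOn.add
    (contDiffOn_const.mul (contDiff_coord 2).contDiffOn)) h.contDiffOn_coefficient

lemma isSymmetryNear_iff (h : IsGenericNormalForm ξ ξ' ε I J m e B) :
    IsSymmetryNear ξ ξ' Y m ↔
      (∀ᶠ p in 𝓝 m, ContMDiffAt 𝓘(ℝ, E3) 𝓘(ℝ, E3).tangent ∞
        (fun x => (⟨x, Y x⟩ : TangentBundle 𝓘(ℝ, E3) M)) p) ∧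
      (∀ᶠ y in 𝓝 (e m), ∀ u, firstForm B y u = 0 →
        lieForm (firstForm B) (vecInChart e Y) y u = 0) ∧
      ∀ᶠ y in 𝓝 (e m), ∀ u, secondForm ε B y u = 0 →
        lieForm (secondForm ε B) (vecInChart e Y) y u = 0 := by
  have hm := h.1.2
  refine and_congr_right fun hY => ?_
  rw [preservesNear_iff h.1.1 h.contDiffOn_firstForm ?_ ?_ hm hY,
    preservesNear_iff h.1.1 h.contDiffOn_secondForm ?_ ?_ hm hY]
  · exact and_congr
      (eventually_chart (P := fun y => ∀ u, firstForm B y u = 0 →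
        lieForm (firstForm B) (vecInChart e Y) y u = 0) hm)
      (eventually_chart (P := fun y => ∀ u, secondForm ε B y u = 0 →
        lieForm (secondForm ε B) (vecInChart e Y) y u = 0) hm)
  · intro y hy h0
    have := congrArg (fun L => L (stdVec 0)) h0
    simp [secondForm, coordForm_apply, (h.pos_target hy).ne'] at this
  · intro p hp v
    rw [h.2.2.2.2.2 p hp, secondForm, coordForm_apply, (h.2.1 p hp).1, (h.2.1 p hp).2]
  · intro y hy h0
    have := congrArg (fun L => L (stdVec 1)) h0
    simp [firstForm, coordForm_apply] at this
  · intro p hp v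
    rw [h.2.2.2.2.1 p hp, firstForm, coordForm_apply, (h.2.1 p hp).1, (h.2.1 p hp).2, one_mul,
      neg_mul, ← sub_eq_add_neg, sub_eq_zero]

lemma exists_isReducedField (h : IsGenericNormalForm ξ ξ' ε I J m e B) (hε : ε = 1 ∨ ε = -1)
    (hD : ∀ p : M, 1 + I p * J p + ε * J p ^ 2 ≠ 0) (hY : IsSymmetryNear ξ ξ' Y m) :
    ∃ r : ℝ, 0 < r ∧ Metric.ball (e m) r ⊆ e.target ∧
      IsReducedField B (vecInChart e Y) (Metric.ball (e m) r) := by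
  have hm := h.1.2
  obtain ⟨h0, h1, h2⟩ := h.isSymmetryNear_iff.1 hY
  have h0' : ∀ᶠ p in 𝓝 m, ContDiffAt ℝ ∞ (vecInChart e Y) (e p) := by
    filter_upwards [h0, e.open_source.mem_nhds hm] with p hp hps
      using contDiffAt_vecInChart h.1.1 hps hp
  rw [eventually_chart (P := fun y => ContDiffAt ℝ ∞ (vecInChart e Y) y) hm] at h0'
  obtain ⟨r, hr, hball⟩ := Metric.eventually_nhds_iff_ball.1
    (h0'.and (h1.and (h2.and (e.open_target.eventually_mem (e.map_source hm)))))
  refine ⟨r, hr, fun y hy => (hball y hy).2.2.2, ?_⟩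
  refine isReducedField_of_symmetry hε (convex_ball _ _) Metric.isOpen_ball
    (fun y hy => (hball y hy).1.contDiffWithinAt)
    (fun y hy => h.differentiableAt_plane (hball y hy).2.2.2)
    (fun y hy => (h.pos_target (hball y hy).2.2.2).ne') (fun y hy => ?_)
    (fun y hy => (hball y hy).2.1) (fun y hy => (hball y hy).2.2.1)
  have hyt := (hball y hy).2.2.2
  have h3 := h.2.1 _ (e.map_target hyt)
  rw [e.right_inv hyt] at h3
  rw [h3.1, h3.2]
  exact hD _

lemma isSymmetryNear_of_isReducedField (h : IsGenericNormalForm ξ ξ' ε I J m e B) {V : E3 → E3}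
    {s : Set E3} (hs : IsOpen s) (hms : e m ∈ s) (hV : IsReducedField B V s) :
    IsSymmetryNear ξ ξ' (fieldOfChart e V) m := by
  have hm := h.1.2
  have hst : ∀ᶠ y in 𝓝 (e m), y ∈ s ∧ y ∈ e.target :=
    (hs.eventually_mem hms).and (e.open_target.eventually_mem (e.map_source hm))
  have hvec : Set.EqOn (vecInChart e (fieldOfChart e V)) V e.target := by
    intro y hy
    have hp := e.map_target hy
    rw [← e.right_inv hy, vecInChart_apply e hp, chartD_fieldOfChart h.1.1 hp]
  have key : ∀ y, y ∈ s → y ∈ e.target → ∀ u,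
      lieForm (firstForm B) (vecInChart e (fieldOfChart e V)) y u = 0 ∧
      lieForm (secondForm ε B) (vecInChart e (fieldOfChart e V)) y u = 0 := by
    intro y hys hyt u
    have ev : vecInChart e (fieldOfChart e V) =ᶠ[𝓝 y] V := by
      filter_upwards [e.open_target.mem_nhds hyt] with z hz using hvec hz
    have hd : DifferentiableAt ℝ V y :=
      (hV.smooth.contDiffAt (hs.mem_nhds hys)).differentiableAt (by simp)
    have e1 : (fun z => V z 1) =ᶠ[𝓝 y] fun _ => (0 : ℝ) := by
      filter_upwards [hs.mem_nhds hys] with z hz using hV.second z hz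
    refine lieForm_eq_zero (h.differentiableAt_plane hyt)
      (by rw [hvec hyt]; exact hV.second y hys) (by rw [hvec hyt]; exact hV.third y hys)
      (fun v => ?_) (c := fderiv ℝ V y (stdVec 0) 0) (fun v => ?_) ?_ u
    · rw [ev.fderiv_eq, ← fderiv_coord hd, e1.fderiv_eq, fderiv_fun_const]
      rfl
    · rw [ev.fderiv_eq]
      conv_lhs => rw [eq_sum_stdVec v]
      simp only [map_add, map_smul, PiLp.add_apply, PiLp.smul_apply, smul_eq_mul,
        hV.fderiv_second y hys, hV.fderiv_third y hys]
      ring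
    · rw [hvec hyt]
      exact hV.fderiv_first y hys
  refine h.isSymmetryNear_iff.2 ⟨?_, ?_, ?_⟩
  · have := (eventually_chart hm).2 hst
    filter_upwards [this, e.open_source.mem_nhds hm] with p hp hps
      using contMDiffAt_fieldOfChart h.1.1 hps (hV.smooth.contDiffAt (hs.mem_nhds hp.1))
  · filter_upwards [hst] with y hy u _ using (key y hy.1 hy.2 u).1
  · filter_upwards [hst] with y hy u _ using (key y hy.1 hy.2 u).2

end IsGenericNormalForm

end Charts

/-- The component c = V₀ is non-zero on the whole ball, as c B(I₀, x) is a non-zero constant.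
Differentiating this constant in x and comparing with ∂_x(cB) = 0 at the actual value of I shows
that both slopes equal −c'/c. -/
lemma IsReducedField.logSlope_eq {B : ℝ × ℝ → ℝ} {V : E3 → E3} {z : E3} {r : ℝ}
    (h : IsReducedField B V (Metric.ball z r))
    (hB : ∀ y ∈ Metric.ball z r, DifferentiableAt ℝ B (y 1, y 0))
    (hB0 : ∀ y ∈ Metric.ball z r, B (y 1, y 0) ≠ 0) (hz : V z 0 ≠ 0) {y : E3}
    (hy : y ∈ Metric.ball z r) : logSlope B (y 1, y 0) = logSlope B (z 1, y 0) := by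
  have hz' : z ∈ Metric.ball z r :=
    Metric.mem_ball_self (lt_of_le_of_lt dist_nonneg (Metric.mem_ball.1 hy))
  have hV : V y 0 * B (z 1, y 0) ≠ 0 := by
    rw [h.mul_eq hB hy]
    exact mul_ne_zero hz (hB0 z hz')
  have hVd : DifferentiableAt ℝ V y :=
    (h.smooth.contDiffAt (Metric.isOpen_ball.mem_nhds hy)).differentiableAt (by simp)
  have d1 : HasDerivAt (fun t : ℝ => y + t • stdVec 0) (stdVec 0) 0 := by
    simpa using ((hasDerivAt_id (0 : ℝ)).smul_const (stdVec 0)).const_add y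
  have hy0 : y + (0 : ℝ) • stdVec 0 = y := by simp
  have hf : HasFDerivAt (fun w => V w 0) (fderiv ℝ (fun w => V w 0) y) (y + (0 : ℝ) • stdVec 0) := by
    rw [hy0]
    exact (((contDiff_coord 0).contDiffAt.differentiableAt (by simp)).comp y hVd).hasFDerivAt
  have d2 := hf.comp_hasDerivAt (0 : ℝ) d1
  rw [fderiv_coord hVd] at d2
  have hB1 := hB _ (point_first_mem_ball hy)
  have hB2 : HasDerivAt (fun t => B (z 1, t)) (fderiv ℝ B (z 1, y 0) (0, 1)) (y 0 + 0) := by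
    rw [add_zero]
    exact deriv_second hB1
  have d3 := HasDerivAt.comp_const_add (y 0) 0 hB2
  have d4 := d2.mul d3
  have e : ((fun w => V w 0) ∘ fun t : ℝ => y + t • stdVec 0) * (fun t => B (z 1, y 0 + t))
      =ᶠ[𝓝 (0 : ℝ)] fun _ => V z 0 * B (z 1, z 0) := by
    filter_upwards [d1.continuousAt.preimage_mem_nhds
      (by rw [hy0]; exact Metric.isOpen_ball.mem_nhds hy)] with t ht
    have := h.mul_eq hB ht
    simpa using this
  have h0 := d4.unique ((hasDerivAt_const (0 : ℝ) (V z 0 * B (z 1, z 0))).congr_of_eventuallyEq e)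
  simp only [Function.comp_apply, hy0, add_zero] at h0
  have h1 := h.fderiv_first y hy
  have hV0 : V y 0 ≠ 0 := left_ne_zero_of_mul hV
  rw [logSlope, logSlope, div_eq_div_iff (hB0 y hy) (right_ne_zero_of_mul hV)]
  refine mul_left_cancel₀ hV0 ?_
  linear_combination B (z 1, y 0) * h1 - B (y 1, y 0) * h0

/-- For c = 1/B(I₀, x) the derivative ∂_x(cB) is cB times the difference of ∂_x log B at I and at
I₀, which vanishes by separability. -/
lemma isReducedField_inverse {B : ℝ × ℝ → ℝ} {z : E3} {r : ℝ}
    (hB : ∀ y ∈ Metric.ball z r, ContDiffAt ℝ ∞ B (y 1, y 0))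
    (hB0 : ∀ y ∈ Metric.ball z r, B (y 1, y 0) ≠ 0)
    (hs : ∀ y ∈ Metric.ball z r, logSlope B (y 1, y 0) = logSlope B (z 1, y 0)) :
    IsReducedField B (fun y => point (B (z 1, y 0))⁻¹ 0 0) (Metric.ball z r) := by
  have hd : ∀ y ∈ Metric.ball z r, ContDiffAt ℝ ∞ (fun y : E3 => (B (z 1, y 0))⁻¹) y := by
    intro y hy
    have h1 := hB _ (point_first_mem_ball hy)
    exact (h1.comp y (contDiff_const.prodMk (contDiff_coord 0)).contDiffAt).inv
      (hB0 _ (point_first_mem_ball hy))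
  have hsm : ContDiffOn ℝ ∞ (fun y => point (B (z 1, y 0))⁻¹ 0 0) (Metric.ball z r) := by
    refine contDiffOn_euclidean.2 fun i => ?_
    fin_cases i
    exacts [fun y hy => (hd y hy).contDiffWithinAt, contDiffOn_const, contDiffOn_const]
  have hf : ∀ y ∈ Metric.ball z r, ∀ v : E3,
      fderiv ℝ (fun y => point (B (z 1, y 0))⁻¹ 0 0) y v 0
        = -fderiv ℝ B (z 1, y 0) (0, 1) / B (z 1, y 0) ^ 2 * v 0 := by
    intro y hy v
    have hV := (hsm.contDiffAt (Metric.isOpen_ball.mem_nhds hy)).differentiableAt (by simp)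
    have h1 := (deriv_second ((hB _ (point_first_mem_ball hy)).differentiableAt (by simp))).inv
      (hB0 _ (point_first_mem_ball hy))
    have h2 := h1.comp_hasFDerivAt y (EuclideanSpace.proj (𝕜 := ℝ) (0 : Fin 3)).hasFDerivAt
    rw [← fderiv_coord hV]
    have h3 := congrArg (fun L => L v) h2.fderiv
    exact h3
  refine ⟨hsm, fun y _ => rfl, fun y _ => rfl, fun y hy => ?_, fun y hy => ?_, fun y hy => ?_⟩
  · rw [hf y hy]
    simp
  · rw [hf y hy]
    simp
  · rw [hf y hy, point_zero]
    have h1 := hs y hy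
    have h2 := hB0 _ (point_first_mem_ball hy)
    simp only [point_zero, point_one] at h2
    rw [logSlope, logSlope, div_eq_div_iff (hB0 y hy) h2] at h1
    have s0 : stdVec 0 0 = 1 := by simp
    rw [s0]
    field_simp
    linear_combination h1

/-! ### The space of germs of symmetries. -/

section Charts

variable {M : Type*} [TopologicalSpace M] [ChartedSpace E3 M] [IsManifold 𝓘(ℝ, E3) ∞ M]
  {ξ ξ' : ∀ m : M, Submodule ℝ (TangentSpace 𝓘(ℝ, E3) m)} {ε : ℝ}
  {X Y : ∀ m : M, TangentSpace 𝓘(ℝ, E3) m} {I J : M → ℝ} {e : OpenPartialHomeomorph M E3}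
  {B : ℝ × ℝ → ℝ} {m : M}

lemma eventually_plane {z : E3} {P : ℝ × ℝ → Prop} :
    (∀ᶠ w in 𝓝 (z 1, z 0), P w) ↔ ∀ᶠ y in 𝓝 z, P (y 1, y 0) := by
  have h : Filter.map planeProj (𝓝 z) = 𝓝 (planeProj z) :=
    le_antisymm planeProj.continuous.continuousAt (isOpenMap_planeProj.nhds_le z)
  rw [planeProj_apply] at h
  rw [← h, Filter.eventually_map]
  rfl

lemma vecInChart_eq_iff (he : e ∈ smoothCharts M) {p : M} (hp : p ∈ e.source)
    {Y Z : ∀ m : M, TangentSpace 𝓘(ℝ, E3) m} {c : ℝ} :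
    Z p = c • Y p ↔ vecInChart e Z (e p) = c • vecInChart e Y (e p) := by
  rw [vecInChart_apply e hp, vecInChart_apply e hp, ← map_smul]
  exact (chartD_injective he hp).eq_iff.symm

namespace IsGenericNormalForm

/-- Every symmetry is c ∂_x with c B(I₀, x) constant, so it vanishes near m if it vanishes at one
nearby point, and any two symmetries are proportional. A non-zero one forces separability;
conversely (1/B(I₀, x)) ∂_x is one. -/
theorem hasExactlyOneSymmetry_iff_logSlope (h : IsGenericNormalForm ξ ξ' ε I J m e B)
    (hε : ε = 1 ∨ ε = -1) (hD : ∀ p : M, 1 + I p * J p + ε * J p ^ 2 ≠ 0) :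
    HasExactlyOneSymmetry ξ ξ' m ↔
      ∀ᶠ y in 𝓝 (e m), logSlope B (y 1, y 0) = logSlope B (e m 1, y 0) := by
  have hm := h.1.2
  have hsrc : ∀ {r : ℝ}, 0 < r → ∀ᶠ p in 𝓝 m, p ∈ e.source ∧ e p ∈ Metric.ball (e m) r :=
    fun hr => (e.open_source.eventually_mem hm).and
      ((e.continuousAt hm).eventually (Metric.ball_mem_nhds _ hr))
  constructor
  · rintro ⟨Y, hY, hY0, -⟩
    obtain ⟨r, hr, hrt, hV⟩ := h.exists_isReducedField hε hD hY
    have hB := fun y hy => h.differentiableAt_plane (hrt (a := y) hy)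
    have hB0 := fun y hy => (h.pos_target (hrt (a := y) hy)).ne'
    filter_upwards [Metric.ball_mem_nhds (e m) hr] with y hy
    refine hV.logSlope_eq hB hB0 (fun h0 => hY0 ?_) hy
    filter_upwards [hsrc hr] with p hp
    have h1 := hV.mul_eq hB hp.2
    rw [h0, zero_mul] at h1
    have h2 := (mul_eq_zero.1 h1).resolve_right (hB0 _ (point_first_mem_ball hp.2))
    have h3 : vecInChart e Y (e p) = (0 : ℝ) • vecInChart e Y (e p) := by
      ext i
      fin_cases i
      · simpa using h2
      · simpa using hV.second _ hp.2
      · simpa using hV.third _ hp.2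
    have h4 := (vecInChart_eq_iff h.1.1 hp.1).2 h3
    rwa [zero_smul] at h4
  · intro hs
    obtain ⟨r, hr, hball⟩ := Metric.eventually_nhds_iff_ball.1
      (hs.and (e.open_target.eventually_mem (e.map_source hm)))
    have hrt : Metric.ball (e m) r ⊆ e.target := fun y hy => (hball y hy).2
    have hB0 := fun y hy => (h.pos_target (hrt (a := y) hy)).ne'
    have hV := isReducedField_inverse (fun y hy => h.contDiffAt_plane (hrt hy))
      hB0 (fun y hy => (hball y hy).1)
    refine ⟨_, h.isSymmetryNear_of_isReducedField Metric.isOpen_ball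
      (Metric.mem_ball_self hr) hV, fun h0 => ?_, fun Z hZ => ?_⟩
    · have h1 := chartD_fieldOfChart h.1.1 hm (fun y => point (B (e m 1, y 0))⁻¹ 0 0)
      rw [h0.self_of_nhds, map_zero] at h1
      have h2 := congrArg (fun v : E3 => v 0) h1
      exact hB0 _ (Metric.mem_ball_self hr) (inv_eq_zero.1 h2.symm)
    · obtain ⟨r', hr', hrt', hV'⟩ := h.exists_isReducedField hε hD hZ
      -- The factor is the constant value of c B(I₀, x) for the given symmetry.
      refine ⟨vecInChart e Z (e m) 0 * B (e m 1, e m 0), ?_⟩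
      filter_upwards [hsrc hr'] with p hp
      rw [vecInChart_eq_iff h.1.1 hp.1, vecInChart_apply e hp.1 (fieldOfChart _ _),
        chartD_fieldOfChart h.1.1 hp.1]
      have h1 := hV'.mul_eq (fun y hy => h.differentiableAt_plane (hrt' hy)) hp.2
      have h2 := (h.pos_target (hrt' (point_first_mem_ball hp.2))).ne'
      simp only [point_zero, point_one] at h2
      ext i
      fin_cases i
      · simp only [PiLp.smul_apply, smul_eq_mul, Fin.zero_eta, point_zero]
        rw [← h1, mul_inv_cancel_right₀ h2]
      · simpa using hV'.second _ hp.2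
      · simpa using hV'.third _ hp.2

theorem hasExactlyOneSymmetry_iff (h : IsGenericNormalForm ξ ξ' ε I J m e B)
    (hε : ε = 1 ∨ ε = -1) (hD : ∀ p : M, 1 + I p * J p + ε * J p ^ 2 ≠ 0) :
    HasExactlyOneSymmetry ξ ξ' m ↔ IsSeparableNear B (I m, e m 0) := by
  have hm := h.1.2
  rw [h.hasExactlyOneSymmetry_iff_logSlope hε hD, ← (h.2.1 m hm).1,
    isSeparableNear_iff h.isOpen_plane h.2.2.1 h.pos_plane
      (Set.mem_image_of_mem (fun y : E3 => (y 1, y 0)) (e.map_source hm)), eventually_plane]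

end IsGenericNormalForm

end Charts

/-! ### The invariants `H`, `F`, `G` -/

/-- The derivative of `log B` with respect to the first variable. -/
def firstSlope (B : ℝ × ℝ → ℝ) (w : ℝ × ℝ) : ℝ := fderiv ℝ B w (1, 0) / B w

section Plane

variable {Ω : Set (ℝ × ℝ)} {B : ℝ × ℝ → ℝ}

lemma contDiffOn_firstSlope (hΩ : IsOpen Ω) (hB : ContDiffOn ℝ ∞ B Ω) (h0 : ∀ w ∈ Ω, 0 < B w) :
    ContDiffOn ℝ ∞ (firstSlope B) Ω :=
  ((hB.fderiv_of_isOpen hΩ (by simp)).clm_apply contDiffOn_const).div hB fun w hw => (h0 w hw).ne'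

/-- Both sides are mixed second derivatives of log B. -/
lemma fderiv_firstSlope (hΩ : IsOpen Ω) (hB : ContDiffOn ℝ ∞ B Ω) (h0 : ∀ w ∈ Ω, 0 < B w)
    {w : ℝ × ℝ} (hw : w ∈ Ω) :
    fderiv ℝ (firstSlope B) w (0, 1) = fderiv ℝ (logSlope B) w (1, 0) := by
  have hlog : ContDiffAt ℝ ∞ (fun w => Real.log (B w)) w :=
    (hB.contDiffAt (hΩ.mem_nhds hw)).log (h0 w hw).ne'
  have hslope : ∀ a : ℝ × ℝ, (fun w => fderiv ℝ B w a / B w)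
      =ᶠ[𝓝 w] fun w => fderiv ℝ (fun w => Real.log (B w)) w a := by
    intro a
    filter_upwards [hΩ.mem_nhds hw] with u hu
    rw [fderiv.log ((hB.contDiffAt (hΩ.mem_nhds hu)).differentiableAt (by simp)) (h0 u hu).ne',
      smul_apply, smul_eq_mul, div_eq_inv_mul]
  have hd : DifferentiableAt ℝ (fderiv ℝ fun w => Real.log (B w)) w :=
    (hlog.fderiv_right (m := ∞) (by simp)).differentiableAt (by simp)
  have happ : ∀ a b : ℝ × ℝ, fderiv ℝ (fun w => fderiv ℝ B w a / B w) w b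
      = fderiv ℝ (fderiv ℝ fun w => Real.log (B w)) w b a := by
    intro a b
    rw [(hslope a).fderiv_eq, fderiv_clm_apply hd (differentiableAt_const a)]
    simp
  have hsymm : IsSymmSndFDerivAt ℝ (fun w => Real.log (B w)) w :=
    hlog.isSymmSndFDerivAt (by simpa using two_le_infty)
  exact (happ _ _).trans ((hsymm _ _).trans (happ _ _).symm)

lemma isSeparableNear_iff_firstSlope (hΩ : IsOpen Ω) (hB : ContDiffOn ℝ ∞ B Ω)
    (h0 : ∀ w ∈ Ω, 0 < B w) {z : ℝ × ℝ} (hz : z ∈ Ω) :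
    IsSeparableNear B z ↔ ∀ᶠ w in 𝓝 z, fderiv ℝ (firstSlope B) w (0, 1) = 0 := by
  refine Filter.eventually_congr ?_
  filter_upwards [hΩ.eventually_mem hz] with w hw
  rw [deriv_deriv_log hΩ hB h0 hw, fderiv_firstSlope hΩ hB h0 hw,
    (deriv_first (((contDiffOn_logSlope hΩ hB h0).contDiffAt
      (hΩ.mem_nhds hw)).differentiableAt (by simp))).deriv]

end Plane

/-! ### The form `η` in a generic chart. -/

section Charts

open IsNormalizedOn (basicForm)

variable {M : Type*} [TopologicalSpace M] [ChartedSpace E3 M] [IsManifold 𝓘(ℝ, E3) ∞ M]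
  {ξ ξ' : ∀ m : M, Submodule ℝ (TangentSpace 𝓘(ℝ, E3) m)} {ε : ℝ}
  {X : ∀ m : M, TangentSpace 𝓘(ℝ, E3) m} {I J : M → ℝ} {e e' : OpenPartialHomeomorph M E3}
  {α β α' β' : E3 → E3 →L[ℝ] ℝ} {B : ℝ × ℝ → ℝ} {m : M}

/-- Normalized forms are unique. -/
lemma IsAdapted.pullForm_eq (h : IsAdapted ξ ξ' ε X I J e α β)
    (h' : IsAdapted ξ ξ' ε X I J e' α' β') {p : M} (hp : p ∈ e.source) (hp' : p ∈ e'.source) :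
    pullForm (transition e' e) α (e' p) = α' (e' p) ∧
      pullForm (transition e' e) β (e' p) = β' (e' p) := by
  have hy := e.map_source hp
  have hy' := e'.map_source hp'
  obtain ⟨c, hc, h1, h2⟩ := exists_factor_of_forms h.mem h'.mem h.kernel
    h.normalized.toIsBalancedOn h'.kernel h'.normalized.toIsBalancedOn hp hy hp' hy'
  obtain ⟨w₁, w₂, hw1, hw2, -, -⟩ := h'.normalized.frame _ hy'
  have h3 := congrArg (fun L => L w₁) (fderiv_transition_fun h.mem h'.mem (f := I) hp hp'
    (h.normalized.differentiableAt_invariant hy))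
  have e1 : pullForm (transition e' e) α (e' p) w₁ = c := by
    rw [h1, smul_apply, hw1, smul_eq_mul, mul_one]
  have e2 : pullForm (transition e' e) β (e' p) w₁ = 0 := by
    rw [h2, smul_apply, hw2, smul_zero]
  have ht : transition e' e (e' p) = e p := by rw [transition, e'.left_inv hp']
  rw [pullForm_apply, ht] at e1 e2
  -- Both pairs satisfy dI = α + Jβ; evaluation on w₁ shows that the common factor is 1.
  rw [h.normalized.fderiv_invariant _ hy, h'.normalized.fderiv_invariant _ hy'] at h3
  simp only [add_apply, smul_apply, smul_eq_mul, ContinuousLinearMap.comp_apply, hw1, hw2, e1,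
    e2, mul_zero, add_zero] at h3
  rw [h1, h2, ← h3, one_smul, one_smul]
  exact ⟨rfl, rfl⟩

lemma IsAdapted.etaForm_eq (h : IsAdapted ξ ξ' ε X I J e α β)
    (h' : IsAdapted ξ ξ' ε X I J e' α' β') {p : M} (hp : p ∈ e.source) (hp' : p ∈ e'.source) :
    etaForm ε I J e' α' β' (e' p)
      = pullForm (transition e' e) (etaForm ε I J e α β) (e' p) := by
  obtain ⟨h1, h2⟩ := h.pullForm_eq h' hp hp'
  have ht : transition e' e (e' p) = e p := by rw [transition, e'.left_inv hp']
  ext v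
  simp only [etaForm, ← h1, ← h2, pullForm_apply, ht, e.left_inv hp, e'.left_inv hp', sub_apply,
    smul_apply]

lemma IsAdapted.smooth_etaForm (h : IsAdapted ξ ξ' ε X I J e α β) :
    ContDiffOn ℝ ∞ (etaForm ε I J e α β) e.target := by
  have hI := h.normalized.smooth_invariant.div_const 2
  have hJ := h.normalized.smoothJ
  exact ((hJ.add (contDiffOn_const.mul hI)).smul h.normalized.smooth₁).sub
    ((contDiffOn_const.mul ((hI.mul hJ).add contDiffOn_const)).smul h.normalized.smooth₂)

lemma IsAdapted.extD_etaForm_eq (h : IsAdapted ξ ξ' ε X I J e α β)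
    (h' : IsAdapted ξ ξ' ε X I J e' α' β') {p : M} (hp : p ∈ e.source) (hp' : p ∈ e'.source)
    (u v : E3) :
    extD (etaForm ε I J e' α' β') (e' p) u v
      = extD (etaForm ε I J e α β) (e p) (fderiv ℝ (transition e' e) (e' p) u)
          (fderiv ℝ (transition e' e) (e' p) v) := by
  have ht : transition e' e (e' p) = e p := by rw [transition, e'.left_inv hp']
  have hmem := mem_transitionDomain hp' hp (e.map_source hp)
  have hnhds := (isOpen_transitionDomain e' e e.open_target).mem_nhds hmem
  have ev : etaForm ε I J e' α' β'
      =ᶠ[𝓝 (e' p)] pullForm (transition e' e) (etaForm ε I J e α β) := by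
    filter_upwards [hnhds] with y hy
    obtain ⟨q, hq', hq, -, rfl, -⟩ := exists_of_mem_transitionDomain hy
    exact h.etaForm_eq h' hq hq'
  have hd := (h.smooth_etaForm.contDiffAt
    (e.open_target.mem_nhds (e.map_source hp))).differentiableAt (by simp)
  rw [← ht] at hd
  rw [extD_congr ev, extD_pullForm ((contDiffOn_transitionDomain h.mem h'.mem).contDiffAt hnhds) hd,
    ht]

/-- A generic chart with its normalized forms. -/
structure IsGenericData (ξ ξ' : ∀ m : M, Submodule ℝ (TangentSpace 𝓘(ℝ, E3) m)) (ε : ℝ)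
    (X : ∀ m : M, TangentSpace 𝓘(ℝ, E3) m) (I J : M → ℝ) (m : M)
    (e : OpenPartialHomeomorph M E3) (α β : E3 → E3 →L[ℝ] ℝ) (B : ℝ × ℝ → ℝ) : Prop where
  adapted : IsAdapted ξ ξ' ε X I J e α β
  normalForm : IsGenericNormalForm ξ ξ' ε I J m e B
  form : ∀ y ∈ e.target, ∀ v : E3, basicForm ε (fun y => I (e.symm y)) (fun y => J (e.symm y))
    α β y v = B (y 1, y 0) * v 0

namespace IsGenericData

lemma fderiv_invariant (h : IsGenericData ξ ξ' ε X I J m e α β B) {y : E3} (hy : y ∈ e.target)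
    (v : E3) : fderiv ℝ (fun y => I (e.symm y)) y v = v 1 :=
  fderiv_of_coordinate (fun p hp => (h.normalForm.2.1 p hp).1) hy v

lemma invariant_eq (h : IsGenericData ξ ξ' ε X I J m e α β B) {y : E3} (hy : y ∈ e.target) :
    I (e.symm y) = y 1 := by
  rw [← (h.normalForm.2.1 _ (e.map_target hy)).1, e.right_inv hy]

/-- Algebraically η = −ε(θ + (I/2) dI) with the basic form θ = B dx, so η no longer involves J. -/
lemma etaForm_eq (h : IsGenericData ξ ξ' ε X I J m e α β B) (hε : ε = 1 ∨ ε = -1) {y : E3}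
    (hy : y ∈ e.target) : etaForm ε I J e α β y
      = coordForm (fun y => -ε / 2 * y 1) (fun y => -ε * B (y 1, y 0)) y := by
  have hεε : ε * ε = 1 := by rcases hε with rfl | rfl <;> norm_num
  ext v
  have h1 := h.form y hy v
  have h2 := h.fderiv_invariant hy v
  rw [h.adapted.normalized.fderiv_invariant y hy] at h2
  rw [coordForm_apply]
  simp only [basicForm, etaForm, add_apply, sub_apply, smul_apply, smul_eq_mul,
    h.invariant_eq hy] at h1 h2 ⊢
  linear_combination -ε * h1 - ε * y 1 / 2 * h2 - J (e.symm y) * α y v * hεε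

/-- In the chart dη = −ε ∂_I B dI ∧ dx and dI ∧ η = −ε B dI ∧ dx, whence H = ∂_I log B. -/
lemma extD_etaForm (h : IsGenericData ξ ξ' ε X I J m e α β B) (hε : ε = 1 ∨ ε = -1) {y : E3}
    (hy : y ∈ e.target) (u v : E3) : extD (etaForm ε I J e α β) y u v
      = firstSlope B (y 1, y 0) * wedge (fderiv ℝ (fun z => I (e.symm z)) y)
          (etaForm ε I J e α β y) u v := by
  have ev : etaForm ε I J e α β
      =ᶠ[𝓝 y] coordForm (fun y => -ε / 2 * y 1) (fun y => -ε * B (y 1, y 0)) := by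
    filter_upwards [e.open_target.mem_nhds hy] with z hz using h.etaForm_eq hε hz
  have hBd := h.normalForm.differentiableAt_plane hy
  have hb := differentiableAt_plane hBd
  have h1 : DifferentiableAt ℝ (fun z : E3 => z 1) y :=
    (contDiff_coord 1).contDiffAt.differentiableAt (by simp)
  have hB0 := (h.normalForm.pos_target hy).ne'
  rw [extD_congr ev, h.etaForm_eq hε hy, extD, fderiv_coordForm (h1.const_mul _) (hb.const_mul _),
    fderiv_coordForm (h1.const_mul _) (hb.const_mul _), wedge, h.fderiv_invariant hy,
    h.fderiv_invariant hy, coordForm_apply, coordForm_apply, fderiv_const_mul h1,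
    fderiv_const_mul hb, firstSlope]
  simp only [smul_apply, smul_eq_mul, fderiv_coord_apply, fderiv_plane hBd]
  field_simp
  ring

lemma exists_wedge_ne_zero (h : IsGenericData ξ ξ' ε X I J m e α β B) (hε : ε = 1 ∨ ε = -1)
    {y : E3} (hy : y ∈ e.target) : wedge (fderiv ℝ (fun z => I (e.symm z)) y)
      (etaForm ε I J e α β y) (stdVec 1) (stdVec 0) ≠ 0 := by
  have hε0 : ε ≠ 0 := by rcases hε with rfl | rfl <;> norm_num
  have hB0 := (h.normalForm.pos_target hy).ne'
  rw [wedge, h.fderiv_invariant hy, h.fderiv_invariant hy, h.etaForm_eq hε hy, coordForm_apply]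
  simp [hε0, hB0]

end IsGenericData

end Charts

/-! ### The functions `H`, `F`, `G` on the manifold. -/

section Charts

variable {M : Type*} [TopologicalSpace M] [ChartedSpace E3 M] [IsManifold 𝓘(ℝ, E3) ∞ M]
  {ξ ξ' : ∀ m : M, Submodule ℝ (TangentSpace 𝓘(ℝ, E3) m)} {ε : ℝ}
  {X : ∀ m : M, TangentSpace 𝓘(ℝ, E3) m} {I J : M → ℝ} {e e' : OpenPartialHomeomorph M E3}
  {α β α' β' : E3 → E3 →L[ℝ] ℝ} {B B' : ℝ × ℝ → ℝ} {m m' : M}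

namespace IsGenericData

lemma wedge_transition (h : IsGenericData ξ ξ' ε X I J m e α β B)
    (h' : IsGenericData ξ ξ' ε X I J m' e' α' β' B') {p : M}
    (hp : p ∈ e.source) (hp' : p ∈ e'.source) (u v : E3) :
    wedge (fderiv ℝ (fun z => I (e.symm z)) (e p)) (etaForm ε I J e α β (e p))
        (fderiv ℝ (transition e' e) (e' p) u) (fderiv ℝ (transition e' e) (e' p) v)
      = wedge (fderiv ℝ (fun z => I (e'.symm z)) (e' p)) (etaForm ε I J e' α' β' (e' p)) u v := by
  have ht : transition e' e (e' p) = e p := by rw [transition, e'.left_inv hp']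
  rw [h.adapted.etaForm_eq h'.adapted hp hp', fderiv_transition_fun h.adapted.mem h'.adapted.mem
    (f := I) hp hp' (h.adapted.normalized.differentiableAt_invariant (e.map_source hp))]
  simp only [wedge, pullForm_apply, ht, ContinuousLinearMap.comp_apply]

/-- Both dη and dI ∧ η are independent of the chart, and dI ∧ η ≠ 0; so is their quotient. -/
lemma firstSlope_eq (h : IsGenericData ξ ξ' ε X I J m e α β B)
    (h' : IsGenericData ξ ξ' ε X I J m' e' α' β' B') (hε : ε = 1 ∨ ε = -1) {p : M}
    (hp : p ∈ e.source) (hp' : p ∈ e'.source) :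
    firstSlope B (e p 1, e p 0) = firstSlope B' (e' p 1, e' p 0) := by
  have h1 := h.adapted.extD_etaForm_eq h'.adapted hp hp' (stdVec 1) (stdVec 0)
  rw [h.extD_etaForm hε (e.map_source hp), h'.extD_etaForm hε (e'.map_source hp'),
    h.wedge_transition h' hp hp'] at h1
  exact (mul_right_cancel₀ (h'.exists_wedge_ne_zero hε (e'.map_source hp')) h1).symm

lemma contDiffAt_firstSlope (h : IsGenericData ξ ξ' ε X I J m e α β B) {y : E3}
    (hy : y ∈ e.target) : ContDiffAt ℝ ∞ (firstSlope B) (y 1, y 0) :=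
  (contDiffOn_firstSlope h.normalForm.isOpen_plane h.normalForm.2.2.1
    h.normalForm.pos_plane).contDiffAt (h.normalForm.isOpen_plane.mem_nhds ⟨y, hy, rfl⟩)

variable {H : M → ℝ}

lemma fderiv_H (h : IsGenericData ξ ξ' ε X I J m e α β B)
    (hH : ∀ p ∈ e.source, H p = firstSlope B (e p 1, e p 0)) {y : E3} (hy : y ∈ e.target) :
    ContDiffAt ℝ ∞ (fun z => H (e.symm z)) y ∧ ∀ v, fderiv ℝ (fun z => H (e.symm z)) y v
      = v 1 * fderiv ℝ (firstSlope B) (y 1, y 0) (1, 0)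
        + v 0 * fderiv ℝ (firstSlope B) (y 1, y 0) (0, 1) := by
  have hS := h.contDiffAt_firstSlope hy
  have ev : (fun z => H (e.symm z)) =ᶠ[𝓝 y] fun z => firstSlope B (z 1, z 0) := by
    filter_upwards [e.open_target.mem_nhds hy] with z hz
    rw [hH _ (e.map_target hz), e.right_inv hz]
  refine ⟨ContDiffAt.congr_of_eventuallyEq (hS.comp y (f := planeProj)
    planeProj.contDiff.contDiffAt) ev, fun v => ?_⟩
  rw [ev.fderiv_eq, fderiv_plane (hS.differentiableAt (by simp))]

/-- Insert dx = −(εη + (I/2) dI)/B into dH = ∂_I H dI + ∂_x H dx. -/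
lemma fderiv_H_eq (h : IsGenericData ξ ξ' ε X I J m e α β B) (hε : ε = 1 ∨ ε = -1)
    (hH : ∀ p ∈ e.source, H p = firstSlope B (e p 1, e p 0)) {y : E3} (hy : y ∈ e.target) :
    fderiv ℝ (fun z => H (e.symm z)) y
      = (fderiv ℝ (firstSlope B) (y 1, y 0) (1, 0)
          - fderiv ℝ (firstSlope B) (y 1, y 0) (0, 1) * y 1 / (2 * B (y 1, y 0))) •
            fderiv ℝ (fun z => I (e.symm z)) y
        + (-ε * fderiv ℝ (firstSlope B) (y 1, y 0) (0, 1) / B (y 1, y 0)) •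
            etaForm ε I J e α β y := by
  have hεε : ε * ε = 1 := by rcases hε with rfl | rfl <;> norm_num
  have hB0 := (h.normalForm.pos_target hy).ne'
  ext v
  rw [(h.fderiv_H hH hy).2, add_apply, smul_apply, smul_apply, h.fderiv_invariant hy,
    h.etaForm_eq hε hy, coordForm_apply]
  simp only [smul_eq_mul]
  field_simp
  linear_combination (-(fderiv ℝ (firstSlope B) (y 1, y 0) (0, 1) * (y 1 * v 1
    + 2 * B (y 1, y 0) * v 0))) * hεε

/-- Evaluation on ∂_x, where dI vanishes and η equals −εB, gives ∂_x H = −εB g. -/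
lemma eq_zero_iff (h : IsGenericData ξ ξ' ε X I J m e α β B) (hε : ε = 1 ∨ ε = -1)
    (hH : ∀ p ∈ e.source, H p = firstSlope B (e p 1, e p 0)) {y : E3} (hy : y ∈ e.target)
    {f g : ℝ} (hfg : fderiv ℝ (fun z => H (e.symm z)) y
      = f • fderiv ℝ (fun z => I (e.symm z)) y + g • etaForm ε I J e α β y) :
    g = 0 ↔ fderiv ℝ (firstSlope B) (y 1, y 0) (0, 1) = 0 := by
  have hε0 : ε ≠ 0 := by rcases hε with rfl | rfl <;> norm_num
  have hB0 := (h.normalForm.pos_target hy).ne'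
  have h1 := congrArg (fun L => L (stdVec 0)) hfg
  simp only [(h.fderiv_H hH hy).2, add_apply, smul_apply, smul_eq_mul, h.fderiv_invariant hy,
    h.etaForm_eq hε hy, coordForm_apply] at h1
  simp at h1
  rw [h1]
  simp [hε0, hB0]

end IsGenericData

/-- H is read off at each point from one chosen generic chart and then equals ∂_I log B in every
generic chart. Likewise the coefficients F and G of dH with respect to dI and η carry over between
charts, since both forms are intrinsic. -/
theorem exists_HFG (hε : ε = 1 ∨ ε = -1)
    (hdata : ∀ m : M, ∃ (e : OpenPartialHomeomorph M E3) (α β : E3 → E3 →L[ℝ] ℝ)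
      (B : ℝ × ℝ → ℝ), IsGenericData ξ ξ' ε X I J m e α β B) :
    ∃ H F G : M → ℝ, IsHFGInvariant ξ ξ' ε X I J H F G ∧
      ∀ (m : M) (e : OpenPartialHomeomorph M E3) (α β : E3 → E3 →L[ℝ] ℝ) (B : ℝ × ℝ → ℝ),
        IsGenericData ξ ξ' ε X I J m e α β B →
          ((∀ᶠ p in 𝓝 m, G p = 0) ↔ IsSeparableNear B (I m, e m 0)) := by
  choose c a b A hd using hdata
  set H : M → ℝ := fun p => firstSlope (A p) (c p p 1, c p p 0) with hHdef
  have hHc : ∀ {m e α β B}, IsGenericData ξ ξ' ε X I J m e α β B →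
      ∀ p ∈ e.source, H p = firstSlope B (e p 1, e p 0) := fun h p hp =>
    (hd p).firstSlope_eq h hε (hd p).normalForm.1.2 hp
  have hex : ∀ p : M, ∃ f g : ℝ, ∀ m e α β B, IsGenericData ξ ξ' ε X I J m e α β B →
      p ∈ e.source → fderiv ℝ (fun z => H (e.symm z)) (e p)
        = f • fderiv ℝ (fun z => I (e.symm z)) (e p) + g • etaForm ε I J e α β (e p) := by
    intro p
    have hpc := (hd p).normalForm.1.2
    have hyc := (c p).map_source hpc
    obtain ⟨f, g, h0⟩ : ∃ f g : ℝ, fderiv ℝ (fun z => H ((c p).symm z)) (c p p)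
        = f • fderiv ℝ (fun z => I ((c p).symm z)) (c p p) + g • etaForm ε I J (c p) (a p) (b p)
          (c p p) := ⟨_, _, (hd p).fderiv_H_eq hε (hHc (hd p)) hyc⟩
    refine ⟨f, g, fun m e α β B h hp => ?_⟩
    have ht : transition e (c p) (e p) = c p p := by rw [transition, e.left_inv hp]
    rw [fderiv_transition_fun (hd p).adapted.mem h.adapted.mem (f := H) hpc hp
        (((hd p).fderiv_H (hHc (hd p)) hyc).1.differentiableAt (by simp)),
      fderiv_transition_fun (hd p).adapted.mem h.adapted.mem (f := I) hpc hp
        ((hd p).adapted.normalized.differentiableAt_invariant hyc), h0,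
      (hd p).adapted.etaForm_eq h.adapted hpc hp]
    ext v
    simp only [ContinuousLinearMap.comp_apply, add_apply, smul_apply, pullForm_apply, ht]
  choose F G hFG using hex
  refine ⟨H, F, G, ⟨fun p => ?_, fun m => ?_⟩, fun m e α β B h => ?_⟩
  · have hpc := (hd p).normalForm.1.2
    exact (contMDiffAt_iff_chart (hd p).adapted.mem hpc).2
      ((hd p).fderiv_H (hHc (hd p)) ((c p).map_source hpc)).1
  · have hA := (hd m).adapted
    refine ⟨c m, a m, b m, (hd m).normalForm.1,
      IsBalancedOn.isBalanced hA.mem hA.kernel hA.normalized.toIsBalancedOn, fun y hy => ⟨?_, ?_, ?_⟩⟩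
    · exact hA.normalized.fderiv_invariant y hy
    · intro u v
      rw [hHc (hd m) _ ((c m).map_target hy), (c m).right_inv hy]
      exact (hd m).extD_etaForm hε hy u v
    · have := hFG ((c m).symm y) m _ _ _ _ (hd m) ((c m).map_target hy)
      rwa [(c m).right_inv hy] at this
  · have hm := h.normalForm.1.2
    have hmt : (e m 1, e m 0) ∈ (fun y : E3 => (y 1, y 0)) '' e.target :=
      ⟨e m, e.map_source hm, rfl⟩
    rw [← (h.normalForm.2.1 m hm).1, isSeparableNear_iff_firstSlope h.normalForm.isOpen_plane
      h.normalForm.2.2.1 h.normalForm.pos_plane hmt, eventually_plane, ← eventually_chart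
      (P := fun y => fderiv ℝ (firstSlope B) (y 1, y 0) (0, 1) = 0) hm]
    refine Filter.eventually_congr ?_
    filter_upwards [e.open_source.mem_nhds hm] with p hp
    exact h.eq_zero_iff hε (hHc h) (e.map_source hp) (hFG p m e α β B h hp)

lemma IsAdapted.axisDeriv_eq (h : IsAdapted ξ ξ' ε X I J e α β) (hε : ε = 1 ∨ ε = -1)
    (hm : m ∈ e.source) : axisDeriv X J m = 1 + I m * J m + ε * J m ^ 2 := by
  have hy := e.map_source hm
  have h1 := (h.normalized.structure_equations hε hy).1
  rw [vecInChart_apply e hm, e.left_inv hm] at h1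
  rw [axisDeriv, mfderiv_eq_chart h.mem hm (h.normalized.differentiableAt_J hy), h1]

end Charts

end

end ContactPair

/-! ### The main theorem. -/

theorem mainTheorem6 {M : Type*} [TopologicalSpace M] [ChartedSpace ContactPair.E3 M]
    [IsManifold 𝓘(ℝ, ContactPair.E3) ∞ M]
    (ξ ξ' : ∀ m : M, Submodule ℝ (TangentSpace 𝓘(ℝ, ContactPair.E3) m))
    (ε : ℝ) (hε : ε = 1 ∨ ε = -1)
    (hpair : ContactPair.IsContactPair ξ ξ' ε)
    (X : ∀ m : M, TangentSpace 𝓘(ℝ, ContactPair.E3) m) (I : M → ℝ)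
    (hI : ContactPair.IsGeneratingInvariant ξ ξ' ε X I)
    (hS : ContactPair.SchwarzianVanishes ξ ξ')
    (hdI : ∀ m : M, mfderiv 𝓘(ℝ, ContactPair.E3) 𝓘(ℝ, ℝ) I m ≠ 0)
    -- up to exchanging the two distributions, `j₁ ≠ 0`: the form `dI` is non-zero on `ξ'`
    (hj : ∀ m : M, ∃ v ∈ ξ' m, mfderiv 𝓘(ℝ, ContactPair.E3) 𝓘(ℝ, ℝ) I m v ≠ 0) :
    ∃ J : M → ℝ, ContMDiff 𝓘(ℝ, ContactPair.E3) 𝓘(ℝ, ℝ) ∞ J ∧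
      ContactPair.IsJInvariant ξ ξ' ε X I J ∧
      ((∀ m : M, ContactPair.axisDeriv X J m ≠ 0) →
        (∀ m : M, ∃ (e : OpenPartialHomeomorph M ContactPair.E3) (B : ℝ × ℝ → ℝ),
          ContactPair.IsGenericNormalForm ξ ξ' ε I J m e B) ∧
        (∀ (m : M) (e : OpenPartialHomeomorph M ContactPair.E3) (B : ℝ × ℝ → ℝ),
          ContactPair.IsGenericNormalForm ξ ξ' ε I J m e B →
          (ContactPair.HasExactlyOneSymmetry ξ ξ' m ↔
            ContactPair.IsSeparableNear B (I m, e m 0))) ∧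
        (∃ H F G : M → ℝ, ContactPair.IsHFGInvariant ξ ξ' ε X I J H F G ∧
          ∀ m : M, ContactPair.HasExactlyOneSymmetry ξ ξ' m ↔ ∀ᶠ p in 𝓝 m, G p = 0)) ∧
      ((∀ m : M, ContactPair.axisDeriv X J m = 0) →
        ∀ m : M, ∃ (e : OpenPartialHomeomorph M ContactPair.E3) (j : ℝ → ℝ),
          ContactPair.IsDegenerateNormalForm ξ ξ' ε I J m e j) := by
  obtain ⟨J, hJ, hJI, hforms⟩ := ContactPair.exists_normalized_forms hε hpair hI hS hj
  refine ⟨J, hJ, hJI, fun hJ' => ?_, fun hJ' m => ?_⟩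
  -- By J' = 1 + IJ + εJ², the two cases J' ≠ 0 and J' ≡ 0 are those of a nowhere zero and an
  -- identically zero value of the quadratic.
  · have hD : ∀ p : M, 1 + I p * J p + ε * J p ^ 2 ≠ 0 := by
      intro p
      obtain ⟨e, α, β, he, hp, hK, hN⟩ := hforms p
      rw [← ContactPair.IsAdapted.axisDeriv_eq (X := X) ⟨he, hK, hN⟩ hε hp]
      exact hJ' p
    have hdata : ∀ m : M, ∃ (e : OpenPartialHomeomorph M ContactPair.E3)
        (α β : ContactPair.E3 → ContactPair.E3 →L[ℝ] ℝ) (B : ℝ × ℝ → ℝ),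
        ContactPair.IsGenericData ξ ξ' ε X I J m e α β B := by
      intro m
      obtain ⟨e, α, β, he, hm, hK, hN⟩ := hforms m
      obtain ⟨e', α', β', B, h1, h2, h3⟩ :=
        ContactPair.IsAdapted.exists_generic_chart ⟨he, hK, hN⟩ hε hD hm
      exact ⟨e', α', β', B, h1, h2, h3⟩
    refine ⟨fun m => ?_, fun m e B h => h.hasExactlyOneSymmetry_iff hε hD, ?_⟩
    · obtain ⟨e, α, β, B, h⟩ := hdata m
      exact ⟨e, B, h.normalForm⟩
    · obtain ⟨H, F, G, h, hG⟩ := ContactPair.exists_HFG hε hdata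
      refine ⟨H, F, G, h, fun m => ?_⟩
      obtain ⟨e, α, β, B, hd⟩ := hdata m
      rw [hG m e α β B hd, hd.normalForm.hasExactlyOneSymmetry_iff hε hD]
  · obtain ⟨e, α, β, he, hm, hK, hN⟩ := hforms m
    refine ContactPair.IsAdapted.exists_degenerate_chart (X := X) ⟨he, hK, hN⟩ hε (fun p => ?_) hm
    obtain ⟨e, α, β, he, hp, hK, hN⟩ := hforms p
    rw [← ContactPair.IsAdapted.axisDeriv_eq (X := X) ⟨he, hK, hN⟩ hε hp]
    exact hJ' p
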